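/- **Setting.** Let $\mathbb{R}^\infty$ be the space of finitely supported real sequences with the inductive limit topology of the subspaces $\mathbb{R}^n$, let $e_1,e_2,\dots$ be its standard basis, and let $\mathbb{R}_+^\infty\subset\mathbb{R}^\infty$ be the subsemigroup of sequences with nonnegative entries, with the subspace topology. Hilbert spaces are complex and separable. An *isometric representation* of $\mathbb{R}_+^\infty$ on a Hilbert space $\mathcal K$ is a strongly continuous semigroup $V=(V_x)_{x\in\mathbb{R}_+^\infty}$ of isometries on $\mathcal K$ (so $V_0=1$, $V_{x+y}=V_xV_y$). It is *doubly commuting* if $V_{te_i}^*V_{se_j}=V_{se_j}V_{te_i}^*$ for all $s,t\ge 0$ and $i\ne j$, and *irreducible* if $\mathcal K\neq 0$ and only the scalars commute with all $V_x$ and $V_x^*$. It is a *railway representation* if it is unitarily equivalent to the direct sum of countably infinitely many copies of one irreducible isometric representation. Fix an infinite dimensional separable Hilbert space $\mathcal L$. On the set of railway representations on $\mathcal L$, consider the topology generated by the sets $$X(V,K,\epsilon,F)=\Big\{W:\ \max_{\xi\in F}\ \sup_{x\in K}\max\big(\|(V_x-W_x)\xi\|,\|(V_x^*-W_x^*)\xi\|\big)<\epsilon\Big\},$$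 where $V$ is a railway representation on $\mathcal L$, $K\subset\mathbb{R}_+^\infty$ is compact, $\epsilon>0$, and $F\subset\mathcal L$ is finite and non-empty. The quotient by unitary equivalence, with the quotient topology (the *Fell topology*), is $\mathcal{R}(\mathbb{R}_+^\infty)$. Let $\mathcal{R}_0(\mathbb{R}_+^\infty)\subset\mathcal{R}(\mathbb{R}_+^\infty)$ be the subspace of classes of doubly commuting representations. If $W$ is a doubly commuting railway representation on some Hilbert space, then $[W]\in\mathcal{R}_0(\mathbb{R}_+^\infty)$ denotes the class of the representations on $\mathcal L$ that are unitarily equivalent to $W$. Let $\gamma$ be the standard Gaussian measure on $\mathbb{R}$ and $\mu=\bigotimes_{n=1}^\infty\gamma$ on $\mathbb{R}^{\mathbb N}$. Let $X$ be the set of real sequences $a=(a_n)_{n\ge1}$ with $a_n\le 0$ for all $n$ and $\prod_{n=1}^\infty\gamma([a_n,\infty))>0$. For $a\in X$ put $A=\prod_{n=1}^\infty[a_n,\infty)$ and regard $L^2(A)$ as the closed subspace of $L^2(\mathbb{R}^{\mathbb N},\mu)$ of the functions vanishing a.e. outside $A$. For $x\in\mathbb{R}_+^\infty$ let $T_x(y)=x+y$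 on $\mathbb{R}^{\mathbb N}$. The Koopman operator $$U_xf=\sqrt{\frac{d(\mu\circ T_x^{-1})}{d\mu}}\;f\circ T_x^{-1}$$ on $L^2(\mathbb{R}^{\mathbb N},\mu)$ leaves $L^2(A)$ invariant. Let $V^A_x$ be its restriction to $L^2(A)$ and $V^A=(V^A_x)_{x\in\mathbb{R}_+^\infty}$. For $b\in X$ define $B=\prod_{n=1}^\infty[b_n,\infty)$ and $V^B$ in the same way. **Theorem.** Let $\mathcal H$ be an infinite dimensional separable Hilbert space. 1. Let $a,b\in X$ with $a-b\notin\ell^2(\mathbb N)$. Then $V^A$ and $V^B$ are irreducible, doubly commuting isometric representations of $\mathbb{R}_+^\infty$ that are not unitarily equivalent. The representations $V^A\otimes 1_{\mathcal H}$ and $V^B\otimes 1_{\mathcal H}$ on the Hilbert space tensor products $L^2(A)\otimes\mathcal H$ and $L^2(B)\otimes\mathcal H$ are doubly commuting railway representations, their classes in $\mathcal{R}_0(\mathbb{R}_+^\infty)$ are distinct, and the singletons $\{[V^A\otimes 1_{\mathcal H}]\}$ and $\{[V^B\otimes 1_{\mathcal H}]\}$ have the same closure in $\mathcal{R}_0(\mathbb{R}_+^\infty)$.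 2. The Fell topology on $\mathcal{R}_0(\mathbb{R}_+^\infty)$ is not $T_0$. -/

import Mathlib

open MeasureTheory Filter Topology
open scoped ENNReal NNReal TensorProduct

noncomputable section

/-! ### The topological semigroup of finitely supported nonnegative sequences -/

/-- The real vector space of finitely supported real sequences. -/
def RInfty : Type := ℕ →₀ ℝ

namespace RInfty

instance : AddCommGroup RInfty := inferInstanceAs (AddCommGroup (ℕ →₀ ℝ))

instance : FunLike RInfty ℕ ℝ := inferInstanceAs (FunLike (ℕ →₀ ℝ) ℕ ℝ)

/-- The inclusion of `ℝⁿ` as the sequences supported on the first `n` coordinates. -/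
def incl (n : ℕ) (v : Fin n → ℝ) : RInfty := ∑ i : Fin n, Finsupp.single (i : ℕ) (v i)

/-- The inductive limit topology: a set is open iff its trace on every `ℝⁿ` is open. -/
instance : TopologicalSpace RInfty :=
  ⨆ n : ℕ, TopologicalSpace.coinduced (incl n) inferInstance

end RInfty

/-- The subsemigroup of sequences with nonnegative entries; it carries the subspace topology. -/
def RPlusInfty : AddSubmonoid RInfty where
  carrier := {x | ∀ n, 0 ≤ x n}
  zero_mem' := fun _ => le_refl (0 : ℝ)
  add_mem' := fun {_ _} hx hy n => add_nonneg (hx n) (hy n)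

/-- The element `t • eᵢ`, for `t ≥ 0`. -/
def RPlusInfty.axis (i : ℕ) (t : ℝ≥0) : RPlusInfty :=
  ⟨(Finsupp.single i (t : ℝ) : ℕ →₀ ℝ), fun n => by
    change 0 ≤ (Finsupp.single i (t : ℝ) : ℕ →₀ ℝ) n
    rw [Finsupp.single_apply]
    split_ifs
    · exact t.2
    · exact le_refl _⟩

/-! ### Isometric representations -/

section Representations

universe u v w

variable {S : Type u} {K : Type v} {L : Type w}
variable [NormedAddCommGroup K] [InnerProductSpace ℂ K]
variable [NormedAddCommGroup L] [InnerProductSpace ℂ L]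

/-- `V` is a strongly continuous semigroup of isometries indexed by `S`. -/
structure IsIsometricRep [AddCommMonoid S] [TopologicalSpace S] (V : S → K →L[ℂ] K) : Prop where
  map_zero : V 0 = 1
  map_add : ∀ s t, V (s + t) = V s * V t
  norm_map : ∀ s x, ‖V s x‖ = ‖x‖
  strong_continuous : ∀ x, Continuous fun s => V s x

/-- Unitary equivalence of families of operators on two Hilbert spaces. -/
def UnitarilyEquivalent (V : S → K →L[ℂ] K) (W : S → L →L[ℂ] L) : Prop :=
  ∃ U : K ≃ₗᵢ[ℂ] L, ∀ s x, U (V s x) = W s (U x)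

/-- Irreducibility: the commutant of the operators `V s` and their adjoints consists of the scalars
(and the space is not zero). -/
def IsIrreducibleRep [CompleteSpace K] (V : S → K →L[ℂ] K) : Prop :=
  Nontrivial K ∧
    Set.centralizer {T : K →L[ℂ] K | ∃ s, T = V s ∨ T = ContinuousLinearMap.adjoint (V s)} =
      {T : K →L[ℂ] K | ∃ c : ℂ, T = c • 1}

/-- `V` is a railway representation: it is an isometric representation, unitarily equivalent to the
direct sum of countably infinitely many copies of an irreducible isometric representation `V₀` on a
separable Hilbert space `K₀` (the direct sum acts coordinatewise on the `ℓ²`-sum of copies of `K₀`).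
Every separable Hilbert space is isometrically isomorphic to one in `Type`. -/
def IsRailway [AddCommMonoid S] [TopologicalSpace S] (V : S → K →L[ℂ] K) : Prop :=
  IsIsometricRep V ∧
    ∃ (K₀ : Type) (_ : NormedAddCommGroup K₀) (_ : InnerProductSpace ℂ K₀) (_ : CompleteSpace K₀)
      (_ : TopologicalSpace.SeparableSpace K₀) (V₀ : S → K₀ →L[ℂ] K₀),
      IsIsometricRep V₀ ∧ IsIrreducibleRep V₀ ∧
        ∃ U : K ≃ₗᵢ[ℂ] lp (fun _ : ℕ => K₀) 2,
          ∀ (s : S) (x : K) (n : ℕ), (U (V s x) : ∀ _ : ℕ, K₀) n = V₀ s ((U x : ∀ _ : ℕ, K₀) n)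

/-- The representation `V ⊗ 1` on the Hilbert space tensor product of `K` and `L`. -/
def tensorOne (L : Type w) [NormedAddCommGroup L] [InnerProductSpace ℂ L] (V : S → K →L[ℂ] K)
    (s : S) : UniformSpace.Completion (K ⊗[ℂ] L) →L[ℂ] UniformSpace.Completion (K ⊗[ℂ] L) :=
  ((V s).rTensor L).completion

/-- A doubly commuting family of operators indexed by `RPlusInfty`. -/
def IsDoublyCommuting [CompleteSpace K] (V : RPlusInfty → K →L[ℂ] K) : Prop :=
  ∀ i j : ℕ, i ≠ j → ∀ s t : ℝ≥0,
    ContinuousLinearMap.adjoint (V (RPlusInfty.axis i t)) * V (RPlusInfty.axis j s) =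
      V (RPlusInfty.axis j s) * ContinuousLinearMap.adjoint (V (RPlusInfty.axis i t))

/-! ### The Fell topology -/

/-- The railway representations of `S` on the fixed Hilbert space `L`. -/
structure RailwayRep (S : Type u) [AddCommMonoid S] [TopologicalSpace S]
    (L : Type w) [NormedAddCommGroup L] [InnerProductSpace ℂ L] where
  op : S → L →L[ℂ] L
  isRailway : IsRailway op

variable [AddCommMonoid S] [TopologicalSpace S]

/-- The basic open sets `X(V, C, ε, F)`: the supremum over `x ∈ C` and the maximum over `ξ ∈ F` of
the numbers `‖(V x - W x) ξ‖` and `‖((V x)* - (W x)*) ξ‖` is less than `ε`. -/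
def RailwayRep.basicOpen [CompleteSpace L] (V : RailwayRep S L) (C : Set S) (ε : ℝ)
    (F : Finset L) : Set (RailwayRep S L) :=
  {W | ∃ δ < ε, ∀ ξ ∈ F, ∀ x ∈ C,
    ‖(V.op x - W.op x) ξ‖ ≤ δ ∧
    ‖(ContinuousLinearMap.adjoint (V.op x) - ContinuousLinearMap.adjoint (W.op x)) ξ‖ ≤ δ}

instance [CompleteSpace L] : TopologicalSpace (RailwayRep S L) :=
  TopologicalSpace.generateFrom
    {O | ∃ (V : RailwayRep S L) (C : Set S) (ε : ℝ) (F : Finset L),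
      IsCompact C ∧ 0 < ε ∧ F.Nonempty ∧ O = V.basicOpen C ε F}

/-- Unitary equivalence as an equivalence relation on the railway representations on `L`. -/
def RailwayRep.setoid (S : Type u) [AddCommMonoid S] [TopologicalSpace S]
    (L : Type w) [NormedAddCommGroup L] [InnerProductSpace ℂ L] : Setoid (RailwayRep S L) where
  r V W := UnitarilyEquivalent V.op W.op
  iseqv :=
    { refl := fun _ => ⟨LinearIsometryEquiv.refl ℂ L, fun _ _ => rfl⟩
      symm := fun ⟨U, hU⟩ => ⟨U.symm, fun s x => by
        apply U.injective
        rw [hU, U.apply_symm_apply, U.apply_symm_apply]⟩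
      trans := fun ⟨U, hU⟩ ⟨U', hU'⟩ => ⟨U.trans U', fun s x => by
        rw [LinearIsometryEquiv.trans_apply, LinearIsometryEquiv.trans_apply, hU, hU']⟩ }

/-- The set of equivalence classes of railway representations of `S` on `L`. -/
def FellSpace (S : Type u) [AddCommMonoid S] [TopologicalSpace S]
    (L : Type w) [NormedAddCommGroup L] [InnerProductSpace ℂ L] :=
  Quotient (RailwayRep.setoid S L)

/-- The class `[V]`. -/
def FellSpace.mk (V : RailwayRep S L) : FellSpace S L := Quotient.mk (RailwayRep.setoid S L) V

/-- The Fell topology: the quotient topology. -/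
instance [CompleteSpace L] : TopologicalSpace (FellSpace S L) :=
  inferInstanceAs (TopologicalSpace (Quotient (RailwayRep.setoid S L)))

/-- The classes of doubly commuting railway representations of `RPlusInfty` on `L`, with the
subspace topology. -/
abbrev FellSpaceDC (L : Type w) [NormedAddCommGroup L] [InnerProductSpace ℂ L] [CompleteSpace L] :
    Type _ :=
  {P : FellSpace RPlusInfty L //
    ∃ V : RailwayRep RPlusInfty L, FellSpace.mk V = P ∧ IsDoublyCommuting V.op}

/-- `P` is the class of those railway representations on `L` that are unitarily equivalent to the
representation `W`, which may act on another Hilbert space. -/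
def FellSpaceDC.IsClassOf [CompleteSpace L] (P : FellSpaceDC L) (W : RPlusInfty → K →L[ℂ] K) :
    Prop :=
  ∀ V : RailwayRep RPlusInfty L, FellSpace.mk V = P.1 ↔ UnitarilyEquivalent V.op W

end Representations

/-! ### Koopman operators -/

section Koopman

variable {X : Type*} [MeasurableSpace X] (μ : Measure X) (T : X ≃ᵐ X)

/-- The function `√(d(μ ∘ T⁻¹)/dμ) · (f ∘ T⁻¹)`. -/
def koopmanFun (f : X → ℂ) (y : X) : ℂ :=
  (Real.sqrt (((μ.map T).rnDeriv μ y).toReal) : ℂ) * f (T.symm y)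

theorem koopmanFun_ae_zero {p : X → Prop} (h : ∀ᵐ y ∂μ.map T, p y) :
    ∀ᵐ y ∂μ, (μ.map T).rnDeriv μ y = 0 ∨ p y := by
  have h1 : ∀ᵐ y ∂μ.withDensity ((μ.map T).rnDeriv μ), p y :=
    (Measure.absolutelyContinuous_of_le (Measure.withDensity_rnDeriv_le _ _)).ae_le h
  rw [ae_withDensity_iff (Measure.measurable_rnDeriv _ _)] at h1
  filter_upwards [h1] with y hy
  by_cases h0 : (μ.map T).rnDeriv μ y = 0
  · exact Or.inl h0
  · exact Or.inr (hy h0)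

theorem koopmanFun_congr {f g : X → ℂ} (h : f =ᵐ[μ] g) :
    koopmanFun μ T f =ᵐ[μ] koopmanFun μ T g := by
  have h0 : ∀ᵐ y ∂μ.map T, f (T.symm y) = g (T.symm y) := by
    rw [T.measurableEmbedding.ae_map_iff]
    simpa using (show ∀ᵐ y ∂μ, f y = g y from h)
  filter_upwards [koopmanFun_ae_zero μ T h0] with y hy
  rcases hy with hy | hy
  · simp [koopmanFun, hy]
  · simp [koopmanFun, hy]

theorem eLpNorm_koopmanFun_le (f : X → ℂ) (hf : StronglyMeasurable f) :
    eLpNorm (koopmanFun μ T f) 2 μ ≤ eLpNorm f 2 μ := by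
  rw [eLpNorm_eq_lintegral_rpow_enorm_toReal (by norm_num) (by norm_num),
    eLpNorm_eq_lintegral_rpow_enorm_toReal (by norm_num) (by norm_num)]
  refine ENNReal.rpow_le_rpow ?_ (by positivity)
  have hm : Measurable fun y => ‖f (T.symm y)‖ₑ ^ (2 : ℝ≥0∞).toReal :=
    (hf.measurable.comp T.symm.measurable).enorm.pow_const _
  calc ∫⁻ y, ‖koopmanFun μ T f y‖ₑ ^ (2 : ℝ≥0∞).toReal ∂μ
      ≤ ∫⁻ y, ((μ.map T).rnDeriv μ * fun y => ‖f (T.symm y)‖ₑ ^ (2 : ℝ≥0∞).toReal) y ∂μ := by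
        refine lintegral_mono fun y => ?_
        simp only [koopmanFun, enorm_mul, Pi.mul_apply]
        rw [ENNReal.mul_rpow_of_nonneg _ _ (by positivity)]
        gcongr
        rw [← ofReal_norm, Complex.norm_real, Real.norm_of_nonneg (Real.sqrt_nonneg _),
          ENNReal.ofReal_rpow_of_nonneg (Real.sqrt_nonneg _) (by positivity)]
        simp only [ENNReal.toReal_ofNat, Real.rpow_two, Real.sq_sqrt ENNReal.toReal_nonneg]
        exact ENNReal.ofReal_toReal_le
    _ = ∫⁻ y, ‖f (T.symm y)‖ₑ ^ (2 : ℝ≥0∞).toReal ∂μ.withDensity ((μ.map T).rnDeriv μ) :=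
        (lintegral_withDensity_eq_lintegral_mul _ (Measure.measurable_rnDeriv _ _) hm).symm
    _ ≤ ∫⁻ y, ‖f (T.symm y)‖ₑ ^ (2 : ℝ≥0∞).toReal ∂μ.map T :=
        lintegral_mono' (Measure.withDensity_rnDeriv_le _ _) le_rfl
    _ = ∫⁻ y, ‖f y‖ₑ ^ (2 : ℝ≥0∞).toReal ∂μ := by
        rw [lintegral_map_equiv]
        simp

theorem memLp_koopmanFun (f : Lp ℂ 2 μ) : MemLp (koopmanFun μ T f) 2 μ := by
  refine ⟨?_, (eLpNorm_koopmanFun_le μ T f (Lp.stronglyMeasurable f)).trans_lt (Lp.eLpNorm_lt_top f)⟩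
  refine Measurable.aestronglyMeasurable ?_
  unfold koopmanFun
  exact (Complex.measurable_ofReal.comp
    (Measure.measurable_rnDeriv _ _).ennreal_toReal.sqrt).mul
    ((Lp.stronglyMeasurable f).measurable.comp T.symm.measurable)

/-- The Koopman operator `f ↦ √(d(μ ∘ T⁻¹)/dμ) · (f ∘ T⁻¹)` on `L²(μ)`; it is a contraction for
every bimeasurable bijection `T` and finite measure `μ`, and unitary when `μ` is moreover
quasi-invariant. -/
def koopman : Lp ℂ 2 μ →L[ℂ] Lp ℂ 2 μ :=
  LinearMap.mkContinuous
    { toFun := fun f => (memLp_koopmanFun μ T f).toLp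
      map_add' := fun f g => by
        apply Lp.ext
        filter_upwards [(memLp_koopmanFun μ T (f + g)).coeFn_toLp,
          (memLp_koopmanFun μ T f).coeFn_toLp, (memLp_koopmanFun μ T g).coeFn_toLp,
          Lp.coeFn_add (memLp_koopmanFun μ T f).toLp (memLp_koopmanFun μ T g).toLp,
          koopmanFun_congr μ T (Lp.coeFn_add f g)] with y h1 h2 h3 h4 h5
        rw [h1, h4, h5, Pi.add_apply, h2, h3]
        simp [koopmanFun, mul_add]
      map_smul' := fun c f => by
        apply Lp.ext
        filter_upwards [(memLp_koopmanFun μ T (c • f)).coeFn_toLp,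
          (memLp_koopmanFun μ T f).coeFn_toLp,
          Lp.coeFn_smul c (memLp_koopmanFun μ T f).toLp,
          koopmanFun_congr μ T (Lp.coeFn_smul c f)] with y h1 h2 h3 h4
        rw [h1, RingHom.id_apply, h3, h4, Pi.smul_apply, h2]
        simp [koopmanFun, mul_left_comm] }
    1 fun f => by
      rw [one_mul]
      change ‖(memLp_koopmanFun μ T f).toLp‖ ≤ ‖f‖
      rw [Lp.norm_toLp, Lp.norm_def]
      exact ENNReal.toReal_mono (Lp.eLpNorm_ne_top f)
        (eLpNorm_koopmanFun_le μ T f (Lp.stronglyMeasurable f))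

theorem koopman_coeFn (f : Lp ℂ 2 μ) : koopman μ T f =ᵐ[μ] koopmanFun μ T f :=
  (memLp_koopmanFun μ T f).coeFn_toLp

end Koopman

/-! ### The representations attached to Gaussian orthants -/

/-- The countable product of standard Gaussian measures on `ℝ^ℕ`. -/
def gaussianProduct : Measure (ℕ → ℝ) :=
  Measure.infinitePi fun _ => ProbabilityTheory.gaussianReal 0 1

instance : IsProbabilityMeasure gaussianProduct := by
  unfold gaussianProduct; infer_instance

/-- The set of sequences `a` with `aₙ ≤ 0` for all `n` such that the infinite product of the
Gaussian measures of the half-lines `[aₙ, ∞)` is positive. -/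
def thresholds : Set (ℕ → ℝ) :=
  {a | (∀ n, a n ≤ 0) ∧ ∃ p : ℝ, 0 < p ∧
    Tendsto (fun N => ∏ n ∈ Finset.range N,
      (ProbabilityTheory.gaussianReal 0 1).real (Set.Ici (a n))) atTop (𝓝 p)}

/-- The orthant `∏ₙ [aₙ, ∞)`. -/
def orthant (a : ℕ → ℝ) : Set (ℕ → ℝ) := {y | ∀ n, a n ≤ y n}

/-- `L²` of the orthant, as the closed subspace of those elements of `L²(ℝ^ℕ)` whose restriction to
the complement of the orthant is zero. -/
abbrev orthantL2 (a : ℕ → ℝ) : Submodule ℂ (Lp ℂ 2 gaussianProduct) :=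
  (LpToLpRestrictCLM (ℕ → ℝ) ℂ ℂ gaussianProduct 2 (orthant a)ᶜ).ker

/-- The Koopman operator of the translation `y ↦ x + y` on `L²(ℝ^ℕ)`. -/
def translationKoopman (x : RPlusInfty) :
    Lp ℂ 2 gaussianProduct →L[ℂ] Lp ℂ 2 gaussianProduct :=
  koopman gaussianProduct (MeasurableEquiv.addLeft (fun n => x.1 n))

theorem measurableSet_orthant (a : ℕ → ℝ) : MeasurableSet (orthant a) := by
  have : orthant a = ⋂ n, {y | a n ≤ y n} := by ext; simp [orthant]
  rw [this]
  exact MeasurableSet.iInter fun n => measurableSet_le measurable_const (measurable_pi_apply n)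

theorem mem_orthantL2_iff (a : ℕ → ℝ) (f : Lp ℂ 2 gaussianProduct) :
    f ∈ orthantL2 a ↔ ∀ᵐ y ∂gaussianProduct, y ∉ orthant a → f y = 0 := by
  have hm := (measurableSet_orthant a).compl
  refine Iff.trans ?_ (ae_restrict_iff' hm)
  rw [LinearMap.mem_ker]
  refine Lp.eq_zero_iff_ae_eq_zero.trans ?_
  exact ⟨fun h => (LpToLpRestrictCLM_coeFn ℂ _ f).symm.trans h,
    fun h => (LpToLpRestrictCLM_coeFn ℂ _ f).trans h⟩

theorem translationKoopman_mem (a : ℕ → ℝ) (x : RPlusInfty) (f : Lp ℂ 2 gaussianProduct)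
    (hf : f ∈ orthantL2 a) : translationKoopman x f ∈ orthantL2 a := by
  rw [mem_orthantL2_iff] at hf ⊢
  set T : (ℕ → ℝ) ≃ᵐ (ℕ → ℝ) := MeasurableEquiv.addLeft (fun n => x.1 n) with hT
  have h0 : ∀ᵐ y ∂gaussianProduct.map T, T.symm y ∉ orthant a → f (T.symm y) = 0 := by
    rw [T.measurableEmbedding.ae_map_iff]
    simpa using hf
  filter_upwards [koopmanFun_ae_zero gaussianProduct T h0, koopman_coeFn gaussianProduct T f]
    with y hy hy' hya
  rw [translationKoopman, ← hT, hy']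
  rcases hy with hy | hy
  · simp [koopmanFun, hy]
  · have : T.symm y ∉ orthant a := fun h => hya fun n => by
      have h1 := h n
      have h2 : 0 ≤ x.1 n := x.2 n
      have h3 : T.symm y n = -x.1 n + y n := rfl
      linarith
    simp [koopmanFun, hy this]

/-- The representation on `L²` of the orthant: the restriction of the translation Koopman
operators. -/
def orthantRep (a : ℕ → ℝ) (x : RPlusInfty) : orthantL2 a →L[ℂ] orthantL2 a :=
  (translationKoopman x).restrict (translationKoopman_mem a x)

end

noncomputable section

/-! ### The algebra of Koopman operators -/

section KoopmanAlgebra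

variable {X : Type*} [MeasurableSpace X] {μ : Measure X}

/-! Finitely supported translations preserve the class of the Gaussian product, so they act on
`L²(ℝ^ℕ)` by a strongly continuous unitary group `U`. On `L²(A)` the isometry `V_x` is the
restriction of `U_x`, its adjoint is the compression of `U_{-x}`, and `V_x V_x*` is multiplication
by the indicator of the orthant with corner `a + x`. These range projections generate all
multiplications by functions of `y - a`. Hence an operator intertwining `V^A` and `V^B` together
with their adjoints carries multiplication by `1_S(y - a)` to multiplication by `1_S(y - b)` for
every Borel set `S` (`intertwines_orthantMul`).

Two consequences follow. For `a = b`, an element of the commutant is multiplication by a function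
invariant under translations inside the orthant. Such a function does not depend on any finite set
of coordinates, so it is constant by a zero-one law (`exists_ae_eq_const`), and `V^A` is
irreducible. For `a - b ∉ ℓ²`, the laws of `y - a` and `y - b` are asymptotically separated, as in
Kakutani's dichotomy (`exists_separating_sets`), so every intertwiner vanishes. Slicing in the
second tensor factor transfers this disjointness to `V ⊗ 1`, so the two classes are distinct.

For equality of closures, replace the first `m` entries of `a` by those of `b`. This translates the
orthant by a finitely supported vector and so does not change the unitary equivalence class. By
Borel–Cantelli, the indicators of the modified orthants converge almost everywhere to that of `B`.
All representations involved are compressions of the same group `U`, so operators and adjoints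
converge strongly, uniformly on compact sets, once the `L²` spaces are identified by unitaries
nearly equal to the identity on the relevant vectors (`exists_unitary_fixing`). The approximation
survives tensoring with `1`, and the roles of `a` and `b` are symmetric, so the two classes are
topologically inseparable. One explicit pair at infinite `ℓ²` distance then refutes `T₀`. -/

theorem norm_koopman_apply_le (T : X ≃ᵐ X) (f : Lp ℂ 2 μ) : ‖koopman μ T f‖ ≤ ‖f‖ := by
  have h := (koopman μ T).le_of_opNorm_le (LinearMap.mkContinuous_norm_le _ zero_le_one _) f
  simpa using h

theorem koopman_refl [SigmaFinite μ] (f : Lp ℂ 2 μ) :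
    koopman μ (MeasurableEquiv.refl X) f = f := by
  apply Lp.ext
  have h : μ.map (MeasurableEquiv.refl X) = μ := Measure.map_id
  filter_upwards [koopman_coeFn μ (MeasurableEquiv.refl X) f, Measure.rnDeriv_self μ] with y h1 h2
  rw [h1, koopmanFun, h, h2]
  simp

/-- Chain rule for Radon–Nikodym derivatives: the density of `(T ∘ S)_* μ` relative to `μ` is the
density relative to `T_* μ` times that of `T_* μ` relative to `μ`, and the first factor is the
density of `S_* μ` transported by `T`. Points where the density of `T_* μ` vanishes contribute zero
on both sides, so nothing has to be assumed about `T`. -/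
theorem koopman_trans [IsFiniteMeasure μ] (S T : X ≃ᵐ X) (hS : μ.map S ≪ μ) (f : Lp ℂ 2 μ) :
    koopman μ (S.trans T) f = koopman μ T (koopman μ S f) := by
  apply Lp.ext
  have hmap : μ.map (S.trans T) = (μ.map S).map T := by
    rw [Measure.map_map T.measurable S.measurable]; rfl
  have hc : (μ.map (S.trans T)).rnDeriv (μ.map T) * (μ.map T).rnDeriv μ
      =ᵐ[μ] (μ.map (S.trans T)).rnDeriv μ := by
    refine Measure.rnDeriv_mul_rnDeriv ?_
    rw [hmap]
    exact T.measurableEmbedding.absolutelyContinuous_map hS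
  have hd : ∀ᵐ y ∂μ.map T, (μ.map (S.trans T)).rnDeriv (μ.map T) y
      = (μ.map S).rnDeriv μ (T.symm y) := by
    rw [T.measurableEmbedding.ae_map_iff, hmap]
    filter_upwards [T.measurableEmbedding.rnDeriv_map (μ.map S) μ] with y hy
    rw [hy, T.symm_apply_apply]
  filter_upwards [koopman_coeFn μ (S.trans T) f, koopman_coeFn μ T (koopman μ S f),
    koopmanFun_congr μ T (koopman_coeFn μ S f), koopmanFun_ae_zero μ T hd, hc]
    with y h1 h2 h3 h4 h5
  rw [h1, h2, h3]
  simp only [koopmanFun]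
  rw [← h5, Pi.mul_apply]
  rcases h4 with h4 | h4
  · simp [h4]
  · rw [h4, ENNReal.toReal_mul, Real.sqrt_mul ENNReal.toReal_nonneg]
    push_cast
    rw [mul_comm (Complex.ofReal _), mul_assoc]
    rfl

theorem koopman_symm_koopman [IsFiniteMeasure μ] (T : X ≃ᵐ X) (hT : μ.map T ≪ μ) (f : Lp ℂ 2 μ) :
    koopman μ T.symm (koopman μ T f) = f := by
  rw [← koopman_trans _ _ hT, MeasurableEquiv.self_trans_symm, koopman_refl]

/-- A contraction with a contractive left inverse is isometric. -/
theorem norm_koopman_apply [IsFiniteMeasure μ] (T : X ≃ᵐ X) (hT : μ.map T ≪ μ) (f : Lp ℂ 2 μ) :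
    ‖koopman μ T f‖ = ‖f‖ := by
  refine le_antisymm (norm_koopman_apply_le T f) ?_
  conv_lhs => rw [← koopman_symm_koopman T hT f]
  exact norm_koopman_apply_le _ _

end KoopmanAlgebra

/-! ### Multiplication by an indicator function -/

section IndicatorProjection

variable {X : Type*} [MeasurableSpace X] {μ : Measure X}

/-- Multiplication by the indicator function of `E` on `L²(μ)`; by convention zero if `E` is not
measurable. -/
def indicatorMul (μ : Measure X) (E : Set X) : Lp ℂ 2 μ →L[ℂ] Lp ℂ 2 μ := by
  classical
  exact if hE : MeasurableSet E then
    LinearMap.mkContinuous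
      { toFun := fun f => ((Lp.memLp f).indicator hE).toLp
        map_add' := fun f g => by
          apply Lp.ext
          filter_upwards [((Lp.memLp (f + g)).indicator hE).coeFn_toLp,
            ((Lp.memLp f).indicator hE).coeFn_toLp, ((Lp.memLp g).indicator hE).coeFn_toLp,
            Lp.coeFn_add ((Lp.memLp f).indicator hE).toLp ((Lp.memLp g).indicator hE).toLp,
            Lp.coeFn_add f g] with y h1 h2 h3 h4 h5
          rw [h1, h4, Pi.add_apply, h2, h3]
          by_cases hy : y ∈ E
          · simp only [Set.indicator_of_mem hy, h5, Pi.add_apply]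
          · simp [hy]
        map_smul' := fun c f => by
          apply Lp.ext
          filter_upwards [((Lp.memLp (c • f)).indicator hE).coeFn_toLp,
            ((Lp.memLp f).indicator hE).coeFn_toLp,
            Lp.coeFn_smul c ((Lp.memLp f).indicator hE).toLp,
            Lp.coeFn_smul c f] with y h1 h2 h3 h4
          rw [h1, RingHom.id_apply, h3, Pi.smul_apply, h2]
          by_cases hy : y ∈ E
          · simp only [Set.indicator_of_mem hy, h4, Pi.smul_apply]
          · simp [hy] }
      1 fun f => by
        rw [one_mul]
        change ‖((Lp.memLp f).indicator hE).toLp‖ ≤ ‖f‖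
        rw [Lp.norm_toLp, Lp.norm_def]
        exact ENNReal.toReal_mono (Lp.eLpNorm_ne_top f) (eLpNorm_indicator_le _)
  else 0

theorem indicatorMul_coeFn {E : Set X} (hE : MeasurableSet E) (f : Lp ℂ 2 μ) :
    indicatorMul μ E f =ᵐ[μ] E.indicator f := by
  rw [indicatorMul, dif_pos hE]
  exact ((Lp.memLp f).indicator hE).coeFn_toLp

theorem norm_indicatorMul_le {E : Set X} (hE : MeasurableSet E) (f : Lp ℂ 2 μ) :
    ‖indicatorMul μ E f‖ ≤ ‖f‖ := by
  have h : ‖indicatorMul μ E‖ ≤ 1 := by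
    rw [indicatorMul, dif_pos hE]
    exact LinearMap.mkContinuous_norm_le _ zero_le_one _
  simpa using (indicatorMul μ E).le_of_opNorm_le h f

theorem indicatorMul_eq_self_iff {E : Set X} (hE : MeasurableSet E) (f : Lp ℂ 2 μ) :
    indicatorMul μ E f = f ↔ ∀ᵐ y ∂μ, y ∉ E → f y = 0 := by
  constructor
  · intro h
    have h0 := indicatorMul_coeFn hE f
    rw [h] at h0
    filter_upwards [h0] with y hy hyE
    rw [hy, Set.indicator_of_notMem hyE]
  · intro h
    apply Lp.ext
    filter_upwards [h, indicatorMul_coeFn hE f] with y hy hy'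
    rw [hy']
    by_cases hyE : y ∈ E
    · simp [hyE]
    · simp [hyE, hy hyE]

theorem indicatorMul_indicatorMul {E F : Set X} (hE : MeasurableSet E) (hF : MeasurableSet F)
    (f : Lp ℂ 2 μ) : indicatorMul μ E (indicatorMul μ F f) = indicatorMul μ (E ∩ F) f := by
  apply Lp.ext
  filter_upwards [indicatorMul_coeFn hE (indicatorMul μ F f), indicatorMul_coeFn hF f,
    indicatorMul_coeFn (hE.inter hF) f] with y h1 h2 h3
  rw [h1, h3]
  by_cases hyE : y ∈ E <;> by_cases hyF : y ∈ F <;> simp [hyE, hyF, h2]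

theorem indicatorMul_univ (f : Lp ℂ 2 μ) : indicatorMul μ Set.univ f = f := by
  rw [indicatorMul_eq_self_iff MeasurableSet.univ]
  simp

theorem indicatorMul_add_compl {E : Set X} (hE : MeasurableSet E) (f : Lp ℂ 2 μ) :
    indicatorMul μ E f + indicatorMul μ Eᶜ f = f := by
  apply Lp.ext
  filter_upwards [Lp.coeFn_add (indicatorMul μ E f) (indicatorMul μ Eᶜ f),
    indicatorMul_coeFn hE f, indicatorMul_coeFn hE.compl f] with y h1 h2 h3
  rw [h1, Pi.add_apply, h2, h3]
  by_cases hy : y ∈ E <;> simp [hy]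

theorem inner_indicatorMul {E : Set X} (hE : MeasurableSet E) (f g : Lp ℂ 2 μ) :
    inner ℂ (indicatorMul μ E f) g = inner ℂ f (indicatorMul μ E g) := by
  rw [L2.inner_def, L2.inner_def]
  refine integral_congr_ae ?_
  filter_upwards [indicatorMul_coeFn hE f, indicatorMul_coeFn hE g] with y h1 h2
  rw [h1, h2]
  by_cases hy : y ∈ E <;> simp [hy]

theorem indicatorMul_koopman (T : X ≃ᵐ X) {E : Set X} (hE : MeasurableSet E) (f : Lp ℂ 2 μ) :
    indicatorMul μ E (koopman μ T f) = koopman μ T (indicatorMul μ (T ⁻¹' E) f) := by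
  apply Lp.ext
  filter_upwards [indicatorMul_coeFn hE (koopman μ T f), koopman_coeFn μ T f,
    koopman_coeFn μ T (indicatorMul μ (T ⁻¹' E) f),
    koopmanFun_congr μ T (indicatorMul_coeFn (T.measurable hE) f)] with y h1 h2 h3 h4
  rw [h1, h3, h4]
  by_cases hy : y ∈ E <;> simp [hy, h2, koopmanFun, Set.indicator]

/-- If the indicator functions of the sets `E n` converge almost everywhere, then the
multiplication operators converge strongly. -/
theorem tendsto_indicatorMul {E : ℕ → Set X} {F : Set X} (hE : ∀ n, MeasurableSet (E n))
    (hF : MeasurableSet F) (h : ∀ᵐ y ∂μ, ∀ᶠ n in atTop, (y ∈ E n ↔ y ∈ F)) (f : Lp ℂ 2 μ) :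
    Tendsto (fun n => indicatorMul μ (E n) f) atTop (𝓝 (indicatorMul μ F f)) := by
  rw [tendsto_iff_norm_sub_tendsto_zero]
  have key : ∀ n, ‖indicatorMul μ (E n) f - indicatorMul μ F f‖ ^ 2
      = ∫ y, ‖(E n).indicator f y - F.indicator f y‖ ^ 2 ∂μ := by
    intro n
    have h1 : ‖indicatorMul μ (E n) f - indicatorMul μ F f‖ ^ 2
        = RCLike.re (inner ℂ (indicatorMul μ (E n) f - indicatorMul μ F f)
          (indicatorMul μ (E n) f - indicatorMul μ F f)) := by
      rw [norm_sq_eq_re_inner (𝕜 := ℂ)]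
    rw [h1, L2.inner_def, ← integral_re (L2.integrable_inner _ _)]
    refine integral_congr_ae ?_
    filter_upwards [Lp.coeFn_sub (indicatorMul μ (E n) f) (indicatorMul μ F f),
      indicatorMul_coeFn (hE n) f, indicatorMul_coeFn hF f] with y h2 h3 h4
    rw [h2, Pi.sub_apply, h3, h4, ← norm_sq_eq_re_inner (𝕜 := ℂ)]
  have hi : Integrable (fun y => ‖f y‖ ^ 2) μ := (Lp.memLp f).integrable_norm_pow (by norm_num)
  have h0 : Tendsto (fun n => ∫ y, ‖(E n).indicator f y - F.indicator f y‖ ^ 2 ∂μ) atTop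
      (𝓝 (∫ _, (0 : ℝ) ∂μ)) := by
    -- The difference of the two indicators has modulus at most one, so `|f|²` dominates.
    refine tendsto_integral_of_dominated_convergence (fun y => ‖f y‖ ^ 2) ?_ hi ?_ ?_
    · intro n
      have := (Lp.aestronglyMeasurable f)
      exact ((this.indicator (hE n)).sub (this.indicator hF)).norm.pow 2
    · intro n
      refine Eventually.of_forall fun y => ?_
      by_cases h1 : y ∈ E n <;> by_cases h2 : y ∈ F <;> simp [h1, h2]
    · filter_upwards [h] with y hy
      refine tendsto_const_nhds.congr' ?_
      filter_upwards [hy] with n hn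
      by_cases h2 : y ∈ F <;> simp [hn, h2]
  rw [integral_zero] at h0
  have h1 := (h0.congr fun n => (key n).symm).sqrt
  simpa [Real.sqrt_sq] using h1

end IndicatorProjection

/-! ### Quasi-invariance of the Gaussian product under finitely supported translations -/

section GaussianShift

open ProbabilityTheory

namespace RInfty

/-- The element `t • eᵢ`. -/
def single (i : ℕ) (t : ℝ) : RInfty := (Finsupp.single i t : ℕ →₀ ℝ)

theorem add_apply (x y : RInfty) (n : ℕ) : (x + y) n = x n + y n := rfl

theorem neg_apply (x : RInfty) (n : ℕ) : (-x) n = -x n := rfl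

theorem zero_apply (n : ℕ) : (0 : RInfty) n = 0 := rfl

theorem single_apply (i : ℕ) (t : ℝ) (n : ℕ) : single i t n = if i = n then t else 0 :=
  Finsupp.single_apply

theorem single_add (i : ℕ) (s t : ℝ) : single i (s + t) = single i s + single i t :=
  Finsupp.single_add i s t

theorem single_zero (i : ℕ) : single i 0 = 0 := Finsupp.single_zero i

theorem sum_single_apply (s : Finset ℕ) (c : ℕ → ℝ) (n : ℕ) :
    (∑ k ∈ s, single k (c k)) n = if n ∈ s then c n else 0 := by
  have h : (∑ k ∈ s, single k (c k)) n = ∑ k ∈ s, (Finsupp.single k (c k) : ℕ →₀ ℝ) n :=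
    Finsupp.finsetSum_apply _ _ _
  rw [h]
  simp only [Finsupp.single_apply, Finset.sum_ite_eq']

theorem induction_single {p : RInfty → Prop} (x : RInfty) (h0 : p 0)
    (hadd : ∀ i t y, p y → p (single i t + y)) : p x :=
  Finsupp.induction (motive := p) x h0 fun i t y _ _ hy => hadd i t y hy

end RInfty

/-- The translation of `ℝ^ℕ` by a finitely supported sequence. -/
def shiftEquiv (x : RInfty) : (ℕ → ℝ) ≃ᵐ (ℕ → ℝ) := MeasurableEquiv.addLeft (fun n => x n)

theorem shiftEquiv_apply (x : RInfty) (y : ℕ → ℝ) (n : ℕ) : shiftEquiv x y n = x n + y n := rfl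

theorem shiftEquiv_symm_apply (x : RInfty) (y : ℕ → ℝ) (n : ℕ) :
    (shiftEquiv x).symm y n = -x n + y n := rfl

theorem shiftEquiv_zero : shiftEquiv 0 = MeasurableEquiv.refl _ := by
  ext y n
  simp [shiftEquiv_apply, RInfty.zero_apply]

theorem shiftEquiv_add (x y : RInfty) :
    shiftEquiv (x + y) = (shiftEquiv y).trans (shiftEquiv x) := by
  ext z n
  rw [MeasurableEquiv.trans_apply]
  simp only [shiftEquiv_apply, RInfty.add_apply, add_assoc]

/-- One-dimensional Cameron–Martin formula, obtained by completing the square in the exponent. -/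
theorem gaussianReal_withDensity_exp (t : ℝ) :
    (gaussianReal 0 1).withDensity (fun u => ENNReal.ofReal (Real.exp (t * u - t ^ 2 / 2)))
      = gaussianReal t 1 := by
  rw [gaussianReal_of_var_ne_zero 0 one_ne_zero, gaussianReal_of_var_ne_zero t one_ne_zero,
    ← withDensity_mul _ (measurable_gaussianPDF 0 1) (by fun_prop)]
  congr 1
  ext u
  rw [Pi.mul_apply, gaussianPDF, gaussianPDF, ← ENNReal.ofReal_mul (gaussianPDFReal_nonneg _ _ _),
    gaussianPDFReal, gaussianPDFReal, mul_assoc, ← Real.exp_add]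
  congr 3
  simp only [NNReal.coe_one]
  ring

/-- A density depending on a single coordinate alters only that factor. On a box the integrand is a
product of functions of separate coordinates, and independence factors the integral. -/
theorem withDensity_infinitePi_eval {ι : Type*} [DecidableEq ι] (m : ι → Measure ℝ)
    [∀ i, IsProbabilityMeasure (m i)] (i : ι) (g : ℝ → ℝ≥0∞) (hg : Measurable g)
    (m' : ι → Measure ℝ) [∀ i, IsProbabilityMeasure (m' i)]
    (hi : m' i = (m i).withDensity g) (hj : ∀ j, j ≠ i → m' j = m j) :
    (Measure.infinitePi m).withDensity (fun y => g (y i)) = Measure.infinitePi m' := by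
  classical
  refine Measure.eq_infinitePi _ fun s t ht => ?_
  -- The box is rewritten over `insert i s`, with the whole line on the `i`-th side when `i ∉ s`, so
  -- that coordinate `i` always occurs in the product and can absorb `g`.
  set t' : ι → Set ℝ := fun j => if j ∈ s then t j else Set.univ with ht'
  have ht'm : ∀ j, MeasurableSet (t' j) := fun j => by
    simp only [ht']; split_ifs
    · exact ht j
    · exact MeasurableSet.univ
  have hbox : (Set.pi s t : Set (ι → ℝ)) = Set.pi (insert i s : Finset ι) t' := by
    ext y
    simp only [Set.mem_pi, Finset.mem_coe, Finset.mem_insert, ht']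
    constructor
    · rintro h j -
      split_ifs with hj
      · exact h j hj
      · trivial
    · intro h j hj
      simpa [hj] using h j (Or.inr hj)
  have hprod : ∏ j ∈ s, m' j (t j) = ∏ j ∈ insert i s, m' j (t' j) := by
    rw [← Finset.prod_subset (Finset.subset_insert i s)]
    · exact Finset.prod_congr rfl fun j hj => by simp [ht', hj]
    · intro j _ hj
      simp [ht', hj]
  rw [hbox, hprod]
  set X : ι → ℝ → ℝ≥0∞ := fun j u => (t' j).indicator (fun u => if j = i then g u else 1) u with hX
  have hXm : ∀ j, Measurable (X j) := fun j => by
    refine Measurable.indicator ?_ (ht'm j)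
    by_cases h : j = i <;> simp [h, hg]
  have hmeas : MeasurableSet (Set.pi (insert i s : Finset ι) t') :=
    MeasurableSet.pi (Finset.countable_toSet _) fun j _ => ht'm j
  rw [withDensity_apply _ hmeas, ← lintegral_indicator hmeas]
  have hpt : ∀ y : ι → ℝ, (Set.pi (insert i s : Finset ι) t').indicator (fun y => g (y i)) y
      = ∏ j ∈ insert i s, X j (y j) := by
    intro y
    by_cases hy : y ∈ Set.pi (insert i s : Finset ι) t'
    · rw [Set.indicator_of_mem hy]
      have h1 : ∀ j ∈ insert i s, X j (y j) = if j = i then g (y i) else 1 := by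
        intro j hj
        simp only [hX]
        rw [Set.indicator_of_mem (hy j hj)]
        split_ifs with h
        · rw [h]
        · rfl
      rw [Finset.prod_congr rfl h1, Finset.prod_ite_eq' _ i]
      simp
    · rw [Set.indicator_of_notMem hy]
      simp only [Set.mem_pi, not_forall] at hy
      obtain ⟨j, hj, hjy⟩ := hy
      refine (Finset.prod_eq_zero (Finset.mem_coe.1 hj) ?_).symm
      simp only [hX]
      rw [Set.indicator_of_notMem hjy]
  simp_rw [hpt]
  rw [lintegral_prod_eq_prod_lintegral_of_indepFun _ (fun j (y : ι → ℝ) => X j (y j))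
    (iIndepFun_infinitePi hXm) (fun j => (hXm j).comp (measurable_pi_apply j))]
  refine Finset.prod_congr rfl fun j _ => ?_
  have h2 : ∫⁻ y : ι → ℝ, X j (y j) ∂Measure.infinitePi m = ∫⁻ u, X j u ∂m j := by
    rw [← Measure.infinitePi_map_eval m j, lintegral_map (hXm j) (measurable_pi_apply j)]
  rw [h2, lintegral_indicator (ht'm j)]
  by_cases h : j = i
  · subst h
    simp [hi, withDensity_apply _ (ht'm j)]
  · simp [h, hj j h]

theorem map_shiftEquiv_single (i : ℕ) (t : ℝ) :
    gaussianProduct.map (shiftEquiv (RInfty.single i t)) = gaussianProduct.withDensity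
      (fun y => ENNReal.ofReal (Real.exp (t * y i - t ^ 2 / 2))) := by
  have h1 := Measure.infinitePi_map_pi (fun _ : ℕ => gaussianReal 0 1)
    (f := fun n u => RInfty.single i t n + u) (fun n => by fun_prop)
  have hprob : ∀ n, (gaussianReal 0 1).map (fun u => RInfty.single i t n + u)
      = gaussianReal (RInfty.single i t n) 1 := fun n => by
    rw [gaussianReal_map_const_add, zero_add]
  simp_rw [hprob] at h1
  refine Eq.trans h1 (Eq.symm ?_)
  refine withDensity_infinitePi_eval _ i
    (fun u => ENNReal.ofReal (Real.exp (t * u - t ^ 2 / 2))) (by fun_prop) _ ?_ ?_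
  · rw [gaussianReal_withDensity_exp, RInfty.single_apply, if_pos rfl]
  · intro j hj
    rw [RInfty.single_apply, if_neg (Ne.symm hj)]

/-- A finitely supported shift is a finite composition of coordinate shifts, each of which has an
exponential density. -/
theorem map_shiftEquiv_absolutelyContinuous (x : RInfty) :
    gaussianProduct.map (shiftEquiv x) ≪ gaussianProduct := by
  induction x using RInfty.induction_single with
  | h0 =>
    rw [shiftEquiv_zero]
    exact (Measure.map_id (μ := gaussianProduct)).le.absolutelyContinuous
  | hadd i t y hy =>
    rw [shiftEquiv_add]
    have h1 : gaussianProduct.map ((shiftEquiv y).trans (shiftEquiv (RInfty.single i t)))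
        = (gaussianProduct.map (shiftEquiv y)).map (shiftEquiv (RInfty.single i t)) := by
      rw [Measure.map_map (MeasurableEquiv.measurable _) (MeasurableEquiv.measurable _)]; rfl
    rw [h1]
    refine ((shiftEquiv (RInfty.single i t)).measurableEmbedding.absolutelyContinuous_map hy).trans
      ?_
    rw [map_shiftEquiv_single]
    exact withDensity_absolutelyContinuous _ _

theorem ae_comp_shiftEquiv {p : (ℕ → ℝ) → Prop} (x : RInfty)
    (h : ∀ᵐ y ∂gaussianProduct, p y) : ∀ᵐ y ∂gaussianProduct, p (shiftEquiv x y) :=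
  ae_of_ae_map (shiftEquiv x).measurable.aemeasurable
    ((map_shiftEquiv_absolutelyContinuous x).ae_le h)

theorem shiftEquiv_neg (x : RInfty) : shiftEquiv (-x) = (shiftEquiv x).symm := by
  ext y n
  rw [shiftEquiv_apply, shiftEquiv_symm_apply, RInfty.neg_apply]

/-- The unitary Koopman operator of the translation by an arbitrary finitely supported sequence. -/
def shiftKoopman (x : RInfty) : Lp ℂ 2 gaussianProduct →L[ℂ] Lp ℂ 2 gaussianProduct :=
  koopman gaussianProduct (shiftEquiv x)

theorem shiftKoopman_zero (f : Lp ℂ 2 gaussianProduct) : shiftKoopman 0 f = f := by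
  rw [shiftKoopman, shiftEquiv_zero, koopman_refl]

theorem shiftKoopman_add (x y : RInfty) (f : Lp ℂ 2 gaussianProduct) :
    shiftKoopman (x + y) f = shiftKoopman x (shiftKoopman y f) := by
  rw [shiftKoopman, shiftEquiv_add, koopman_trans _ _ (map_shiftEquiv_absolutelyContinuous y)]
  rfl

theorem shiftKoopman_neg_apply (x : RInfty) (f : Lp ℂ 2 gaussianProduct) :
    shiftKoopman (-x) (shiftKoopman x f) = f := by
  rw [← shiftKoopman_add, neg_add_cancel, shiftKoopman_zero]

theorem shiftKoopman_apply_neg (x : RInfty) (f : Lp ℂ 2 gaussianProduct) :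
    shiftKoopman x (shiftKoopman (-x) f) = f := by
  rw [← shiftKoopman_add, add_neg_cancel, shiftKoopman_zero]

theorem norm_shiftKoopman (x : RInfty) (f : Lp ℂ 2 gaussianProduct) :
    ‖shiftKoopman x f‖ = ‖f‖ :=
  norm_koopman_apply _ (map_shiftEquiv_absolutelyContinuous x) f

/-- An isometry preserves inner products, and `shiftKoopman (-x)` is its two-sided inverse, hence
its adjoint. -/
theorem inner_shiftKoopman (x : RInfty) (f g : Lp ℂ 2 gaussianProduct) :
    inner ℂ (shiftKoopman x f) g = inner ℂ f (shiftKoopman (-x) g) := by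
  have h := (LinearMap.norm_map_iff_inner_map_map (𝕜 := ℂ) (shiftKoopman x)).1
    (norm_shiftKoopman x) f (shiftKoopman (-x) g)
  rwa [shiftKoopman_apply_neg] at h

theorem shiftKoopman_single_coeFn (i : ℕ) (t : ℝ) (f : Lp ℂ 2 gaussianProduct) :
    shiftKoopman (RInfty.single i t) f =ᵐ[gaussianProduct] fun y =>
      (Real.exp ((t * y i - t ^ 2 / 2) / 2) : ℂ) * f ((shiftEquiv (RInfty.single i t)).symm y) := by
  have h1 := Measure.rnDeriv_withDensity gaussianProduct
    (f := fun y => ENNReal.ofReal (Real.exp (t * y i - t ^ 2 / 2))) (by fun_prop)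
  filter_upwards [koopman_coeFn gaussianProduct (shiftEquiv (RInfty.single i t)) f, h1]
    with y h2 h3
  rw [shiftKoopman, h2, koopmanFun, map_shiftEquiv_single, h3,
    ENNReal.toReal_ofReal (Real.exp_nonneg _), Real.exp_half]

end GaussianShift

/-! ### Strong continuity of the translation group -/

section StrongContinuity

open ProbabilityTheory

theorem norm_sub_sq_eq_integral {X : Type*} [MeasurableSpace X] {μ : Measure X} (f g : Lp ℂ 2 μ) :
    ‖f - g‖ ^ 2 = ∫ y, ‖f y - g y‖ ^ 2 ∂μ := by
  have h1 : ‖f - g‖ ^ 2 = RCLike.re (inner ℂ (f - g) (f - g)) := by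
    rw [norm_sq_eq_re_inner (𝕜 := ℂ)]
  rw [h1, L2.inner_def, ← integral_re (L2.integrable_inner _ _)]
  refine integral_congr_ae ?_
  filter_upwards [Lp.coeFn_sub f g] with y h2
  rw [h2, Pi.sub_apply, ← norm_sq_eq_re_inner (𝕜 := ℂ)]

theorem integrable_exp_abs_eval (i : ℕ) :
    Integrable (fun y : ℕ → ℝ => Real.exp |y i|) gaussianProduct := by
  have h : Integrable (fun u : ℝ => Real.exp (1 * |u|)) (gaussianReal 0 1) :=
    integrable_exp_mul_abs (integrable_exp_mul_gaussianReal 1) (integrable_exp_mul_gaussianReal _)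
  simp only [one_mul] at h
  exact ((measurePreserving_eval_infinitePi (fun _ : ℕ => gaussianReal 0 1) i).integrable_comp
    h.aestronglyMeasurable).2 h

-- For a bounded continuous representative the integrand tends to zero pointwise. For `|t| ≤ 1` both
-- terms are at most `exp (|y i| / 2) * ‖g‖`, so the squared difference is dominated by `4 * ‖g‖ ^ 2
-- * exp |y i|`, which is integrable because Gaussians have exponential moments.
open scoped BoundedContinuousFunction in
theorem tendsto_shiftKoopman_single_of_bounded (i : ℕ) (f : Lp ℂ 2 gaussianProduct)
    (g : (ℕ → ℝ) →ᵇ ℂ) (hfg : f =ᵐ[gaussianProduct] g) :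
    Tendsto (fun t => shiftKoopman (RInfty.single i t) f) (𝓝 0) (𝓝 f) := by
  rw [tendsto_iff_norm_sub_tendsto_zero]
  set G : ℝ → (ℕ → ℝ) → ℂ := fun t y => (Real.exp ((t * y i - t ^ 2 / 2) / 2) : ℂ) *
    g ((shiftEquiv (RInfty.single i t)).symm y) with hG
  have hGm : ∀ t, Continuous (G t) := fun t => by
    simp only [hG]
    refine Continuous.mul ?_ (g.continuous.comp ?_)
    · fun_prop
    · refine continuous_pi fun n => ?_
      simp only [shiftEquiv_symm_apply]
      fun_prop
  have hae : ∀ t, shiftKoopman (RInfty.single i t) f =ᵐ[gaussianProduct] G t := by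
    intro t
    have h1 : ∀ᵐ y ∂gaussianProduct, f ((shiftEquiv (RInfty.single i t)).symm y)
        = g ((shiftEquiv (RInfty.single i t)).symm y) := by
      rw [← shiftEquiv_neg]
      exact ae_comp_shiftEquiv (p := fun y => f y = g y) _ hfg
    filter_upwards [shiftKoopman_single_coeFn i t f, h1] with y h2 h3
    rw [h2, h3]
  have key : ∀ t, ‖shiftKoopman (RInfty.single i t) f - f‖ ^ 2
      = ∫ y, ‖G t y - g y‖ ^ 2 ∂gaussianProduct := by
    intro t
    rw [norm_sub_sq_eq_integral]
    refine integral_congr_ae ?_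
    filter_upwards [hae t, hfg] with y h1 h2
    rw [h1, h2]
  have h0 : Tendsto (fun t => ∫ y, ‖G t y - g y‖ ^ 2 ∂gaussianProduct) (𝓝 0)
      (𝓝 (∫ _, (0 : ℝ) ∂gaussianProduct)) := by
    refine tendsto_integral_filter_of_dominated_convergence
      (fun y => 4 * ‖g‖ ^ 2 * Real.exp |y i|) ?_ ?_ ((integrable_exp_abs_eval i).const_mul _) ?_
    · refine Eventually.of_forall fun t => ?_
      exact ((hGm t).sub g.continuous).norm.pow 2 |>.aestronglyMeasurable
    · filter_upwards [Metric.ball_mem_nhds (0 : ℝ) one_pos] with t ht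
      refine Eventually.of_forall fun y => ?_
      have ht1 : |t| ≤ 1 := by simpa using (mem_ball_zero_iff.1 ht).le
      have he : Real.exp ((t * y i - t ^ 2 / 2) / 2) ≤ Real.exp (|y i| / 2) := by
        refine Real.exp_le_exp.2 ?_
        have h1 : t * y i ≤ |y i| := by
          refine (le_abs_self _).trans ?_
          rw [abs_mul]
          exact mul_le_of_le_one_left (abs_nonneg _) ht1
        nlinarith [sq_nonneg t]
      have h1 : ‖G t y‖ ≤ Real.exp (|y i| / 2) * ‖g‖ := by
        simp only [hG, norm_mul, Complex.norm_real, Real.norm_of_nonneg (Real.exp_nonneg _)]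
        exact mul_le_mul he (g.norm_coe_le_norm _) (norm_nonneg _) (Real.exp_nonneg _)
      have h2 : ‖g y‖ ≤ Real.exp (|y i| / 2) * ‖g‖ := by
        refine (g.norm_coe_le_norm y).trans (le_mul_of_one_le_left (norm_nonneg _) ?_)
        exact Real.one_le_exp (by positivity)
      have h3 : ‖G t y - g y‖ ≤ 2 * (Real.exp (|y i| / 2) * ‖g‖) := by
        linarith [norm_sub_le (G t y) (g y)]
      rw [Real.norm_of_nonneg (by positivity)]
      calc ‖G t y - g y‖ ^ 2 ≤ (2 * (Real.exp (|y i| / 2) * ‖g‖)) ^ 2 :=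
            pow_le_pow_left₀ (norm_nonneg _) h3 2
        _ = 4 * ‖g‖ ^ 2 * (Real.exp (|y i| / 2) * Real.exp (|y i| / 2)) := by ring
        _ = 4 * ‖g‖ ^ 2 * Real.exp |y i| := by rw [← Real.exp_add, add_halves]
    · refine Eventually.of_forall fun y => ?_
      have hc : Continuous fun t => ‖G t y - g y‖ ^ 2 := by
        simp only [hG]
        refine ((Continuous.mul ?_ (g.continuous.comp ?_)).sub continuous_const).norm.pow 2
        · fun_prop
        · refine continuous_pi fun n => ?_
          simp only [shiftEquiv_symm_apply, RInfty.single_apply]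
          by_cases h : i = n
          · simp only [h, if_true]; fun_prop
          · simp only [h, if_false]; fun_prop
      have h1 : ‖G 0 y - g y‖ ^ 2 = 0 := by
        have h2 : (shiftEquiv (RInfty.single i 0)).symm y = y := by
          rw [RInfty.single_zero, shiftEquiv_zero]; rfl
        simp [hG, h2]
      have h2 := hc.tendsto 0
      rwa [h1] at h2
  rw [integral_zero] at h0
  have h1 := (h0.congr fun n => (key n).symm).sqrt
  simpa [Real.sqrt_sq] using h1

/-- A uniformly bounded family of operators that converges on a dense set converges strongly. -/
theorem tendsto_apply_of_dense {α E F : Type*} [NormedAddCommGroup E] [NormedSpace ℂ E]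
    [NormedAddCommGroup F] [NormedSpace ℂ F] {l : Filter α} {A : α → E →L[ℂ] F} {B : E →L[ℂ] F}
    (hA : ∀ a x, ‖A a x‖ ≤ ‖x‖) (hB : ∀ x, ‖B x‖ ≤ ‖x‖) {s : Set E} (hs : Dense s)
    (h : ∀ x ∈ s, Tendsto (fun a => A a x) l (𝓝 (B x))) (x : E) :
    Tendsto (fun a => A a x) l (𝓝 (B x)) := by
  rw [Metric.tendsto_nhds]
  intro ε hε
  obtain ⟨z, hzs, hz⟩ := Metric.dense_iff.1 hs x (ε / 3) (by positivity)
  rw [Metric.mem_ball, dist_eq_norm] at hzs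
  filter_upwards [Metric.tendsto_nhds.1 (h z hz) (ε / 3) (by positivity)] with a ha
  rw [dist_eq_norm] at ha ⊢
  have h1 : A a x - B x = -A a (z - x) + (A a z - B z) + B (z - x) := by
    rw [map_sub, map_sub]; abel
  rw [h1]
  have h2 := norm_add_le (-A a (z - x) + (A a z - B z)) (B (z - x))
  have h3 := norm_add_le (-A a (z - x)) (A a z - B z)
  rw [norm_neg] at h3
  linarith [hA a (z - x), hB (z - x)]

theorem tendsto_shiftKoopman_single (i : ℕ) (f : Lp ℂ 2 gaussianProduct) :
    Tendsto (fun t => shiftKoopman (RInfty.single i t) f) (𝓝 0) (𝓝 f) := by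
  have h := tendsto_apply_of_dense (l := 𝓝 (0 : ℝ))
    (A := fun t => shiftKoopman (RInfty.single i t)) (B := ContinuousLinearMap.id ℂ _)
    (fun t x => (norm_shiftKoopman _ x).le) (fun x => le_rfl)
    (Lp.boundedContinuousFunction_dense ℂ gaussianProduct (p := 2) (by norm_num)) ?_ f
  · simpa using h
  · intro g hg
    obtain ⟨g', hg'⟩ := hg
    refine tendsto_shiftKoopman_single_of_bounded i g g' ?_
    have h1 : (g : (ℕ → ℝ) →ₘ[gaussianProduct] ℂ)
        = ContinuousMap.toAEEqFun gaussianProduct g'.toContinuousMap := hg'.symm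
    rw [h1]
    exact ContinuousMap.coeFn_toAEEqFun gaussianProduct g'.toContinuousMap

theorem continuous_shiftKoopman_single (i : ℕ) (f : Lp ℂ 2 gaussianProduct) :
    Continuous fun t => shiftKoopman (RInfty.single i t) f := by
  rw [continuous_iff_continuousAt]
  intro t
  have h := ((tendsto_shiftKoopman_single i (shiftKoopman (RInfty.single i t) f)).comp
    (tendsto_sub_nhds_zero_iff.2 (tendsto_id (α := ℝ) (x := 𝓝 t))))
  refine h.congr fun s => ?_
  simp only [Function.comp, id]
  rw [← shiftKoopman_add, ← RInfty.single_add, sub_add_cancel]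

/-- Composition of a strongly continuous family of contractions with a continuous family of
vectors. -/
theorem continuous_apply_of_strong {α E F : Type*} [TopologicalSpace α] [NormedAddCommGroup E]
    [NormedSpace ℂ E] [NormedAddCommGroup F] [NormedSpace ℂ F] {A : α → E →L[ℂ] F}
    (hA : ∀ a x, ‖A a x‖ ≤ ‖x‖) (hc : ∀ x, Continuous fun a => A a x) {g : α → E}
    (hg : Continuous g) : Continuous fun a => A a (g a) := by
  rw [continuous_iff_continuousAt]
  intro a
  have h1 : Tendsto (fun b => A b (g b - g a)) (𝓝 a) (𝓝 0) := by
    refine squeeze_zero_norm (fun b => hA b _) ?_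
    have := (tendsto_iff_norm_sub_tendsto_zero.1 (hg.tendsto a))
    exact this
  have h2 := h1.add ((hc (g a)).tendsto a)
  rw [zero_add] at h2
  refine h2.congr fun b => ?_
  rw [map_sub, sub_add_cancel]

/-- On `ℝⁿ` the group is a product of one-parameter groups, and products of strongly continuous
contractions are strongly continuous. This suffices for the inductive limit, whose topology is
tested on each `ℝⁿ`. -/
theorem continuous_shiftKoopman_sum {n : ℕ} (s : Finset (Fin n)) (f : Lp ℂ 2 gaussianProduct) :
    Continuous fun v : Fin n → ℝ =>
      shiftKoopman (∑ i ∈ s, RInfty.single (i : ℕ) (v i)) f := by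
  classical
  induction s using Finset.induction_on with
  | empty => simpa using continuous_const
  | insert i s hi ih =>
    simp_rw [Finset.sum_insert hi, shiftKoopman_add]
    exact continuous_apply_of_strong
      (A := fun v : Fin n → ℝ => shiftKoopman (RInfty.single (i : ℕ) (v i)))
      (fun v x => (norm_shiftKoopman _ x).le)
      (fun x => (continuous_shiftKoopman_single i x).comp (continuous_apply i)) ih

/-- The translation group on `L²(ℝ^ℕ)` is strongly continuous for the inductive limit topology. -/
theorem continuous_shiftKoopman (f : Lp ℂ 2 gaussianProduct) :
    Continuous fun x : RInfty => shiftKoopman x f := by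
  refine continuous_iSup_dom.2 fun n => continuous_coinduced_dom.2 ?_
  exact continuous_shiftKoopman_sum Finset.univ f

/-- By unitarity `‖U_{-y} f - U_{-x} f‖ = ‖U_y U_{-x} f - f‖`, so strong continuity of `U` at `x`
suffices and continuity of negation on `RInfty` is not needed. -/
theorem continuous_shiftKoopman_neg (f : Lp ℂ 2 gaussianProduct) :
    Continuous fun x : RInfty => shiftKoopman (-x) f := by
  rw [continuous_iff_continuousAt]
  intro x
  have h := (continuous_shiftKoopman (shiftKoopman (-x) f)).tendsto x
  rw [ContinuousAt, tendsto_iff_norm_sub_tendsto_zero]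
  rw [tendsto_iff_norm_sub_tendsto_zero] at h
  refine h.congr fun y => ?_
  rw [shiftKoopman_apply_neg, ← norm_neg, neg_sub, ← norm_shiftKoopman (-y), map_sub,
    shiftKoopman_neg_apply]

end StrongContinuity

/-! ### The representations on orthants -/

section Orthant

theorem mem_orthantL2_iff_indicatorMul (a : ℕ → ℝ) (f : Lp ℂ 2 gaussianProduct) :
    f ∈ orthantL2 a ↔ indicatorMul gaussianProduct (orthant a) f = f := by
  rw [mem_orthantL2_iff, indicatorMul_eq_self_iff (measurableSet_orthant a)]

theorem indicatorMul_coe (a : ℕ → ℝ) (f : orthantL2 a) :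
    indicatorMul gaussianProduct (orthant a) (f : Lp ℂ 2 gaussianProduct) = f :=
  (mem_orthantL2_iff_indicatorMul a f).1 f.2

theorem indicatorMul_orthant_mem (a : ℕ → ℝ) (f : Lp ℂ 2 gaussianProduct) :
    indicatorMul gaussianProduct (orthant a) f ∈ orthantL2 a := by
  rw [mem_orthantL2_iff_indicatorMul, indicatorMul_indicatorMul (measurableSet_orthant a)
    (measurableSet_orthant a), Set.inter_self]

theorem coe_orthantRep (a : ℕ → ℝ) (x : RPlusInfty) (f : orthantL2 a) :
    (orthantRep a x f : Lp ℂ 2 gaussianProduct) = shiftKoopman x.1 f := rfl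

/-- The adjoint of the restriction of a unitary to an invariant subspace is the compression of its
inverse. -/
theorem coe_adjoint_orthantRep (a : ℕ → ℝ) (x : RPlusInfty) (f : orthantL2 a) :
    (ContinuousLinearMap.adjoint (orthantRep a x) f : Lp ℂ 2 gaussianProduct)
      = indicatorMul gaussianProduct (orthant a) (shiftKoopman (-x.1) f) := by
  have h : ContinuousLinearMap.adjoint (orthantRep a x) f
      = ⟨indicatorMul gaussianProduct (orthant a) (shiftKoopman (-x.1) f),
        indicatorMul_orthant_mem a _⟩ := by
    refine ext_inner_right ℂ fun g => ?_
    rw [ContinuousLinearMap.adjoint_inner_left, Submodule.coe_inner, Submodule.coe_inner,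
      coe_orthantRep, inner_indicatorMul (measurableSet_orthant a), indicatorMul_coe,
      inner_shiftKoopman, neg_neg]
  rw [h]

theorem isIsometricRep_orthantRep (a : ℕ → ℝ) : IsIsometricRep (orthantRep a) where
  map_zero := by
    ext1 f
    exact Subtype.ext (shiftKoopman_zero f)
  map_add s t := by
    ext1 f
    exact Subtype.ext (shiftKoopman_add s.1 t.1 f)
  norm_map s f := norm_shiftKoopman s.1 f
  strong_continuous f :=
    ((continuous_shiftKoopman f).comp continuous_subtype_val).subtype_mk _

theorem preimage_shiftEquiv_orthant (a : ℕ → ℝ) (x : RInfty) :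
    shiftEquiv x ⁻¹' orthant (fun n => a n + x n) = orthant a := by
  ext y
  simp only [orthant, Set.mem_preimage, Set.mem_ofPred_eq, shiftEquiv_apply, add_comm (a _),
    add_le_add_iff_left]

theorem shiftKoopman_indicatorMul_orthant (a : ℕ → ℝ) (x : RInfty)
    (f : Lp ℂ 2 gaussianProduct) :
    shiftKoopman x (indicatorMul gaussianProduct (orthant a) f) =
      indicatorMul gaussianProduct (orthant fun n => a n + x n) (shiftKoopman x f) := by
  rw [shiftKoopman, indicatorMul_koopman _ (measurableSet_orthant _), preimage_shiftEquiv_orthant]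

/-- The range projections of the isometries are multiplications by indicators of translated
orthants. This is how the representation and its adjoints recover the position of `y` relative to
`a`. -/
theorem coe_orthantRep_adjoint (a : ℕ → ℝ) (x : RPlusInfty) (f : orthantL2 a) :
    (orthantRep a x (ContinuousLinearMap.adjoint (orthantRep a x) f) : Lp ℂ 2 gaussianProduct)
      = indicatorMul gaussianProduct (orthant fun n => a n + x.1 n) f := by
  rw [coe_orthantRep, coe_adjoint_orthantRep, shiftKoopman_indicatorMul_orthant,
    shiftKoopman_apply_neg]

/-- With `z = s e_j - t e_i`, both products are the translation by `z` followed by an indicator,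
that of `A` on one side and of `A + s e_j` on the other. Since `f` lives on `A`, its translate lives
on `A + z`, where coordinate `j` is already at least `a_j + s`; there the two indicators agree. -/
theorem isDoublyCommuting_orthantRep (a : ℕ → ℝ) : IsDoublyCommuting (orthantRep a) := by
  intro i j hij s t
  ext1 f
  refine Subtype.ext ?_
  rw [mul_apply_eq_comp, mul_apply_eq_comp, coe_adjoint_orthantRep,
    coe_orthantRep, coe_orthantRep, coe_adjoint_orthantRep, shiftKoopman_indicatorMul_orthant,
    ← shiftKoopman_add, ← shiftKoopman_add, add_comm (RPlusInfty.axis j s).1]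
  set z : RInfty := -(RPlusInfty.axis i t).1 + (RPlusInfty.axis j s).1 with hz
  rw [← indicatorMul_coe a f, shiftKoopman_indicatorMul_orthant,
    indicatorMul_indicatorMul (measurableSet_orthant _) (measurableSet_orthant _),
    indicatorMul_indicatorMul (measurableSet_orthant _) (measurableSet_orthant _)]
  refine congrArg (fun E => indicatorMul gaussianProduct E _) ?_
  have hs : ∀ n, (RPlusInfty.axis j s).1 n = if j = n then (s : ℝ) else 0 :=
    RInfty.single_apply j s
  have hzn : ∀ n, z n = -(if i = n then (t : ℝ) else 0) + if j = n then (s : ℝ) else 0 := by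
    intro n
    rw [hz, RInfty.add_apply, RInfty.neg_apply, hs]
    congr 2
    exact RInfty.single_apply i t n
  ext y
  simp only [orthant, Set.mem_inter_iff, Set.mem_ofPred_eq, hs, hzn]
  refine and_congr_left fun h => forall_congr' fun n => ?_
  by_cases hj : j = n
  · subst hj
    have h1 := h j
    simp only [hij, if_false, if_true, neg_zero, zero_add] at h1 ⊢
    have := s.2
    exact ⟨fun _ => h1, fun _ => by linarith [NNReal.coe_nonneg s]⟩
  · simp [hj]

/-- Multiplication by the indicator function of `{y | y - a ∈ S}` on `L²` of the orthant. -/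
def orthantMul (a : ℕ → ℝ) (S : Set (ℕ → ℝ)) : orthantL2 a →L[ℂ] orthantL2 a :=
  (indicatorMul gaussianProduct ((fun y n => y n - a n) ⁻¹' S)).restrict fun f hf => by
    classical
    by_cases hS : MeasurableSet ((fun (y : ℕ → ℝ) n => y n - a n) ⁻¹' S)
    · rw [← (mem_orthantL2_iff_indicatorMul a f).1 hf, indicatorMul_indicatorMul hS
        (measurableSet_orthant a), Set.inter_comm, ← indicatorMul_indicatorMul
        (measurableSet_orthant a) hS]
      exact indicatorMul_orthant_mem a _
    · rw [indicatorMul, dif_neg hS]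
      exact Submodule.zero_mem _

theorem coe_orthantMul (a : ℕ → ℝ) (S : Set (ℕ → ℝ)) (f : orthantL2 a) :
    (orthantMul a S f : Lp ℂ 2 gaussianProduct)
      = indicatorMul gaussianProduct ((fun y n => y n - a n) ⁻¹' S) f := rfl

theorem measurable_sub_const_seq (a : ℕ → ℝ) : Measurable fun (y : ℕ → ℝ) n => y n - a n := by
  fun_prop

theorem orthantMul_compl (a : ℕ → ℝ) {S : Set (ℕ → ℝ)} (hS : MeasurableSet S) (f : orthantL2 a) :
    orthantMul a Sᶜ f = f - orthantMul a S f := by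
  rw [eq_sub_iff_add_eq']
  exact Subtype.ext (indicatorMul_add_compl (measurable_sub_const_seq a hS) _)

theorem orthantMul_union (a : ℕ → ℝ) {S S' : Set (ℕ → ℝ)} (hS : MeasurableSet S)
    (hS' : MeasurableSet S') (hd : Disjoint S S') (f : orthantL2 a) :
    orthantMul a (S ∪ S') f = orthantMul a S f + orthantMul a S' f := by
  refine Subtype.ext ?_
  have hm := measurable_sub_const_seq a
  refine Lp.ext ?_
  rw [Submodule.coe_add]
  filter_upwards [indicatorMul_coeFn (hm (hS.union hS')) (f : Lp ℂ 2 gaussianProduct),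
    indicatorMul_coeFn (hm hS) (f : Lp ℂ 2 gaussianProduct),
    indicatorMul_coeFn (hm hS') (f : Lp ℂ 2 gaussianProduct),
    Lp.coeFn_add (orthantMul a S f : Lp ℂ 2 gaussianProduct) (orthantMul a S' f)] with y h1 h2 h3 h4
  rw [h4, Pi.add_apply, coe_orthantMul, coe_orthantMul, coe_orthantMul, h1, h2, h3,
    Set.preimage_union, Set.indicator_union_of_disjoint (hd.preimage _)]

theorem tendsto_orthantMul (a : ℕ → ℝ) {S : ℕ → Set (ℕ → ℝ)} {F : Set (ℕ → ℝ)}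
    (hS : ∀ n, MeasurableSet (S n)) (hF : MeasurableSet F)
    (h : ∀ y, ∀ᶠ n in atTop, (y ∈ S n ↔ y ∈ F)) (f : orthantL2 a) :
    Tendsto (fun n => orthantMul a (S n) f) atTop (𝓝 (orthantMul a F f)) := by
  rw [tendsto_subtype_rng]
  exact tendsto_indicatorMul (fun n => measurable_sub_const_seq a (hS n))
    (measurable_sub_const_seq a hF) (Eventually.of_forall fun y => h _) _

/-- The system of lower half-space conditions on finitely many coordinates. -/
def lowerBoxes : Set (Set (ℕ → ℝ)) :=
  {S | ∃ (s : Finset ℕ) (x : ℕ → ℝ), S = {z | ∀ n ∈ s, x n ≤ z n}}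

theorem isPiSystem_lowerBoxes : IsPiSystem lowerBoxes := by
  rintro _ ⟨s, x, rfl⟩ _ ⟨s', x', rfl⟩ -
  refine ⟨s ∪ s', fun n => if n ∈ s then (if n ∈ s' then max (x n) (x' n) else x n) else x' n, ?_⟩
  ext z
  simp only [Set.mem_inter_iff, Set.mem_ofPred_eq, Finset.mem_union]
  constructor
  · rintro ⟨h, h'⟩ n hn
    split_ifs with h1 h2
    · exact max_le (h n h1) (h' n h2)
    · exact h n h1
    · exact h' n (hn.resolve_left h1)
  · intro h
    refine ⟨fun n hn => ?_, fun n hn => ?_⟩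
    · have := h n (Or.inl hn)
      rw [if_pos hn] at this
      split_ifs at this with h2
      · exact (le_max_left _ _).trans this
      · exact this
    · have := h n (Or.inr hn)
      split_ifs at this with h2
      · exact (le_max_right _ _).trans this
      · exact this

theorem measurableSet_of_mem_lowerBoxes {S : Set (ℕ → ℝ)} (hS : S ∈ lowerBoxes) :
    MeasurableSet S := by
  obtain ⟨s, x, rfl⟩ := hS
  have : {z : ℕ → ℝ | ∀ n ∈ s, x n ≤ z n} = ⋂ n ∈ s, {z | x n ≤ z n} := by ext; simp
  rw [this]
  exact Finset.measurableSet_biInter _ fun n _ =>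
    measurableSet_le measurable_const (measurable_pi_apply n)

theorem generateFrom_lowerBoxes :
    (MeasurableSpace.pi : MeasurableSpace (ℕ → ℝ)) = MeasurableSpace.generateFrom lowerBoxes := by
  refine le_antisymm ?_ (MeasurableSpace.generateFrom_le fun S => measurableSet_of_mem_lowerBoxes)
  refine iSup_le fun n => ?_
  have hb := (BorelSpace.measurable_eq (α := ℝ)).trans (borel_eq_generateFrom_Ici ℝ)
  rw [hb, MeasurableSpace.comap_generateFrom]
  refine MeasurableSpace.generateFrom_mono ?_
  rintro _ ⟨_, ⟨c, rfl⟩, rfl⟩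
  exact ⟨{n}, fun _ => c, by ext; simp⟩

/-- A bounded operator that intertwines two orthant representations and their adjoints intertwines
the multiplication operators. -/
theorem intertwines_orthantMul {a b : ℕ → ℝ} (T : orthantL2 a →L[ℂ] orthantL2 b)
    (hT : ∀ x f, T (orthantRep a x f) = orthantRep b x (T f))
    (hT' : ∀ x f, T (ContinuousLinearMap.adjoint (orthantRep a x) f)
      = ContinuousLinearMap.adjoint (orthantRep b x) (T f))
    {S : Set (ℕ → ℝ)} (hS : MeasurableSet S) (f : orthantL2 a) :
    T (orthantMul a S f) = orthantMul b S (T f) := by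
  induction S, hS using MeasurableSpace.induction_on_inter generateFrom_lowerBoxes
    isPiSystem_lowerBoxes generalizing f with
  | empty =>
    have h0 : ∀ (c : ℕ → ℝ) (g : orthantL2 c), orthantMul c ∅ g = 0 := by
      intro c g
      have h1 := orthantMul_union c MeasurableSet.empty MeasurableSet.empty
        (Set.disjoint_empty _) g
      simpa using h1
    rw [h0, h0, map_zero]
  | basic S hS =>
    obtain ⟨s, x, rfl⟩ := hS
    -- On the orthant `y n - a n` is nonnegative, so a lower bound `x n` may be replaced by `max (x
    -- n) 0`. The box then becomes the range projection of an element of the positive cone.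
    let z : RInfty := ∑ n ∈ s, RInfty.single n (max (x n) 0)
    have hz : ∀ n, z n = if n ∈ s then max (x n) 0 else 0 :=
      RInfty.sum_single_apply s fun n => max (x n) 0
    let w : RPlusInfty := ⟨z, fun n => by rw [hz]; split_ifs <;> simp⟩
    have key : ∀ (c : ℕ → ℝ) (g : orthantL2 c), orthantMul c {z | ∀ n ∈ s, x n ≤ z n} g
        = orthantRep c w (ContinuousLinearMap.adjoint (orthantRep c w) g) := by
      intro c g
      refine Subtype.ext ?_
      rw [coe_orthantMul, coe_orthantRep_adjoint, ← indicatorMul_coe c g,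
        indicatorMul_indicatorMul (measurable_sub_const_seq c
          (measurableSet_of_mem_lowerBoxes ⟨s, x, rfl⟩)) (measurableSet_orthant _),
        indicatorMul_indicatorMul (measurableSet_orthant _) (measurableSet_orthant _)]
      refine congrArg (fun E => indicatorMul gaussianProduct E _) ?_
      ext y
      simp only [orthant, Set.mem_inter_iff, Set.mem_preimage, Set.mem_ofPred_eq]
      refine and_congr_left fun hy => ?_
      change _ ↔ ∀ n, c n + z n ≤ y n
      simp only [hz]
      constructor
      · intro h n
        split_ifs with hn
        · have h1 := h n hn
          have h2 := hy n
          rcases max_choice (x n) 0 with h3 | h3 <;> rw [h3] <;> linarith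
        · linarith [hy n]
      · intro h n hn
        have h1 := h n
        rw [if_pos hn] at h1
        linarith [le_max_left (x n) 0]
    rw [key, key, hT, hT']
  | compl S hS ih => rw [orthantMul_compl a hS, orthantMul_compl b hS, map_sub, ih]
  | iUnion S hd hS ih =>
    -- Finite disjoint unions follow from additivity. The countable union is their strong limit,
    -- which the bounded operator `T` preserves.
    have hm : ∀ N : ℕ, MeasurableSet (⋃ k ∈ Finset.range N, S k) := fun N =>
      Finset.measurableSet_biUnion _ fun k _ => hS k
    have hfin : ∀ N : ℕ, T (orthantMul a (⋃ k ∈ Finset.range N, S k) f)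
        = orthantMul b (⋃ k ∈ Finset.range N, S k) (T f) := by
      intro N
      induction N with
      | zero =>
        have h0 : ∀ (c : ℕ → ℝ) (g : orthantL2 c), orthantMul c ∅ g = 0 := by
          intro c g
          have h1 := orthantMul_union c MeasurableSet.empty MeasurableSet.empty
            (Set.disjoint_empty _) g
          simpa using h1
        simp [h0]
      | succ N ihN =>
        have h1 : (⋃ k ∈ Finset.range (N + 1), S k) = (⋃ k ∈ Finset.range N, S k) ∪ S N := by
          rw [Finset.range_add_one, Finset.set_biUnion_insert, Set.union_comm]
        have h2 : Disjoint (⋃ k ∈ Finset.range N, S k) (S N) := by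
          simp only [Set.disjoint_iUnion_left]
          intro k hk
          exact hd (Finset.mem_range.1 hk).ne
        rw [h1, orthantMul_union a (hm N) (hS N) h2, orthantMul_union b (hm N) (hS N) h2, map_add,
          ihN, ih]
    have hlim : ∀ y : ℕ → ℝ, ∀ᶠ N in atTop,
        (y ∈ ⋃ k ∈ Finset.range N, S k) ↔ y ∈ ⋃ k, S k := by
      intro y
      by_cases hy : y ∈ ⋃ k, S k
      · obtain ⟨k, hk⟩ := Set.mem_iUnion.1 hy
        filter_upwards [eventually_gt_atTop k] with N hN
        simp only [hy, iff_true]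
        exact Set.mem_biUnion (Finset.mem_coe.2 (Finset.mem_range.2 hN)) hk
      · refine Eventually.of_forall fun N => ?_
        simp only [hy, iff_false]
        intro h
        obtain ⟨k, -, hk⟩ := Set.mem_iUnion₂.1 h
        exact hy (Set.mem_iUnion.2 ⟨k, hk⟩)
    have hU := MeasurableSet.iUnion hS
    refine tendsto_nhds_unique
      ((T.continuous.tendsto _).comp (tendsto_orthantMul a hm hU hlim f)) ?_
    refine (tendsto_orthantMul b hm hU hlim (T f)).congr fun N => ?_
    rw [Function.comp, hfin]

end Orthant

/-! ### Disjointness of orthant representations -/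

section Disjointness

open ProbabilityTheory

/-- Absolute continuity of the integral of `|f|²`. Almost everywhere convergence of the indicators
is not needed. -/
theorem tendsto_indicatorMul_zero {X : Type*} [MeasurableSpace X] {μ : Measure X}
    {E : ℕ → Set X} (hE : ∀ n, MeasurableSet (E n)) (h : Tendsto (fun n => μ (E n)) atTop (𝓝 0))
    (f : Lp ℂ 2 μ) : Tendsto (fun n => indicatorMul μ (E n) f) atTop (𝓝 0) := by
  rw [tendsto_zero_iff_norm_tendsto_zero]
  have key : ∀ n, ‖indicatorMul μ (E n) f‖ ^ 2 = ∫ y in E n, ‖f y‖ ^ 2 ∂μ := by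
    intro n
    rw [← sub_zero (indicatorMul μ (E n) f), norm_sub_sq_eq_integral,
      ← integral_indicator (hE n)]
    refine integral_congr_ae ?_
    filter_upwards [indicatorMul_coeFn (hE n) f, Lp.coeFn_zero ℂ 2 μ] with y h1 h2
    rw [h1, h2]
    by_cases hy : y ∈ E n <;> simp [hy]
  have hi : Integrable (fun y => ‖f y‖ ^ 2) μ := (Lp.memLp f).integrable_norm_pow (by norm_num)
  have h1 := ((hi.tendsto_setIntegral_nhds_zero h).congr fun n => (key n).symm).sqrt
  simpa [Real.sqrt_sq] using h1

theorem memLp_eval_gaussianProduct (n : ℕ) :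
    MemLp (fun y : ℕ → ℝ => y n) 2 gaussianProduct :=
  (memLp_id_gaussianReal (μ := 0) (v := 1) 2).comp_measurePreserving
    (measurePreserving_eval_infinitePi (fun _ : ℕ => gaussianReal 0 1) n)

theorem iIndepFun_eval_gaussianProduct :
    iIndepFun (fun (n : ℕ) (y : ℕ → ℝ) => y n) gaussianProduct :=
  iIndepFun_infinitePi (X := fun _ u => u) fun _ => measurable_id

theorem integral_eval_gaussianProduct (n : ℕ) : ∫ y, y n ∂gaussianProduct = 0 := by
  have h := (measurePreserving_eval_infinitePi (fun _ : ℕ => gaussianReal 0 1) n).map_eq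
  have h1 : ∫ u, u ∂(gaussianProduct.map (Function.eval n)) = ∫ y, y n ∂gaussianProduct :=
    integral_map (measurable_pi_apply n).aemeasurable (by fun_prop)
  rw [← h1]
  unfold gaussianProduct
  rw [h, integral_id_gaussianReal]

theorem variance_eval_gaussianProduct (n : ℕ) : Var[fun y => y n; gaussianProduct] = 1 := by
  have h := (measurePreserving_eval_infinitePi (fun _ : ℕ => gaussianReal 0 1) n).map_eq
  have h1 : Var[id; gaussianProduct.map (Function.eval n)] = Var[fun y => y n; gaussianProduct] :=
    variance_map aemeasurable_id (measurable_pi_apply n).aemeasurable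
  rw [← h1]
  unfold gaussianProduct
  rw [h, variance_id_gaussianReal]
  rfl

/-- Chebyshev's inequality for a linear form in finitely many Gaussian coordinates. -/
theorem gaussianProduct_abs_sum_ge_le (s : Finset ℕ) (c : ℕ → ℝ)
    (hc : 0 < ∑ n ∈ s, c n ^ 2) :
    gaussianProduct {y | (∑ n ∈ s, c n ^ 2) / 2 ≤ |∑ n ∈ s, c n * y n|}
      ≤ ENNReal.ofReal (4 / ∑ n ∈ s, c n ^ 2) := by
  set σ := ∑ n ∈ s, c n ^ 2 with hσ
  have hmem : ∀ n, MemLp (fun y : ℕ → ℝ => c n * y n) 2 gaussianProduct := fun n =>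
    (memLp_eval_gaussianProduct n).const_mul (c n)
  have hmemS : MemLp (fun y : ℕ → ℝ => ∑ n ∈ s, c n * y n) 2 gaussianProduct :=
    memLp_finsetSum s fun n _ => hmem n
  have hmean : ∫ y, ∑ n ∈ s, c n * y n ∂gaussianProduct = 0 := by
    rw [integral_finsetSum _ fun n _ => (hmem n).integrable (by norm_num)]
    simp [integral_const_mul, integral_eval_gaussianProduct]
  have hvar : Var[fun y : ℕ → ℝ => ∑ n ∈ s, c n * y n; gaussianProduct] = σ := by
    have h1 := IndepFun.variance_sum (μ := gaussianProduct) (s := s)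
      (X := fun n (y : ℕ → ℝ) => c n * y n) (fun n _ => hmem n) (by
        intro i _ j _ hij
        exact (iIndepFun_eval_gaussianProduct.indepFun hij).comp (φ := fun u => c i * u)
          (ψ := fun u => c j * u) (by fun_prop) (by fun_prop))
    have h2 : (∑ n ∈ s, fun y : ℕ → ℝ => c n * y n) = fun y => ∑ n ∈ s, c n * y n := by
      ext y; simp
    rw [h2] at h1
    rw [h1, hσ]
    refine Finset.sum_congr rfl fun n _ => ?_
    rw [variance_const_mul, variance_eval_gaussianProduct, mul_one]
  have h := meas_ge_le_variance_div_sq hmemS (c := σ / 2) (by positivity)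
  rw [hvar, hmean] at h
  simp only [sub_zero] at h
  refine h.trans (le_of_eq ?_)
  congr 1
  field_simp
  norm_num

theorem orthantMul_add_orthantMul_compl (a : ℕ → ℝ) {S : Set (ℕ → ℝ)} (hS : MeasurableSet S)
    (f : orthantL2 a) : orthantMul a S f + orthantMul a Sᶜ f = f := by
  rw [orthantMul_compl a hS, add_sub_cancel]

theorem tendsto_orthantMul_zero (a : ℕ → ℝ) {S : ℕ → Set (ℕ → ℝ)} (hS : ∀ n, MeasurableSet (S n))
    (h : Tendsto (fun n => gaussianProduct ((fun y n => y n - a n) ⁻¹' S n)) atTop (𝓝 0))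
    (f : orthantL2 a) : Tendsto (fun n => orthantMul a (S n) f) atTop (𝓝 0) := by
  rw [tendsto_subtype_rng]
  exact tendsto_indicatorMul_zero (fun n => measurable_sub_const_seq a (hS n)) h _

/-- If `a - b` is not square summable, then the translates of the Gaussian product measure by `-a`
and `-b` are asymptotically separated. -/
theorem exists_separating_sets {a b : ℕ → ℝ} (hab : ¬ Memℓp (fun n => a n - b n) 2) :
    ∃ S : ℕ → Set (ℕ → ℝ), (∀ n, MeasurableSet (S n)) ∧
      Tendsto (fun n => gaussianProduct ((fun y n => y n - a n) ⁻¹' S n)) atTop (𝓝 0) ∧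
      Tendsto (fun n => gaussianProduct ((fun y n => y n - b n) ⁻¹' (S n)ᶜ)) atTop (𝓝 0) := by
  set c : ℕ → ℝ := fun n => a n - b n with hc
  set σ : ℕ → ℝ := fun N => ∑ n ∈ Finset.range N, c n ^ 2 with hσ
  have hσlim : Tendsto σ atTop atTop := by
    have h1 : ¬ Summable fun n => c n ^ 2 := by
      intro h
      refine hab ((memℓp_gen_iff (by norm_num)).2 ?_)
      simpa using h
    exact (not_summable_iff_tendsto_nat_atTop_of_nonneg fun n => sq_nonneg _).1 h1
  -- The linear form with coefficients `c` has mean zero and variance `σ N`, so a deviation of `σ N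
  -- / 2` has probability at most `4 / σ N`, which tends to zero exactly because `c` is not square
  -- summable.
  have htail : Tendsto (fun N => gaussianProduct {y | σ N / 2 ≤
      |∑ n ∈ Finset.range N, c n * y n|}) atTop (𝓝 0) := by
    have h1 : Tendsto (fun N => ENNReal.ofReal (4 / σ N)) atTop (𝓝 0) := by
      rw [← ENNReal.ofReal_zero]
      exact ENNReal.tendsto_ofReal (tendsto_const_nhds.div_atTop hσlim)
    refine tendsto_of_tendsto_of_tendsto_of_le_of_le' tendsto_const_nhds h1
      (Eventually.of_forall fun N => zero_le) ?_
    filter_upwards [hσlim.eventually_gt_atTop 0] with N hN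
    exact gaussianProduct_abs_sum_ge_le _ _ hN
  -- Under `z = y - a` and `z = y - b` the form has means `-∑ c a` and `-∑ c b`, which differ by `σ
  -- N`. The threshold is their midpoint, so either error event forces a deviation of at least `σ N
  -- / 2`.
  refine ⟨fun N => {z | -∑ n ∈ Finset.range N, c n * a n + σ N / 2
    < ∑ n ∈ Finset.range N, c n * z n}, fun N => measurableSet_lt measurable_const
      (Finset.measurable_fun_sum _ fun n _ => by fun_prop), ?_, ?_⟩
  · refine tendsto_of_tendsto_of_tendsto_of_le_of_le tendsto_const_nhds htail (fun _ => zero_le)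
      fun N => measure_mono fun y hy => ?_
    simp only [Set.mem_preimage, Set.mem_ofPred_eq, mul_sub, Finset.sum_sub_distrib] at hy ⊢
    exact le_trans (by linarith) (le_abs_self _)
  · refine tendsto_of_tendsto_of_tendsto_of_le_of_le tendsto_const_nhds htail (fun _ => zero_le)
      fun N => measure_mono fun y hy => ?_
    have h1 : σ N = ∑ n ∈ Finset.range N, c n * a n - ∑ n ∈ Finset.range N, c n * b n := by
      rw [← Finset.sum_sub_distrib]
      exact Finset.sum_congr rfl fun n _ => by simp only [hc]; ring
    simp only [Set.mem_preimage, Set.mem_compl_iff, Set.mem_ofPred_eq, mul_sub, not_lt,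
      Finset.sum_sub_distrib] at hy ⊢
    exact le_trans (by linarith) (neg_le_abs _)

/-- If `a - b` is not square summable, there are no nonzero intertwiners between the orthant
representations of `a` and `b`. -/
theorem intertwiner_apply_eq_zero {a b : ℕ → ℝ} (hab : ¬ Memℓp (fun n => a n - b n) 2)
    (T : orthantL2 a →L[ℂ] orthantL2 b)
    (hT : ∀ x f, T (orthantRep a x f) = orthantRep b x (T f))
    (hT' : ∀ x f, T (ContinuousLinearMap.adjoint (orthantRep a x) f)
      = ContinuousLinearMap.adjoint (orthantRep b x) (T f)) (f : orthantL2 a) : T f = 0 := by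
  obtain ⟨S, hSm, hSa, hSb⟩ := exists_separating_sets hab
  -- The part of `f` in `S N` is small because `S N` is rare for `y - a`. The image of the remainder
  -- equals the part of `T f` in the complement, which is small because the complement is rare for
  -- `y - b`.
  have h1 : ∀ N, T f = T (orthantMul a (S N) f) + orthantMul b (S N)ᶜ (T f) := by
    intro N
    rw [← intertwines_orthantMul T hT hT' (hSm N).compl, ← map_add,
      orthantMul_add_orthantMul_compl a (hSm N)]
  have h2 := ((T.continuous.tendsto 0).comp (tendsto_orthantMul_zero a hSm hSa f)).add
    (tendsto_orthantMul_zero b (fun n => (hSm n).compl) hSb (T f))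
  rw [map_zero, add_zero] at h2
  exact tendsto_nhds_unique (tendsto_const_nhds.congr h1) h2

end Disjointness

/-! ### Thresholds -/

section Thresholds

open ProbabilityTheory

/-- With `q n` the mass below `a n`, the bound `1 - q ≤ exp (-q)` and the decrease of the partial
products to `p > 0` bound the partial sums of `q` by `-log p`. -/
theorem summable_gaussianReal_Iio {a : ℕ → ℝ} (ha : a ∈ thresholds) :
    Summable fun n => (gaussianReal 0 1).real (Set.Iio (a n)) := by
  obtain ⟨-, p, hp, hlim⟩ := ha
  set q : ℕ → ℝ := fun n => (gaussianReal 0 1).real (Set.Iio (a n)) with hq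
  have h1 : ∀ n, (gaussianReal 0 1).real (Set.Ici (a n)) = 1 - q n := fun n => by
    rw [hq, ← Set.compl_Iio, probReal_compl_eq_one_sub measurableSet_Iio]
  have hanti : Antitone fun N => ∏ n ∈ Finset.range N,
      (gaussianReal 0 1).real (Set.Ici (a n)) := by
    refine antitone_nat_of_succ_le fun N => ?_
    rw [Finset.prod_range_succ]
    exact mul_le_of_le_one_right (Finset.prod_nonneg fun _ _ => measureReal_nonneg)
      measureReal_le_one
  refine summable_of_sum_range_le (c := -Real.log p) (fun n => measureReal_nonneg) fun N => ?_
  have h2 : p ≤ Real.exp (-∑ n ∈ Finset.range N, q n) := by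
    refine (hanti.le_of_tendsto hlim N).trans ?_
    rw [← Finset.sum_neg_distrib, Real.exp_sum]
    refine Finset.prod_le_prod (fun _ _ => measureReal_nonneg) fun n _ => ?_
    rw [h1]
    linarith [Real.add_one_le_exp (-q n)]
  have h3 := (Real.log_le_iff_le_exp hp).2 h2
  linarith

theorem measure_eval_preimage (n : ℕ) {s : Set ℝ} (hs : MeasurableSet s) :
    gaussianProduct ((fun y => y n) ⁻¹' s) = gaussianReal 0 1 s :=
  (measurePreserving_eval_infinitePi (fun _ : ℕ => gaussianReal 0 1) n).measure_preimage
    hs.nullMeasurableSet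

/-- First Borel–Cantelli lemma. This is the form in which positivity of the infinite product enters
the approximation of orthants. -/
theorem ae_eventually_ge {a : ℕ → ℝ} (ha : a ∈ thresholds) :
    ∀ᵐ y ∂gaussianProduct, ∀ᶠ n in atTop, a n ≤ y n := by
  have h : ∑' n, gaussianProduct ((fun y => y n) ⁻¹' Set.Iio (a n)) ≠ ∞ := by
    have h1 : ∀ n, gaussianProduct ((fun y => y n) ⁻¹' Set.Iio (a n))
        = ENNReal.ofReal ((gaussianReal 0 1).real (Set.Iio (a n))) := fun n => by
      rw [measure_eval_preimage n measurableSet_Iio, ofReal_measureReal]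
    simp_rw [h1]
    exact (summable_gaussianReal_Iio ha).tsum_ofReal_ne_top
  filter_upwards [ae_eventually_notMem h] with y hy
  filter_upwards [hy] with n hn
  simpa using hn

theorem gaussianProduct_orthant_ne_zero {a : ℕ → ℝ} (ha : a ∈ thresholds) :
    gaussianProduct (orthant a) ≠ 0 := by
  obtain ⟨-, p, hp, hlim⟩ := ha
  set B : ℕ → Set (ℕ → ℝ) := fun N => Set.pi (Finset.range N) fun n => Set.Ici (a n) with hB
  have hBm : ∀ N, MeasurableSet (B N) := fun N =>
    MeasurableSet.pi (Finset.countable_toSet _) fun _ _ => measurableSet_Ici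
  have h1 : ∀ N, gaussianProduct (B N) = ENNReal.ofReal (∏ n ∈ Finset.range N,
      (gaussianReal 0 1).real (Set.Ici (a n))) := by
    intro N
    rw [gaussianProduct, Measure.infinitePi_pi _ fun _ _ => measurableSet_Ici,
      ENNReal.ofReal_prod_of_nonneg fun _ _ => measureReal_nonneg]
    simp
  have h2 : orthant a = ⋂ N, B N := by
    ext y
    simp only [orthant, hB, Set.mem_iInter, Set.mem_pi, Finset.mem_coe, Finset.mem_range,
      Set.mem_Ici, Set.mem_ofPred_eq]
    exact ⟨fun h N n _ => h n, fun h n => h (n + 1) n n.lt_succ_self⟩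
  have hanti : Antitone B := fun M N hMN y hy n hn =>
    hy n (Finset.mem_coe.2 (Finset.range_mono hMN (Finset.mem_coe.1 hn)))
  have h3 : Tendsto (fun N => gaussianProduct (B N)) atTop (𝓝 (gaussianProduct (orthant a))) := by
    rw [h2]
    exact tendsto_measure_iInter_atTop (fun N => (hBm N).nullMeasurableSet) hanti
      ⟨0, measure_ne_top _ _⟩
  simp_rw [h1] at h3
  rw [tendsto_nhds_unique h3 (ENNReal.tendsto_ofReal hlim)]
  simpa using hp

end Thresholds

/-! ### Exchanging finitely many coordinates -/

section Swap

open ProbabilityTheory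

/-- Replace the coordinates in `s` of the first sequence by those of the second. -/
def mixCoords (s : Finset ℕ) (y y' : ℕ → ℝ) : ℕ → ℝ := fun n => if n ∈ s then y' n else y n

/-- Exchange the coordinates in `s` of two sequences. -/
def swapCoords (s : Finset ℕ) (p : (ℕ → ℝ) × (ℕ → ℝ)) : (ℕ → ℝ) × (ℕ → ℝ) :=
  (mixCoords s p.1 p.2, mixCoords s p.2 p.1)

theorem measurable_swapCoords (s : Finset ℕ) : Measurable (swapCoords s) := by
  refine Measurable.prodMk ?_ ?_ <;>
  · refine measurable_pi_lambda _ fun n => ?_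
    simp only [mixCoords]
    split_ifs <;> fun_prop

/-- All coordinates of both sequences are independent with the same law, so an exchange only
permutes equal factors of the measure of a box. -/
theorem measurePreserving_swapCoords (s : Finset ℕ) :
    MeasurePreserving (swapCoords s) (gaussianProduct.prod gaussianProduct)
      (gaussianProduct.prod gaussianProduct) := by
  refine ⟨measurable_swapCoords s, Eq.symm ?_⟩
  have hspan : gaussianProduct.FiniteSpanningSetsIn lowerBoxes :=
    { set := fun _ => Set.univ
      set_mem := fun _ => ⟨∅, 0, by simp⟩
      finite := fun _ => measure_lt_top _ _
      spanning := Set.iUnion_const _ }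
  refine Measure.prod_eq_generateFrom generateFrom_lowerBoxes.symm generateFrom_lowerBoxes.symm
    isPiSystem_lowerBoxes isPiSystem_lowerBoxes hspan hspan ?_
  rintro _ ⟨s₁, x₁, rfl⟩ _ ⟨s₂, x₂, rfl⟩
  -- Both boxes are written over the common index set `s₁ ∪ s₂`, so that the exchange acts on them
  -- side by side.
  have hbox : ∀ (r : Finset ℕ) (x : ℕ → ℝ), r ⊆ s₁ ∪ s₂ → {z : ℕ → ℝ | ∀ n ∈ r, x n ≤ z n}
      = Set.pi (s₁ ∪ s₂ : Finset ℕ) fun n => if n ∈ r then Set.Ici (x n) else Set.univ := by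
    intro r x hr
    ext z
    simp only [Set.mem_ofPred_eq, Set.mem_pi]
    constructor
    · intro h n _
      split_ifs with hn
      · exact h n hn
      · trivial
    · intro h n hn
      simpa [hn] using h n (Finset.mem_coe.2 (hr hn))
  rw [hbox s₁ x₁ Finset.subset_union_left, hbox s₂ x₂ Finset.subset_union_right]
  set t₁ : ℕ → Set ℝ := fun n => if n ∈ s₁ then Set.Ici (x₁ n) else Set.univ with ht₁
  set t₂ : ℕ → Set ℝ := fun n => if n ∈ s₂ then Set.Ici (x₂ n) else Set.univ with ht₂
  have hm₁ : ∀ n, MeasurableSet (t₁ n) := fun n => by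
    simp only [ht₁]; split_ifs <;> simp [measurableSet_Ici]
  have hm₂ : ∀ n, MeasurableSet (t₂ n) := fun n => by
    simp only [ht₂]; split_ifs <;> simp [measurableSet_Ici]
  have hpre : swapCoords s ⁻¹' (Set.pi (s₁ ∪ s₂ : Finset ℕ) t₁ ×ˢ Set.pi (s₁ ∪ s₂ : Finset ℕ) t₂)
      = Set.pi (s₁ ∪ s₂ : Finset ℕ) (fun n => if n ∈ s then t₂ n else t₁ n) ×ˢ
        Set.pi (s₁ ∪ s₂ : Finset ℕ) (fun n => if n ∈ s then t₁ n else t₂ n) := by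
    ext ⟨y, y'⟩
    simp only [swapCoords, mixCoords, Set.mem_preimage, Set.mem_prod, Set.mem_pi,
      ← forall₂_and]
    refine forall₂_congr fun n _ => ?_
    split_ifs <;> tauto
  have hpim : ∀ t : ℕ → Set ℝ, (∀ n, MeasurableSet (t n)) →
      MeasurableSet (Set.pi (s₁ ∪ s₂ : Finset ℕ) t) := fun t ht =>
    MeasurableSet.pi (Finset.countable_toSet _) fun n _ => ht n
  rw [Measure.map_apply (measurable_swapCoords s) ((hpim _ hm₁).prod (hpim _ hm₂)), hpre,
    Measure.prod_prod]
  unfold gaussianProduct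
  rw [Measure.infinitePi_pi _ fun n _ => by split_ifs <;> simp [hm₁, hm₂],
    Measure.infinitePi_pi _ fun n _ => by split_ifs <;> simp [hm₁, hm₂],
    Measure.infinitePi_pi _ fun n _ => hm₁ n, Measure.infinitePi_pi _ fun n _ => hm₂ n,
    ← Finset.prod_mul_distrib, ← Finset.prod_mul_distrib]
  refine Finset.prod_congr rfl fun n _ => ?_
  split_ifs
  · exact mul_comm _ _
  · rfl

end Swap

/-! ### Irreducibility -/

section Irreducibility

theorem exists_seq_ae_tendsto {X : Type*} [MeasurableSpace X] {μ : Measure X}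
    {u : ℕ → Lp ℂ 2 μ} {f : Lp ℂ 2 μ} (h : Tendsto u atTop (𝓝 f)) :
    ∃ ns : ℕ → ℕ, StrictMono ns ∧
      ∀ᵐ x ∂μ, Tendsto (fun i => u (ns i) x) atTop (𝓝 (f x)) :=
  (tendstoInMeasure_of_tendsto_Lp h).exists_seq_tendsto_ae

/-- The indicator function of the orthant. -/
def orthantOne (a : ℕ → ℝ) : orthantL2 a :=
  ⟨indicatorConstLp 2 (measurableSet_orthant a) (measure_ne_top _ _) 1, by
    rw [mem_orthantL2_iff]
    filter_upwards [indicatorConstLp_coeFn (p := 2) (hs := measurableSet_orthant a)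
      (hμs := measure_ne_top gaussianProduct _) (c := (1 : ℂ))] with y hy hya
    rw [hy, Set.indicator_of_notMem hya]⟩

theorem orthantOne_coeFn (a : ℕ → ℝ) : (orthantOne a : Lp ℂ 2 gaussianProduct)
    =ᵐ[gaussianProduct] (orthant a).indicator fun _ => (1 : ℂ) :=
  indicatorConstLp_coeFn (hs := measurableSet_orthant a) (hμs := measure_ne_top _ _)

/-- The orthogonal projection onto `L²` of the orthant. -/
def orthantProj (a : ℕ → ℝ) : Lp ℂ 2 gaussianProduct →L[ℂ] orthantL2 a :=
  (indicatorMul gaussianProduct (orthant a)).codRestrict _ (indicatorMul_orthant_mem a)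

theorem coe_orthantProj (a : ℕ → ℝ) (f : Lp ℂ 2 gaussianProduct) :
    (orthantProj a f : Lp ℂ 2 gaussianProduct) = indicatorMul gaussianProduct (orthant a) f := rfl

theorem orthantProj_coe (a : ℕ → ℝ) (f : orthantL2 a) : orthantProj a f = f :=
  Subtype.ext (indicatorMul_coe a f)

theorem preimage_sub_preimage_add (a : ℕ → ℝ) (E : Set (ℕ → ℝ)) :
    (fun (y : ℕ → ℝ) n => y n - a n) ⁻¹' ((fun (z : ℕ → ℝ) n => z n + a n) ⁻¹' E) = E := by
  ext y; simp

/-- An operator commuting with all multiplication operators is the multiplication by the image of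
the constant function. -/
theorem apply_coeFn_of_commute {a : ℕ → ℝ} (T : orthantL2 a →L[ℂ] orthantL2 a)
    (hT : ∀ S, MeasurableSet S → ∀ f, T (orthantMul a S f) = orthantMul a S (T f))
    (f : orthantL2 a) :
    (T f : Lp ℂ 2 gaussianProduct) =ᵐ[gaussianProduct] fun y =>
      (T (orthantOne a) : Lp ℂ 2 gaussianProduct) y * (f : Lp ℂ 2 gaussianProduct) y := by
  set φ : Lp ℂ 2 gaussianProduct := (T (orthantOne a)).1 with hφ
  have hφ0 : ∀ᵐ y ∂gaussianProduct, y ∉ orthant a → φ y = 0 :=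
    (mem_orthantL2_iff a φ).1 (T (orthantOne a)).2
  -- Precomposing with the projection moves the claim to all of `L²`, where induction over simple
  -- functions is possible.
  suffices h : ∀ g : Lp ℂ 2 gaussianProduct,
      (T (orthantProj a g) : Lp ℂ 2 gaussianProduct) =ᵐ[gaussianProduct] fun y => φ y * g y by
    have := h f
    rwa [orthantProj_coe] at this
  intro g
  induction g using Lp.induction (p := 2) ENNReal.ofNat_ne_top with
  | indicatorConst c hs hμs =>
    rename_i s
    have hS : MeasurableSet ((fun (z : ℕ → ℝ) n => z n + a n) ⁻¹' s) :=
      (show Measurable fun (z : ℕ → ℝ) n => z n + a n by fun_prop) hs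
    have h1 : orthantProj a (Lp.simpleFunc.indicatorConst 2 hs hμs.ne c : Lp ℂ 2 gaussianProduct)
        = c • orthantMul a ((fun (z : ℕ → ℝ) n => z n + a n) ⁻¹' s) (orthantOne a) := by
      refine Subtype.ext ?_
      rw [coe_orthantProj, Lp.simpleFunc.coe_indicatorConst, Submodule.coe_smul, coe_orthantMul,
        preimage_sub_preimage_add]
      refine Lp.ext ?_
      filter_upwards [indicatorMul_coeFn (measurableSet_orthant a)
          (indicatorConstLp 2 hs hμs.ne c), indicatorConstLp_coeFn (p := 2) (hs := hs)
          (hμs := hμs.ne) (c := c), Lp.coeFn_smul c (indicatorMul gaussianProduct s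
          (orthantOne a : Lp ℂ 2 gaussianProduct)), indicatorMul_coeFn hs
          (orthantOne a : Lp ℂ 2 gaussianProduct), orthantOne_coeFn a] with y h1 h2 h3 h4 h5
      rw [h1, h3, Pi.smul_apply, h4]
      by_cases hy : y ∈ s <;> by_cases hya : y ∈ orthant a <;> simp [hy, hya, h2, h5]
    rw [h1, map_smul, hT _ hS, Lp.simpleFunc.coe_indicatorConst, Submodule.coe_smul,
      coe_orthantMul, preimage_sub_preimage_add]
    filter_upwards [indicatorConstLp_coeFn (p := 2) (hs := hs) (hμs := hμs.ne) (c := c),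
      Lp.coeFn_smul c (indicatorMul gaussianProduct s φ), indicatorMul_coeFn hs φ]
      with y h2 h3 h4
    rw [h3, h2, Pi.smul_apply, h4]
    by_cases hy : y ∈ s <;> simp [hy, mul_comm]
  | add hf hg _ ihf ihg =>
    rename_i u v _
    rw [map_add, map_add, Submodule.coe_add]
    filter_upwards [ihf, ihg, Lp.coeFn_add (T (orthantProj a (hf.toLp u))).1
      (T (orthantProj a (hg.toLp v))).1, Lp.coeFn_add (hf.toLp u) (hg.toLp v)] with y h1 h2 h3 h4
    rw [h3, h4, Pi.add_apply, Pi.add_apply, h1, h2, mul_add]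
  | isClosed =>
    -- The multiplier `φ` is so far only square integrable, so multiplication by it need not be
    -- continuous on `L²`. Closedness comes instead from subsequences that converge almost
    -- everywhere.
    refine IsSeqClosed.isClosed fun u g hu hlim => ?_
    obtain ⟨ns, hns, hg⟩ := exists_seq_ae_tendsto hlim
    have hTu : Tendsto (fun k => (T (orthantProj a (u (ns k)))).1) atTop
        (𝓝 (T (orthantProj a g)).1) :=
      ((continuous_subtype_val.comp (T.continuous.comp (orthantProj a).continuous)).tendsto g).comp
        (hlim.comp hns.tendsto_atTop)
    obtain ⟨ms, hms, hTg⟩ := exists_seq_ae_tendsto hTu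
    have hae : ∀ᵐ y ∂gaussianProduct, ∀ k, (T (orthantProj a (u k))).1 y = φ y * u k y :=
      ae_all_iff.2 fun k => hu k
    filter_upwards [hg, hTg, hae] with y h1 h2 h3
    refine tendsto_nhds_unique h2 ?_
    simp_rw [h3]
    exact (h1.comp hms.tendsto_atTop).const_mul _

/-- The multiplier of an operator in the commutant is invariant under translations. -/
theorem multiplier_shift {a : ℕ → ℝ} (T : orthantL2 a →L[ℂ] orthantL2 a)
    (hT : ∀ S, MeasurableSet S → ∀ f, T (orthantMul a S f) = orthantMul a S (T f))
    (hV : ∀ x f, T (orthantRep a x f) = orthantRep a x (T f)) (x : RPlusInfty) :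
    ∀ᵐ y ∂gaussianProduct, y ∈ orthant a →
      (T (orthantOne a) : Lp ℂ 2 gaussianProduct) (shiftEquiv x.1 y)
        = (T (orthantOne a) : Lp ℂ 2 gaussianProduct) y := by
  set φ : Lp ℂ 2 gaussianProduct := (T (orthantOne a)).1 with hφ
  have h1 := apply_coeFn_of_commute T hT (orthantRep a x (orthantOne a))
  rw [hV] at h1
  set D := (gaussianProduct.map (shiftEquiv x.1)).rnDeriv gaussianProduct with hD
  have h2 : ∀ᵐ y ∂gaussianProduct, (Real.sqrt (D y).toReal : ℂ) * φ ((shiftEquiv x.1).symm y)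
      = φ y * ((Real.sqrt (D y).toReal : ℂ) *
        (orthantOne a : Lp ℂ 2 gaussianProduct) ((shiftEquiv x.1).symm y)) := by
    filter_upwards [h1, koopman_coeFn gaussianProduct (shiftEquiv x.1) φ,
      koopman_coeFn gaussianProduct (shiftEquiv x.1) (orthantOne a : Lp ℂ 2 gaussianProduct)]
      with y h3 h4 h5
    exact h4.symm.trans (h3.trans (congrArg (φ y * ·) h5))
  -- The square root of the density appears on both sides of `h2`. It is positive and finite at
  -- almost every translated point and can be cancelled.
  have hpos : ∀ᵐ y ∂gaussianProduct, 0 < D (shiftEquiv x.1 y) :=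
    ae_of_ae_map (shiftEquiv x.1).measurable.aemeasurable
      (Measure.rnDeriv_pos (map_shiftEquiv_absolutelyContinuous x.1))
  have hfin : ∀ᵐ y ∂gaussianProduct, D (shiftEquiv x.1 y) < ∞ :=
    ae_comp_shiftEquiv x.1 (Measure.rnDeriv_lt_top _ _)
  filter_upwards [ae_comp_shiftEquiv x.1 h2, hpos, hfin, orthantOne_coeFn a]
    with y h3 h4 h5 h6 hy
  rw [MeasurableEquiv.symm_apply_apply, h6, Set.indicator_of_mem hy, mul_one] at h3
  have h7 : (Real.sqrt (D (shiftEquiv x.1 y)).toReal : ℂ) ≠ 0 := by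
    rw [Complex.ofReal_ne_zero]
    exact (Real.sqrt_pos.2 (ENNReal.toReal_pos h4.ne' h5.ne)).ne'
  rw [mul_comm] at h3
  exact (mul_right_cancel₀ h7 h3).symm

/-- A function that is invariant under translations inside the orthant does not depend on finitely
many coordinates. -/
theorem ae_eq_mixCoords {a : ℕ → ℝ} {φ : (ℕ → ℝ) → ℂ} (hφ : StronglyMeasurable φ)
    (h : ∀ x : RPlusInfty, ∀ᵐ y ∂gaussianProduct, y ∈ orthant a → φ (shiftEquiv x.1 y) = φ y)
    (s : Finset ℕ) :
    ∀ᵐ p ∂gaussianProduct.prod gaussianProduct, p.1 ∈ orthant a → p.2 ∈ orthant a →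
      φ p.1 = φ (mixCoords s p.1 p.2) := by
  -- For `p = (y, y')` this is `y` translated by `∑ (y' n - a n) e_n` over `n ∈ s`. On `s` it is the
  -- symmetric expression `y n + y' n - a n`, so exchanging the coordinates in `s` leaves it
  -- unchanged. Comparing `p` with its exchange therefore yields the claim.
  set sh : (ℕ → ℝ) × (ℕ → ℝ) → ℕ → ℝ := fun p n => if n ∈ s then p.1 n + (p.2 n - a n) else p.1 n
    with hsh
  have hshm : Measurable sh := by
    refine measurable_pi_lambda _ fun n => ?_
    simp only [hsh]
    split_ifs <;> fun_prop
  have h1 : ∀ᵐ p ∂gaussianProduct.prod gaussianProduct, p.1 ∈ orthant a → p.2 ∈ orthant a →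
      φ (sh p) = φ p.1 := by
    have hmeas : MeasurableSet {p : (ℕ → ℝ) × (ℕ → ℝ) | p.1 ∈ orthant a → p.2 ∈ orthant a →
        φ (sh p) = φ p.1} := by
      have e1 : {p : (ℕ → ℝ) × (ℕ → ℝ) | p.1 ∈ orthant a → p.2 ∈ orthant a → φ (sh p) = φ p.1}
          = (Prod.fst ⁻¹' orthant a)ᶜ ∪ (Prod.snd ⁻¹' orthant a)ᶜ ∪ {p | φ (sh p) = φ p.1} := by
        ext p
        simp only [Set.mem_ofPred_eq, Set.mem_union, Set.mem_compl_iff, Set.mem_preimage]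
        tauto
      rw [e1]
      refine ((measurable_fst (measurableSet_orthant a)).compl.union
        (measurable_snd (measurableSet_orthant a)).compl).union ?_
      exact measurableSet_eq_fun (hφ.measurable.comp hshm) (hφ.measurable.comp measurable_fst)
    -- For fixed `y'` in the orthant the translation is by one fixed nonnegative vector, to which
    -- `h` applies. Fubini therefore has to be used with `y'` as the outer variable.
    have hsw : ∀ᵐ p ∂gaussianProduct.prod gaussianProduct,
        p.2 ∈ orthant a → p.1 ∈ orthant a → φ (sh p.swap) = φ p.2 := by
      refine (Measure.ae_prod_iff_ae_ae (measurable_swap hmeas)).2 ?_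
      refine Eventually.of_forall fun y' => ?_
      by_cases hy' : y' ∈ orthant a
      · let z : RInfty := ∑ n ∈ s, RInfty.single n (y' n - a n)
        have hz : ∀ n, z n = if n ∈ s then y' n - a n else 0 :=
          RInfty.sum_single_apply s fun n => y' n - a n
        have hz0 : ∀ n, 0 ≤ z n := fun n => by
          rw [hz]
          split_ifs
          · linarith [hy' n]
          · exact le_rfl
        filter_upwards [h ⟨z, hz0⟩] with y hy hya _
        refine Eq.trans (congrArg φ ?_) (hy hya)
        ext n
        rw [shiftEquiv_apply]
        change sh (y, y') n = z n + y n
        rw [hz]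
        simp only [hsh]
        split_ifs <;> ring
      · exact Eventually.of_forall fun y _ h2 => absurd h2 hy'
    have := (Measure.measurePreserving_swap (μ := gaussianProduct)
      (ν := gaussianProduct)).quasiMeasurePreserving.ae hsw
    exact this
  have h2 := (measurePreserving_swapCoords s).quasiMeasurePreserving.ae h1
  filter_upwards [h1, h2] with p h3 h4 hp1 hp2
  have hm : ∀ y y' : ℕ → ℝ, y ∈ orthant a → y' ∈ orthant a → mixCoords s y y' ∈ orthant a := by
    intro y y' hy hy' n
    simp only [mixCoords]
    split_ifs
    · exact hy' n
    · exact hy n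
  rw [← h3 hp1 hp2]
  have h5 : φ (sh (swapCoords s p)) = φ (mixCoords s p.1 p.2) :=
    h4 (hm _ _ hp1 hp2) (hm _ _ hp2 hp1)
  rw [← h5]
  congr 1
  ext n
  simp only [hsh, swapCoords, mixCoords]
  split_ifs <;> ring

/-- A translation invariant function on the orthant is almost everywhere constant there. -/
theorem exists_ae_eq_const {a : ℕ → ℝ} (ha : gaussianProduct (orthant a) ≠ 0)
    {φ : (ℕ → ℝ) → ℂ} (hφ : StronglyMeasurable φ) (hi : Integrable φ gaussianProduct)
    (hsupp : ∀ᵐ y ∂gaussianProduct, y ∉ orthant a → φ y = 0)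
    (h : ∀ x : RPlusInfty, ∀ᵐ y ∂gaussianProduct, y ∈ orthant a → φ (shiftEquiv x.1 y) = φ y) :
    ∃ c : ℂ, φ =ᵐ[gaussianProduct] (orthant a).indicator fun _ => c := by
  have hA := measurableSet_orthant a
  set m : ℂ := ((gaussianProduct.real (orthant a) : ℝ) : ℂ) with hm
  have hm0 : m ≠ 0 := by
    rw [hm, Complex.ofReal_ne_zero]
    exact (measureReal_ne_zero_iff (measure_ne_top _ _)).2 ha
  set I : ℂ := ∫ y, φ y ∂gaussianProduct with hI
  have hone : ∀ E, MeasurableSet E → ∫ y, (orthant a ∩ E).indicator (fun _ => (1 : ℂ)) y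
      ∂gaussianProduct = ((gaussianProduct.real (orthant a ∩ E) : ℝ) : ℂ) := by
    intro E hE
    rw [integral_indicator (hA.inter hE), setIntegral_const]
    simp
  -- Zero-one argument: `E` depends only on the coordinates in `s`, and `φ` on the orthant does not
  -- depend on them. Exchanging those coordinates with an independent copy moves `E` to the copy and
  -- decouples it from `φ`, which makes `φ` and `E` uncorrelated given the orthant.
  have hbox : ∀ E ∈ lowerBoxes, m * ∫ y, E.indicator φ y ∂gaussianProduct
      = I * ((gaussianProduct.real (orthant a ∩ E) : ℝ) : ℂ) := by
    intro E hE
    have hEm := measurableSet_of_mem_lowerBoxes hE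
    obtain ⟨s, x, rfl⟩ := hE
    set E := {z : ℕ → ℝ | ∀ n ∈ s, x n ≤ z n} with hEdef
    have hmix : ∀ y y' : ℕ → ℝ, (mixCoords s y' y ∈ E ↔ y ∈ E) := by
      intro y y'
      simp only [hEdef, Set.mem_ofPred_eq]
      refine forall₂_congr fun n hn => ?_
      simp [mixCoords, hn]
    have hmixA : ∀ y y' : ℕ → ℝ, (mixCoords s y y' ∈ orthant a ∧ mixCoords s y' y ∈ orthant a)
        ↔ (y ∈ orthant a ∧ y' ∈ orthant a) := by
      intro y y'
      simp only [orthant, Set.mem_ofPred_eq, mixCoords, ← forall_and]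
      refine forall_congr' fun n => ?_
      split_ifs <;> tauto
    set F : (ℕ → ℝ) × (ℕ → ℝ) → ℂ := fun p => (orthant a ∩ E).indicator φ p.1 *
      (orthant a ∩ Set.univ).indicator (fun _ => (1 : ℂ)) p.2 with hF
    set G : (ℕ → ℝ) × (ℕ → ℝ) → ℂ := fun p => (orthant a).indicator φ p.1 *
      (orthant a ∩ E).indicator (fun _ => (1 : ℂ)) p.2 with hG
    have hGm : AEStronglyMeasurable G (gaussianProduct.prod gaussianProduct) := by
      refine StronglyMeasurable.aestronglyMeasurable ?_
      exact ((hφ.indicator hA).comp_measurable measurable_fst).mul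
        ((stronglyMeasurable_const.indicator (hA.inter hEm)).comp_measurable measurable_snd)
    have hFG : F =ᵐ[gaussianProduct.prod gaussianProduct] G ∘ swapCoords s := by
      filter_upwards [ae_eq_mixCoords hφ h s] with p hp
      obtain ⟨y, y'⟩ := p
      simp only [hF, hG, Function.comp, swapCoords]
      by_cases hyy : y ∈ orthant a ∧ y' ∈ orthant a
      · have h1 := (hmixA y y').2 hyy
        by_cases hyE : y ∈ E
        · simp [hyy, h1, hyE, (hmix y y').2 hyE, hp hyy.1 hyy.2]
        · have h2 : mixCoords s y' y ∉ E := fun h => hyE ((hmix y y').1 h)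
          simp [hyE, h2]
      · have h1 := fun h => hyy ((hmixA y y').1 h)
        have h2 : ∀ (u v w : Set (ℕ → ℝ)) (z z' : ℕ → ℝ) (g : (ℕ → ℝ) → ℂ),
            ¬ (z ∈ orthant a ∧ z' ∈ orthant a) → (orthant a ∩ u).indicator g z *
              (orthant a ∩ v).indicator (fun _ => (1 : ℂ)) z' = 0 := by
          intro u v w z z' g hz
          by_cases hz1 : z ∈ orthant a
          · have hz2 : z' ∉ orthant a := fun hz2 => hz ⟨hz1, hz2⟩
            simp [hz2]
          · simp [hz1]
        rw [h2 _ _ Set.univ _ _ _ hyy]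
        have h3 := h2 Set.univ E Set.univ (mixCoords s y y') (mixCoords s y' y) φ h1
        rw [Set.inter_univ] at h3
        exact h3.symm
    have hint : ∫ p, F p ∂gaussianProduct.prod gaussianProduct
        = ∫ p, G p ∂gaussianProduct.prod gaussianProduct := by
      rw [integral_congr_ae hFG]
      have h1 := integral_map (measurable_swapCoords s).aemeasurable (f := G)
        (μ := gaussianProduct.prod gaussianProduct)
        (by rwa [(measurePreserving_swapCoords s).map_eq])
      rw [(measurePreserving_swapCoords s).map_eq] at h1
      exact h1.symm
    rw [hF, hG, integral_prod_mul, integral_prod_mul, hone _ MeasurableSet.univ, hone _ hEm,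
      Set.inter_univ, ← hm, mul_comm] at hint
    have e1 : ∫ y, (orthant a ∩ E).indicator φ y ∂gaussianProduct
        = ∫ y, E.indicator φ y ∂gaussianProduct := by
      refine integral_congr_ae ?_
      filter_upwards [hsupp] with y hy
      by_cases hya : y ∈ orthant a
      · by_cases hyE : y ∈ E <;> simp [hya, hyE]
      · by_cases hyE : y ∈ E <;> simp [hya, hyE, hy hya]
    have e2 : ∫ y, (orthant a).indicator φ y ∂gaussianProduct = I := by
      refine integral_congr_ae ?_
      filter_upwards [hsupp] with y hy
      by_cases hya : y ∈ orthant a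
      · simp [hya]
      · simp [hya, hy hya]
    rw [e1, e2] at hint
    exact hint
  refine ⟨I / m, ?_⟩
  set ψ : (ℕ → ℝ) → ℂ := fun y => φ y - (orthant a).indicator (fun _ => I / m) y with hψ
  have hci : Integrable ((orthant a).indicator fun _ => I / m) gaussianProduct :=
    (integrable_const _).indicator hA
  have hψi : Integrable ψ gaussianProduct := hi.sub hci
  have hzero : ∀ E, MeasurableSet E → ∫ y in E, ψ y ∂gaussianProduct = 0 := by
    have hb : ∀ E ∈ lowerBoxes, ∫ y in E, ψ y ∂gaussianProduct = 0 := by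
      intro E hE
      have hEm := measurableSet_of_mem_lowerBoxes hE
      rw [hψ, integral_sub hi.integrableOn hci.integrableOn, ← integral_indicator hEm,
        setIntegral_indicator hA, setIntegral_const, Set.inter_comm E]
      have h1 := hbox E hE
      rw [Complex.real_smul]
      field_simp
      linear_combination h1
    intro E hE
    induction E, hE using MeasurableSpace.induction_on_inter generateFrom_lowerBoxes
      isPiSystem_lowerBoxes with
    | empty => simp
    | basic E hE => exact hb E hE
    | compl E hE ih =>
      have h1 := integral_add_compl hE hψi
      -- The whole space is the box with no conditions, so the total integral of `ψ` vanishes and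
      -- complements are covered.
      have h2 := hb Set.univ ⟨∅, 0, by simp⟩
      rw [setIntegral_univ] at h2
      rwa [h2, ih, zero_add] at h1
    | iUnion E hd hE ih =>
      rw [integral_iUnion hE hd hψi.integrableOn]
      simp [ih]
  have h0 := hψi.ae_eq_zero_of_forall_setIntegral_eq_zero fun E hE _ => hzero E hE
  filter_upwards [h0] with y hy
  exact sub_eq_zero.1 hy

/-- Commuting with the range projections makes an operator a multiplication. Commuting with the
isometries makes the multiplier translation invariant, hence constant on the orthant. -/
theorem isIrreducibleRep_orthantRep {a : ℕ → ℝ} (ha : gaussianProduct (orthant a) ≠ 0) :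
    IsIrreducibleRep (orthantRep a) := by
  constructor
  · refine ⟨orthantOne a, 0, fun h => ?_⟩
    have h1 : (orthantOne a : Lp ℂ 2 gaussianProduct) = 0 := congrArg Subtype.val h
    have h2 := orthantOne_coeFn a
    rw [h1] at h2
    refine ha ((ae_iff (p := fun y => y ∉ orthant a)).1 ?_ |> fun h => by simpa using h)
    filter_upwards [h2, Lp.coeFn_zero ℂ 2 gaussianProduct] with y h3 h4 hy
    rw [h4, Set.indicator_of_mem hy] at h3
    simp at h3
  · refine Set.Subset.antisymm (fun T hT => ?_) ?_
    · have hV : ∀ x f, T (orthantRep a x f) = orthantRep a x (T f) := fun x f =>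
        (DFunLike.congr_fun (hT _ ⟨x, Or.inl rfl⟩) f).symm
      have hV' : ∀ x f, T (ContinuousLinearMap.adjoint (orthantRep a x) f)
          = ContinuousLinearMap.adjoint (orthantRep a x) (T f) := fun x f =>
        (DFunLike.congr_fun (hT _ ⟨x, Or.inr rfl⟩) f).symm
      have hM : ∀ S, MeasurableSet S → ∀ f, T (orthantMul a S f) = orthantMul a S (T f) :=
        fun S hS f => intertwines_orthantMul T hV hV' hS f
      obtain ⟨c, hc⟩ := exists_ae_eq_const ha (Lp.stronglyMeasurable (T (orthantOne a)).1)
        ((Lp.memLp _).integrable (by norm_num)) ((mem_orthantL2_iff a _).1 (T (orthantOne a)).2)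
        (multiplier_shift T hM hV)
      refine ⟨c, ?_⟩
      ext1 f
      refine Subtype.ext (Lp.ext ?_)
      change _ =ᵐ[gaussianProduct] ((c • f : orthantL2 a) : Lp ℂ 2 gaussianProduct)
      rw [Submodule.coe_smul]
      filter_upwards [apply_coeFn_of_commute T hM f, hc, Lp.coeFn_smul c f.1,
        (mem_orthantL2_iff a _).1 f.2] with y h1 h2 h3 h4
      rw [h1, h2, h3, Pi.smul_apply]
      by_cases hy : y ∈ orthant a
      · simp [hy]
      · simp [hy, h4 hy]
    · rintro _ ⟨c, rfl⟩ S -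
      ext1 f
      simp

end Irreducibility

/-! ### Separable Hilbert spaces -/

section HilbertSpaces

theorem exists_hilbertBasis_nat (E : Type*) [NormedAddCommGroup E] [InnerProductSpace ℂ E]
    [CompleteSpace E] [TopologicalSpace.SeparableSpace E] (hE : ¬ FiniteDimensional ℂ E) :
    Nonempty (HilbertBasis ℕ ℂ E) := by
  obtain ⟨w, b, hb⟩ := exists_hilbertBasis ℂ E
  have horth : Orthonormal ℂ ((↑) : w → E) := hb ▸ b.orthonormal
  have hcount : w.Countable := by
    -- Distinct orthonormal vectors are at distance `√2`, so balls of radius `1/2` are disjoint, and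
    -- a separable space contains only countably many of them.
    have hd : w.PairwiseDisjoint fun x => Metric.ball x (1 / 2 : ℝ) := by
      intro x hx y hy hxy
      refine Metric.ball_disjoint_ball ?_
      have h1 : ‖x‖ = 1 := horth.1 ⟨x, hx⟩
      have h2 : ‖y‖ = 1 := horth.1 ⟨y, hy⟩
      have h3 : inner ℂ x y = 0 :=
        horth.2 (i := ⟨x, hx⟩) (j := ⟨y, hy⟩) fun h => hxy (congrArg Subtype.val h)
      have h4 : ‖x - y‖ * ‖x - y‖ = 2 := by
        rw [@norm_sub_mul_self ℂ, h3, h1, h2]; norm_num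
      rw [dist_eq_norm]
      nlinarith [norm_nonneg (x - y)]
    exact hd.countable_of_isOpen (fun _ _ => Metric.isOpen_ball)
      fun x _ => ⟨x, Metric.mem_ball_self (by norm_num)⟩
  have hinf : Infinite w := by
    rw [← not_finite_iff_infinite]
    intro hfin
    have := Fintype.ofFinite w
    exact hE b.toOrthonormalBasis.toBasis.finiteDimensional_of_finite
  have := hcount.to_subtype
  obtain ⟨e⟩ := nonempty_equiv_of_countable (α := ℕ) (β := w)
  refine ⟨HilbertBasis.mk (b.orthonormal.comp e e.injective) ?_⟩
  rw [e.surjective.range_comp, b.dense_span]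

theorem nonempty_linearIsometryEquiv (E F : Type*) [NormedAddCommGroup E] [InnerProductSpace ℂ E]
    [CompleteSpace E] [TopologicalSpace.SeparableSpace E] (hE : ¬ FiniteDimensional ℂ E)
    [NormedAddCommGroup F] [InnerProductSpace ℂ F] [CompleteSpace F]
    [TopologicalSpace.SeparableSpace F] (hF : ¬ FiniteDimensional ℂ F) :
    Nonempty (E ≃ₗᵢ[ℂ] F) := by
  obtain ⟨b⟩ := exists_hilbertBasis_nat E hE
  obtain ⟨c⟩ := exists_hilbertBasis_nat F hF
  exact ⟨b.repr.trans c.repr.symm⟩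

/-- A unitary between closed subspaces with infinite dimensional complements extends to the whole
space. -/
theorem exists_linearIsometryEquiv_extending {E F : Type*} [NormedAddCommGroup E]
    [InnerProductSpace ℂ E] [CompleteSpace E] [TopologicalSpace.SeparableSpace E]
    [NormedAddCommGroup F] [InnerProductSpace ℂ F] [CompleteSpace F]
    [TopologicalSpace.SeparableSpace F] (M : Submodule ℂ E) (N : Submodule ℂ F)
    [M.HasOrthogonalProjection] [N.HasOrthogonalProjection]
    (hM : ¬ FiniteDimensional ℂ Mᗮ) (hN : ¬ FiniteDimensional ℂ Nᗮ) (e : M ≃ₗᵢ[ℂ] N) :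
    ∃ Θ : E ≃ₗᵢ[ℂ] F, ∀ f : M, Θ f = e f := by
  have h1 : TopologicalSpace.SeparableSpace Mᗮ :=
    (TopologicalSpace.IsSeparable.of_separableSpace (Mᗮ : Set E)).separableSpace
  have h2 : TopologicalSpace.SeparableSpace Nᗮ :=
    (TopologicalSpace.IsSeparable.of_separableSpace (Nᗮ : Set F)).separableSpace
  obtain ⟨e'⟩ := nonempty_linearIsometryEquiv Mᗮ Nᗮ hM hN
  refine ⟨(M.orthogonalDecomposition.trans
    (LinearIsometryEquiv.withLpProdCongr 2 e e')).trans N.orthogonalDecomposition.symm, fun f => ?_⟩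
  simp [Submodule.orthogonalProjectionOnto_orthogonal_apply_eq_zero]

/-- Two isometric embeddings whose ranges have infinite dimensional complements are intertwined by
a unitary. -/
theorem exists_unitary_intertwining_embeddings {N E F : Type*} [NormedAddCommGroup N]
    [InnerProductSpace ℂ N] [CompleteSpace N] [NormedAddCommGroup E]
    [InnerProductSpace ℂ E] [CompleteSpace E] [TopologicalSpace.SeparableSpace E]
    [NormedAddCommGroup F] [InnerProductSpace ℂ F] [CompleteSpace F]
    [TopologicalSpace.SeparableSpace F] (j : N →ₗᵢ[ℂ] E) (k : N →ₗᵢ[ℂ] F)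
    (hj : ¬ FiniteDimensional ℂ (LinearMap.range j.toLinearMap)ᗮ)
    (hk : ¬ FiniteDimensional ℂ (LinearMap.range k.toLinearMap)ᗮ) :
    ∃ Θ : E ≃ₗᵢ[ℂ] F, ∀ n, Θ (j n) = k n := by
  have h1 : CompleteSpace (LinearMap.range j.toLinearMap) :=
    completeSpace_coe_iff_isComplete.2 j.isometry.isUniformInducing.isComplete_range
  have h2 : CompleteSpace (LinearMap.range k.toLinearMap) :=
    completeSpace_coe_iff_isComplete.2 k.isometry.isUniformInducing.isComplete_range
  obtain ⟨Θ, hΘ⟩ := exists_linearIsometryEquiv_extending _ _ hj hk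
    (j.equivRange.symm.trans k.equivRange)
  refine ⟨Θ, fun n => ?_⟩
  have h := hΘ (j.equivRange n)
  rw [LinearIsometryEquiv.trans_apply, LinearIsometryEquiv.symm_apply_apply] at h
  exact h

end HilbertSpaces

/-! ### Dimension, translation and identification of the orthant spaces -/

section OrthantSpaces

instance (a : ℕ → ℝ) : TopologicalSpace.SeparableSpace (orthantL2 a) := by
  have : Fact ((2 : ℝ≥0∞) ≠ ∞) := ⟨ENNReal.ofNat_ne_top⟩
  infer_instance

theorem RPlusInfty.axis_apply (i : ℕ) (t : ℝ≥0) (n : ℕ) :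
    (RPlusInfty.axis i t).1 n = if i = n then (t : ℝ) else 0 :=
  RInfty.single_apply i t n

/-- The elements of `L²` that vanish outside `G`. -/
def supportedL2 (G : Set (ℕ → ℝ)) : Submodule ℂ (Lp ℂ 2 gaussianProduct) :=
  LinearMap.eqLocus (indicatorMul gaussianProduct G).toLinearMap LinearMap.id

theorem mem_supportedL2 {G : Set (ℕ → ℝ)} {f : Lp ℂ 2 gaussianProduct} :
    f ∈ supportedL2 G ↔ indicatorMul gaussianProduct G f = f := Iff.rfl

instance (G : Set (ℕ → ℝ)) : CompleteSpace (supportedL2 G) := by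
  have h : IsClosed (supportedL2 G : Set (Lp ℂ 2 gaussianProduct)) :=
    isClosed_eq (indicatorMul gaussianProduct G).continuous continuous_id
  exact h.completeSpace_coe

theorem supportedL2_le {d : ℕ → ℝ} {G : Set (ℕ → ℝ)} (hG : MeasurableSet G)
    (hd : G ⊆ orthant d) : supportedL2 G ≤ orthantL2 d := by
  intro f hf
  rw [mem_supportedL2] at hf
  rw [mem_orthantL2_iff_indicatorMul]
  conv_rhs => rw [← hf]
  rw [← hf, indicatorMul_indicatorMul (measurableSet_orthant d) hG, indicatorMul_indicatorMul hG hG,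
    Set.inter_self, Set.inter_eq_right.2 hd]

/-- The inclusion of the functions supported in `G` into `L²` of an orthant containing `G`. -/
def supportedInclusion {d : ℕ → ℝ} {G : Set (ℕ → ℝ)} (hG : MeasurableSet G)
    (hd : G ⊆ orthant d) : supportedL2 G →ₗᵢ[ℂ] orthantL2 d where
  toLinearMap := Submodule.inclusion (supportedL2_le hG hd)
  norm_map' _ := rfl

theorem coe_supportedInclusion {d : ℕ → ℝ} {G : Set (ℕ → ℝ)} (hG : MeasurableSet G)
    (hd : G ⊆ orthant d) (f : supportedL2 G) :
    (supportedInclusion hG hd f : Lp ℂ 2 gaussianProduct) = f := rfl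

theorem indicatorMul_empty {X : Type*} [MeasurableSpace X] {μ : Measure X} (f : Lp ℂ 2 μ) :
    indicatorMul μ ∅ f = 0 := by
  have h := indicatorMul_add_compl (μ := μ) MeasurableSet.empty f
  rw [Set.compl_empty, indicatorMul_univ] at h
  simpa using h

/-- In finite dimension every isometry is onto, so any `f` would be supported in `{y 0 ≥ b 0 + k}`
for all `k`. These sets shrink to the empty set, which forces `f = 0`. -/
theorem not_finiteDimensional_orthantL2 {b : ℕ → ℝ} (hb : gaussianProduct (orthant b) ≠ 0) :
    ¬ FiniteDimensional ℂ (orthantL2 b) := by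
  intro hfin
  have hsurj : ∀ x, Function.Surjective (orthantRep b x) := fun x =>
    (LinearMap.injective_iff_surjective (f := (orthantRep b x).toLinearMap)).1
      (LinearIsometry.injective
        ⟨(orthantRep b x).toLinearMap, (isIsometricRep_orthantRep b).norm_map x⟩)
  obtain ⟨f, hf⟩ : ∃ f : orthantL2 b, f ≠ 0 := by
    have := (isIrreducibleRep_orthantRep hb).1
    exact exists_ne 0
  set E : ℕ → Set (ℕ → ℝ) := fun k =>
    orthant fun n => b n + (RPlusInfty.axis 0 (k : ℝ≥0)).1 n with hE
  have h1 : ∀ k, indicatorMul gaussianProduct (E k) (f : Lp ℂ 2 gaussianProduct) = f := by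
    intro k
    obtain ⟨g, rfl⟩ := hsurj (RPlusInfty.axis 0 (k : ℝ≥0)) f
    rw [coe_orthantRep, hE]
    dsimp only
    rw [← shiftKoopman_indicatorMul_orthant, indicatorMul_coe]
  have h2 : Tendsto (fun k => indicatorMul gaussianProduct (E k) (f : Lp ℂ 2 gaussianProduct))
      atTop (𝓝 (indicatorMul gaussianProduct ∅ (f : Lp ℂ 2 gaussianProduct))) := by
    refine tendsto_indicatorMul (fun k => measurableSet_orthant _) MeasurableSet.empty ?_ _
    refine Eventually.of_forall fun y => ?_
    obtain ⟨k₀, hk₀⟩ := exists_nat_gt (y 0 - b 0)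
    filter_upwards [eventually_ge_atTop k₀] with k hk
    simp only [Set.mem_empty_iff_false, iff_false]
    intro hy
    have h3 : b 0 + (RPlusInfty.axis 0 (k : ℝ≥0)).1 0 ≤ y 0 := hy 0
    rw [RPlusInfty.axis_apply] at h3
    simp only [if_true, NNReal.coe_natCast] at h3
    have h4 : (k₀ : ℝ) ≤ k := by exact_mod_cast hk
    linarith
  simp_rw [h1, indicatorMul_empty] at h2
  exact hf (Subtype.ext (tendsto_nhds_unique tendsto_const_nhds h2))

/-- A translation far enough in the first coordinate embeds the whole of `L²` of the orthant
isometrically into functions living on `{y 0 ≥ r}`, which are orthogonal to everything supported in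
`G`. -/
theorem not_finiteDimensional_orthogonal_supported {b : ℕ → ℝ}
    (hb : gaussianProduct (orthant b) ≠ 0) {G : Set (ℕ → ℝ)} (hG : MeasurableSet G)
    (hGb : G ⊆ orthant b) {r : ℝ} (hGr : ∀ y ∈ G, y 0 < r) :
    ¬ FiniteDimensional ℂ (LinearMap.range (supportedInclusion hG hGb).toLinearMap)ᗮ := by
  intro hfin
  set x := RPlusInfty.axis 0 (r - b 0).toNNReal with hx
  have hmem : ∀ f, orthantRep b x f
      ∈ (LinearMap.range (supportedInclusion hG hGb).toLinearMap)ᗮ := by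
    intro f
    rw [Submodule.mem_orthogonal]
    rintro _ ⟨g, rfl⟩
    have hE := measurableSet_orthant fun n => b n + x.1 n
    change inner ℂ (supportedInclusion hG hGb g) _ = _
    rw [Submodule.coe_inner, coe_supportedInclusion, ← mem_supportedL2.1 g.2, coe_orthantRep,
      ← indicatorMul_coe b f, shiftKoopman_indicatorMul_orthant, inner_indicatorMul hG,
      indicatorMul_indicatorMul hG hE]
    have hempty : G ∩ (orthant fun n => b n + x.1 n) = ∅ := by
      refine Set.eq_empty_of_forall_notMem fun y hy => ?_
      have h1 := hGr y hy.1
      have h2 : b 0 + x.1 0 ≤ y 0 := hy.2 0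
      rw [hx, RPlusInfty.axis_apply] at h2
      simp only [if_true] at h2
      linarith [Real.le_coe_toNNReal (r - b 0)]
    rw [hempty, indicatorMul_empty, inner_zero_right]
  refine not_finiteDimensional_orthantL2 hb ?_
  let J : orthantL2 b →ₗ[ℂ] (LinearMap.range (supportedInclusion hG hGb).toLinearMap)ᗮ :=
    (orthantRep b x).toLinearMap.codRestrict _ hmem
  have hJ : Function.Injective J := by
    intro f g hfg
    have h1 : orthantRep b x f = orthantRep b x g := congrArg Subtype.val hfg
    exact (LinearIsometry.injective
        ⟨(orthantRep b x).toLinearMap, (isIsometricRep_orthantRep b).norm_map x⟩) h1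
  exact Module.Finite.of_injective J hJ

/-- If `G` lies in both orthants and is bounded above in the first coordinate, there is a unitary
between the two `L²` spaces that is the identity on the functions supported in `G`. -/
theorem exists_unitary_fixing {b c : ℕ → ℝ} (hb : gaussianProduct (orthant b) ≠ 0)
    (hc : gaussianProduct (orthant c) ≠ 0) {G : Set (ℕ → ℝ)} (hG : MeasurableSet G)
    (hGb : G ⊆ orthant b) (hGc : G ⊆ orthant c) {r : ℝ} (hGr : ∀ y ∈ G, y 0 < r) :
    ∃ Θ : orthantL2 b ≃ₗᵢ[ℂ] orthantL2 c, ∀ f : orthantL2 b,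
      ‖(Θ f : Lp ℂ 2 gaussianProduct) - f‖ ≤
        2 * ‖(f : Lp ℂ 2 gaussianProduct) - indicatorMul gaussianProduct G f‖ := by
  obtain ⟨Θ, hΘ⟩ := exists_unitary_intertwining_embeddings (supportedInclusion hG hGb)
    (supportedInclusion hG hGc) (not_finiteDimensional_orthogonal_supported hb hG hGb hGr)
    (not_finiteDimensional_orthogonal_supported hc hG hGc hGr)
  refine ⟨Θ, fun f => ?_⟩
  have hmem : indicatorMul gaussianProduct G (f : Lp ℂ 2 gaussianProduct) ∈ supportedL2 G := by
    rw [mem_supportedL2, indicatorMul_indicatorMul hG hG, Set.inter_self]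
  set g : orthantL2 b := supportedInclusion hG hGb ⟨_, hmem⟩ with hg
  have hgf : (g : Lp ℂ 2 gaussianProduct) = indicatorMul gaussianProduct G f :=
    coe_supportedInclusion hG hGb _
  have h1 : (Θ g : Lp ℂ 2 gaussianProduct) = g := by
    rw [hg, hΘ, coe_supportedInclusion, coe_supportedInclusion]
  -- Since `Θ` fixes `g = 1_G f`, only `f - g` contributes, once through `Θ` and once directly;
  -- hence the factor `2`.
  have h2 : (Θ f : Lp ℂ 2 gaussianProduct) - f = (Θ (f - g) : Lp ℂ 2 gaussianProduct)
      - ((f - g : orthantL2 b) : Lp ℂ 2 gaussianProduct) := by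
    rw [map_sub, Submodule.coe_sub, Submodule.coe_sub, h1]
    abel
  have h3 : ‖(Θ (f - g) : Lp ℂ 2 gaussianProduct)‖
      = ‖((f - g : orthantL2 b) : Lp ℂ 2 gaussianProduct)‖ := Θ.norm_map (f - g)
  rw [h2]
  refine (norm_sub_le _ _).trans ?_
  rw [h3, ← two_mul, Submodule.coe_sub, hgf]

/-- Translation by `x` maps `L²` of an orthant onto `L²` of the translated orthant. -/
theorem exists_translation_unitary (a : ℕ → ℝ) (x : RInfty) :
    ∃ R : orthantL2 a ≃ₗᵢ[ℂ] orthantL2 (fun n => a n + x n),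
      ∀ z f, R (orthantRep a z f) = orthantRep (fun n => a n + x n) z (R f) := by
  have h1 : ∀ f ∈ orthantL2 a, shiftKoopman x f ∈ orthantL2 (fun n => a n + x n) := by
    intro f hf
    rw [mem_orthantL2_iff_indicatorMul] at hf ⊢
    rw [← shiftKoopman_indicatorMul_orthant, hf]
  have h2 : ∀ f ∈ orthantL2 (fun n => a n + x n), shiftKoopman (-x) f ∈ orthantL2 a := by
    intro f hf
    rw [mem_orthantL2_iff_indicatorMul] at hf ⊢
    have h3 := shiftKoopman_indicatorMul_orthant (fun n => a n + x n) (-x) f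
    rw [hf] at h3
    simp only [RInfty.neg_apply, add_neg_cancel_right] at h3
    exact h3.symm
  refine ⟨
    { toFun := fun f => ⟨shiftKoopman x f, h1 f f.2⟩
      invFun := fun f => ⟨shiftKoopman (-x) f, h2 f f.2⟩
      map_add' := fun f g => Subtype.ext (map_add (shiftKoopman x) f.1 g.1)
      map_smul' := fun c f => Subtype.ext (map_smul (shiftKoopman x) c f.1)
      left_inv := fun f => Subtype.ext (shiftKoopman_neg_apply x f)
      right_inv := fun f => Subtype.ext (shiftKoopman_apply_neg x f)
      norm_map' := fun f => norm_shiftKoopman x f }, fun z f => Subtype.ext ?_⟩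
  change shiftKoopman x (shiftKoopman z.1 f) = shiftKoopman z.1 (shiftKoopman x f)
  rw [← shiftKoopman_add, ← shiftKoopman_add, add_comm]

end OrthantSpaces

/-! ### Approximation of one orthant representation by conjugates of another -/

section Approximation

/-- A unitary intertwining two operators intertwines their adjoints. -/
theorem intertwines_adjoint {K L : Type*} [NormedAddCommGroup K] [InnerProductSpace ℂ K]
    [CompleteSpace K] [NormedAddCommGroup L] [InnerProductSpace ℂ L] [CompleteSpace L]
    (U : K ≃ₗᵢ[ℂ] L) {A : K →L[ℂ] K} {B : L →L[ℂ] L} (h : ∀ x, U (A x) = B (U x)) (x : K) :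
    U (ContinuousLinearMap.adjoint A x) = ContinuousLinearMap.adjoint B (U x) := by
  refine ext_inner_right ℂ fun z => ?_
  obtain ⟨z, rfl⟩ := U.surjective z
  rw [U.inner_map_map, ContinuousLinearMap.adjoint_inner_left,
    ContinuousLinearMap.adjoint_inner_left, ← h, U.inner_map_map]

/-- Strong convergence of contractions is uniform on compact sets. -/
theorem eventually_forall_mem_compact_norm_sub_le {E F : Type*} [NormedAddCommGroup E]
    [NormedSpace ℂ E] [NormedAddCommGroup F] [NormedSpace ℂ F] {A : ℕ → E →L[ℂ] F}
    {B : E →L[ℂ] F} (hA : ∀ n x, ‖A n x‖ ≤ ‖x‖) (hB : ∀ x, ‖B x‖ ≤ ‖x‖)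
    (h : ∀ x, Tendsto (fun n => A n x) atTop (𝓝 (B x))) {S : Set E} (hS : IsCompact S) {ε : ℝ}
    (hε : 0 < ε) : ∀ᶠ n in atTop, ∀ x ∈ S, ‖A n x - B x‖ ≤ ε := by
  obtain ⟨t, -, hfin, hcov⟩ := hS.finite_cover_balls (e := ε / 3) (by positivity)
  have h1 : ∀ᶠ n in atTop, ∀ z ∈ t, ‖A n z - B z‖ < ε / 3 := by
    rw [eventually_all_finite hfin]
    intro z _
    filter_upwards [Metric.tendsto_nhds.1 (h z) (ε / 3) (by positivity)] with n hn
    rwa [dist_eq_norm] at hn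
  filter_upwards [h1] with n hn x hx
  obtain ⟨z, hz, hxz⟩ := Set.mem_iUnion₂.1 (hcov hx)
  rw [Metric.mem_ball, dist_eq_norm] at hxz
  have e1 : A n x - B x = A n (x - z) + (A n z - B z) - B (x - z) := by
    rw [map_sub, map_sub]; abel
  rw [e1]
  have e2 := norm_sub_le (A n (x - z) + (A n z - B z)) (B (x - z))
  have e3 := norm_add_le (A n (x - z)) (A n z - B z)
  linarith [hA n (x - z), hB (x - z), hn z hz]

/-- The sequence with the entries of `b` in the first `m` places and those of `a` afterwards. -/
def spliceSeq (a b : ℕ → ℝ) (m : ℕ) : ℕ → ℝ :=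
  fun n => a n + (∑ k ∈ Finset.range m, RInfty.single k (b k - a k)) n

theorem spliceSeq_apply (a b : ℕ → ℝ) (m n : ℕ) :
    spliceSeq a b m n = if n < m then b n else a n := by
  rw [spliceSeq, RInfty.sum_single_apply _ fun k => b k - a k]
  simp only [Finset.mem_range]
  split_ifs <;> ring

/-- If the translated orthant were null, quasi-invariance would make its preimage, the original
orthant, null. -/
theorem gaussianProduct_orthant_add_ne_zero {a : ℕ → ℝ} (ha : gaussianProduct (orthant a) ≠ 0)
    (x : RInfty) : gaussianProduct (orthant fun n => a n + x n) ≠ 0 := by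
  intro h
  have h1 := map_shiftEquiv_absolutelyContinuous x h
  rw [Measure.map_apply (shiftEquiv x).measurable (measurableSet_orthant _),
    preimage_shiftEquiv_orthant] at h1
  exact ha h1

/-- The two orthants impose different conditions only from coordinate `m` on, and almost every `y`
satisfies both sets of tail conditions once `m` is large. -/
theorem ae_eventually_mem_spliceSeq_iff {a b : ℕ → ℝ} (ha : a ∈ thresholds) (hb : b ∈ thresholds) :
    ∀ᵐ y ∂gaussianProduct, ∀ᶠ m in atTop,
      (y ∈ orthant (spliceSeq a b m) ↔ y ∈ orthant b) := by
  filter_upwards [ae_eventually_ge ha, ae_eventually_ge hb] with y h1 h2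
  obtain ⟨N₁, hN₁⟩ := eventually_atTop.1 h1
  obtain ⟨N₂, hN₂⟩ := eventually_atTop.1 h2
  filter_upwards [eventually_ge_atTop N₁, eventually_ge_atTop N₂] with m hm₁ hm₂
  constructor
  · intro h n
    have h3 := h n
    rw [spliceSeq_apply] at h3
    split_ifs at h3 with hn
    · exact h3
    · exact hN₂ n (hm₂.trans (not_lt.1 hn))
  · intro h n
    rw [spliceSeq_apply]
    split_ifs with hn
    · exact h n
    · exact hN₁ n (hm₁.trans (not_lt.1 hn))

/-- A translate `c` of `a` by a finitely supported sequence, whose orthant approximates that of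
`b` on a given compact set, together with a unitary that is close to the identity there. -/
theorem exists_translate_unitary_near_id {a b : ℕ → ℝ} (ha : a ∈ thresholds) (hb : b ∈ thresholds)
    {S : Set (Lp ℂ 2 gaussianProduct)} (hS : IsCompact S) {δ : ℝ} (hδ : 0 < δ) :
    ∃ (x : RInfty) (Θ : orthantL2 b ≃ₗᵢ[ℂ] orthantL2 fun n => a n + x n),
      (∀ f : orthantL2 b, (f : Lp ℂ 2 gaussianProduct) ∈ S →
        ‖(Θ f : Lp ℂ 2 gaussianProduct) - f‖ ≤ δ) ∧
      ∀ f ∈ S, ‖indicatorMul gaussianProduct (orthant b) f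
        - indicatorMul gaussianProduct (orthant fun n => a n + x n) f‖ ≤ δ := by
  -- Functions supported in both orthants can be kept fixed. The cutoff in coordinate `0` leaves
  -- infinite-dimensional complements in both spaces, so that the identity there extends to a
  -- unitary, and it disappears as `m → ∞`.
  let G : ℕ → Set (ℕ → ℝ) := fun m =>
    orthant b ∩ orthant (spliceSeq a b m) ∩ {y | y 0 < (m : ℝ)}
  have hGm : ∀ m, MeasurableSet (G m) := fun m =>
    ((measurableSet_orthant b).inter (measurableSet_orthant _)).inter
      (measurableSet_lt (measurable_pi_apply 0) measurable_const)
  have hPlim : ∀ f, Tendsto (fun m => indicatorMul gaussianProduct (orthant (spliceSeq a b m)) f)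
      atTop (𝓝 (indicatorMul gaussianProduct (orthant b) f)) := fun f =>
    tendsto_indicatorMul (fun m => measurableSet_orthant _) (measurableSet_orthant b)
      (ae_eventually_mem_spliceSeq_iff ha hb) f
  have hQlim : ∀ f, Tendsto (fun m => indicatorMul gaussianProduct (G m) f) atTop
      (𝓝 (indicatorMul gaussianProduct (orthant b) f)) := by
    refine tendsto_indicatorMul hGm (measurableSet_orthant b) ?_
    filter_upwards [ae_eventually_mem_spliceSeq_iff ha hb] with y hy
    obtain ⟨k, hk⟩ := exists_nat_gt (y 0)
    filter_upwards [hy, eventually_ge_atTop k] with m hm hkm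
    have h1 : y 0 < (m : ℝ) := hk.trans_le (by exact_mod_cast hkm)
    simp only [G, Set.mem_inter_iff, Set.mem_ofPred_eq, h1, hm, and_true, and_self]
  have hBn : ∀ f, ‖indicatorMul gaussianProduct (orthant b) f‖ ≤ ‖f‖ := fun f =>
    norm_indicatorMul_le (measurableSet_orthant b) f
  -- The bound `δ / 2` compensates for the factor `2` in `exists_unitary_fixing`.
  obtain ⟨m, hm₁, hm₂⟩ := ((eventually_forall_mem_compact_norm_sub_le
    (fun m f => norm_indicatorMul_le (hGm m) f) hBn hQlim hS (ε := δ / 2) (by positivity)).and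
    (eventually_forall_mem_compact_norm_sub_le
      (fun m f => norm_indicatorMul_le (measurableSet_orthant (spliceSeq a b m)) f) hBn hPlim hS
      hδ)).exists
  -- By definition `spliceSeq a b m` is `a` plus this finitely supported sequence, so the target is
  -- the `L²` space of a translate of the orthant of `a`.
  obtain ⟨Θ, hΘ⟩ := exists_unitary_fixing (G := G m) (r := m)
    (gaussianProduct_orthant_ne_zero hb)
    (gaussianProduct_orthant_add_ne_zero (gaussianProduct_orthant_ne_zero ha)
      (∑ k ∈ Finset.range m, RInfty.single k (b k - a k))) (hGm m) (fun y hy => hy.1.1)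
    (fun y hy => hy.1.2) (fun y hy => hy.2)
  refine ⟨_, Θ, fun f hf => (hΘ f).trans ?_, fun f hf => ?_⟩
  · have h1 := hm₁ _ hf
    rw [indicatorMul_coe, norm_sub_rev] at h1
    linarith
  · have h1 := hm₂ _ hf
    rw [norm_sub_rev] at h1
    exact h1

/-- Both representations restrict the same unitary `U_x`, so the defect comes only from `Θ` moving
`ξ` and `V_x ξ`, by at most `δ` each. -/
theorem norm_intertwining_defect_le {b c : ℕ → ℝ} (Θ : orthantL2 b ≃ₗᵢ[ℂ] orthantL2 c)
    (x : RPlusInfty) (ξ : orthantL2 b) {δ : ℝ}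
    (h₁ : ‖(Θ ξ : Lp ℂ 2 gaussianProduct) - ξ‖ ≤ δ)
    (h₂ : ‖(Θ (orthantRep b x ξ) : Lp ℂ 2 gaussianProduct) - orthantRep b x ξ‖ ≤ δ) :
    ‖Θ (orthantRep b x ξ) - orthantRep c x (Θ ξ)‖ ≤ 2 * δ := by
  have h3 : ‖shiftKoopman x.1 (ξ : Lp ℂ 2 gaussianProduct) - shiftKoopman x.1 (Θ ξ)‖ ≤ δ := by
    rw [← map_sub, norm_shiftKoopman, norm_sub_rev]
    exact h₁
  rw [coe_orthantRep] at h₂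
  have h4 := norm_add_le_of_le h₂ h3
  rw [sub_add_sub_cancel, ← coe_orthantRep, ← Submodule.coe_sub] at h4
  have h6 : ‖Θ (orthantRep b x ξ) - orthantRep c x (Θ ξ)‖ ≤ δ + δ := h4
  linarith

/-- The adjoints compress the same unitary `U_{-x}` by different projections, which adds a third
error term. -/
theorem norm_adjoint_intertwining_defect_le {b c : ℕ → ℝ} (Θ : orthantL2 b ≃ₗᵢ[ℂ] orthantL2 c)
    (x : RPlusInfty) (ξ : orthantL2 b) {δ : ℝ}
    (h₁ : ‖(Θ ξ : Lp ℂ 2 gaussianProduct) - ξ‖ ≤ δ)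
    (h₂ : ‖(Θ (ContinuousLinearMap.adjoint (orthantRep b x) ξ) : Lp ℂ 2 gaussianProduct)
      - ContinuousLinearMap.adjoint (orthantRep b x) ξ‖ ≤ δ)
    (h₃ : ‖indicatorMul gaussianProduct (orthant b) (shiftKoopman (-x.1) ξ)
        - indicatorMul gaussianProduct (orthant c) (shiftKoopman (-x.1) ξ)‖ ≤ δ) :
    ‖Θ (ContinuousLinearMap.adjoint (orthantRep b x) ξ)
      - ContinuousLinearMap.adjoint (orthantRep c x) (Θ ξ)‖ ≤ 3 * δ := by
  have h4 : ‖indicatorMul gaussianProduct (orthant c) (shiftKoopman (-x.1) ξ)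
      - indicatorMul gaussianProduct (orthant c) (shiftKoopman (-x.1) (Θ ξ))‖ ≤ δ := by
    rw [← map_sub, ← map_sub]
    refine (norm_indicatorMul_le (measurableSet_orthant c) _).trans ?_
    rw [norm_shiftKoopman, norm_sub_rev]
    exact h₁
  rw [coe_adjoint_orthantRep] at h₂
  have h5 := norm_add_le_of_le (norm_add_le_of_le h₂ h₃) h4
  rw [sub_add_sub_cancel, sub_add_sub_cancel, ← coe_adjoint_orthantRep, ← Submodule.coe_sub] at h5
  have h6 : ‖Θ (ContinuousLinearMap.adjoint (orthantRep b x) ξ)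
      - ContinuousLinearMap.adjoint (orthantRep c x) (Θ ξ)‖ ≤ δ + δ + δ := h5
  linarith

/-- The estimates are needed on `ξ`, `U_x ξ`, `U_{-x} ξ` and `V_x* ξ = P_b U_{-x} ξ` for `ξ ∈ F` and
`x ∈ C`. Strong continuity makes these orbits compact, so one unitary serves them all; `ε / 3`
matches the three adjoint error terms. -/
theorem exists_translate_unitary_approx {a b : ℕ → ℝ} (ha : a ∈ thresholds) (hb : b ∈ thresholds)
    {C : Set RPlusInfty} (hC : IsCompact C) (F : Finset (orthantL2 b)) {ε : ℝ} (hε : 0 < ε) :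
    ∃ (z : RInfty) (Θ : orthantL2 b ≃ₗᵢ[ℂ] orthantL2 fun n => a n + z n), ∀ ξ ∈ F, ∀ x ∈ C,
      ‖Θ (orthantRep b x ξ) - orthantRep (fun n => a n + z n) x (Θ ξ)‖ ≤ ε ∧
      ‖Θ (ContinuousLinearMap.adjoint (orthantRep b x) ξ)
        - ContinuousLinearMap.adjoint (orthantRep (fun n => a n + z n) x) (Θ ξ)‖ ≤ ε := by
  let S₁ : Set (Lp ℂ 2 gaussianProduct) := ⋃ ξ ∈ F, ((fun x : RPlusInfty =>
    shiftKoopman x.1 (ξ : Lp ℂ 2 gaussianProduct)) '' C)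
  let S₂ : Set (Lp ℂ 2 gaussianProduct) := ⋃ ξ ∈ F, ((fun x : RPlusInfty =>
    shiftKoopman (-x.1) (ξ : Lp ℂ 2 gaussianProduct)) '' C)
  let S₄ : Set (Lp ℂ 2 gaussianProduct) := (fun ξ : orthantL2 b => ξ.1) '' (F : Set (orthantL2 b))
  have hS₁c : IsCompact S₁ := F.isCompact_biUnion fun ξ _ =>
    hC.image ((continuous_shiftKoopman _).comp continuous_subtype_val)
  have hS₂c : IsCompact S₂ := F.isCompact_biUnion fun ξ _ =>
    hC.image ((continuous_shiftKoopman_neg _).comp continuous_subtype_val)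
  have hS₃c : IsCompact (indicatorMul gaussianProduct (orthant b) '' S₂) :=
    hS₂c.image (indicatorMul gaussianProduct (orthant b)).continuous
  have hS₄c : IsCompact S₄ := (F.finite_toSet.image _).isCompact
  obtain ⟨z, Θ, hΘ, hP⟩ := exists_translate_unitary_near_id ha hb
    (((hS₁c.union hS₂c).union hS₃c).union hS₄c) (δ := ε / 3) (by positivity)
  refine ⟨z, Θ, fun ξ hξ x hx => ?_⟩
  have hξs := hΘ ξ (Or.inr ⟨ξ, hξ, rfl⟩)
  constructor
  · refine (norm_intertwining_defect_le Θ x ξ hξs (hΘ _ ?_)).trans (by linarith)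
    rw [coe_orthantRep]
    exact Or.inl (Or.inl (Or.inl (Set.mem_biUnion (Finset.mem_coe.2 hξ) ⟨x, hx, rfl⟩)))
  · have hmem : shiftKoopman (-x.1) (ξ : Lp ℂ 2 gaussianProduct) ∈ S₂ :=
      Set.mem_biUnion (Finset.mem_coe.2 hξ) ⟨x, hx, rfl⟩
    refine (norm_adjoint_intertwining_defect_le Θ x ξ hξs (hΘ _ ?_)
      (hP _ (Or.inl (Or.inl (Or.inr hmem))))).trans (by linarith)
    rw [coe_adjoint_orthantRep]
    exact Or.inl (Or.inr ⟨_, hmem, rfl⟩)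

theorem norm_conjugate_defect {K L M : Type*} [NormedAddCommGroup K] [InnerProductSpace ℂ K]
    [NormedAddCommGroup L] [InnerProductSpace ℂ L] [NormedAddCommGroup M] [InnerProductSpace ℂ M]
    (Θ : K ≃ₗᵢ[ℂ] L) (R : M ≃ₗᵢ[ℂ] L) {A : L →L[ℂ] L} {B : M →L[ℂ] M}
    (h : ∀ x, R (B x) = A (R x)) (ξ η : K) :
    ‖Θ.trans R.symm η - B (Θ.trans R.symm ξ)‖ = ‖Θ η - A (Θ ξ)‖ := by
  rw [← R.norm_map, map_sub, h]
  simp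

/-- On finitely many vectors and uniformly on compact sets, `orthantRep b` and its adjoint are
approximated by unitary conjugates of `orthantRep a`. -/
theorem exists_unitary_approx {a b : ℕ → ℝ} (ha : a ∈ thresholds) (hb : b ∈ thresholds)
    {C : Set RPlusInfty} (hC : IsCompact C) (F : Finset (orthantL2 b)) {ε : ℝ} (hε : 0 < ε) :
    ∃ Θ : orthantL2 b ≃ₗᵢ[ℂ] orthantL2 a, ∀ ξ ∈ F, ∀ x ∈ C,
      ‖Θ (orthantRep b x ξ) - orthantRep a x (Θ ξ)‖ ≤ ε ∧
      ‖Θ (ContinuousLinearMap.adjoint (orthantRep b x) ξ)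
        - ContinuousLinearMap.adjoint (orthantRep a x) (Θ ξ)‖ ≤ ε := by
  obtain ⟨z, Θ, hΘ⟩ := exists_translate_unitary_approx ha hb hC F hε
  obtain ⟨R, hR⟩ := exists_translation_unitary a z
  refine ⟨Θ.trans R.symm, fun ξ hξ x hx => ?_⟩
  have h := hΘ ξ hξ x hx
  rw [norm_conjugate_defect Θ R (hR x), norm_conjugate_defect Θ R (intertwines_adjoint R (hR x))]
  exact h

end Approximation

/-! ### Hilbert space tensor products -/

section CompletedTensor

open UniformSpace

variable {K M N H : Type*} [NormedAddCommGroup K] [InnerProductSpace ℂ K]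
  [NormedAddCommGroup M] [InnerProductSpace ℂ M] [NormedAddCommGroup N] [InnerProductSpace ℂ N]
  [NormedAddCommGroup H] [InnerProductSpace ℂ H]

theorem completedTensor_induction {p : Completion (K ⊗[ℂ] H) → Prop} (hp : IsClosed {η | p η})
    (hadd : ∀ η ζ, p η → p ζ → p (η + ζ))
    (htmul : ∀ (ξ : K) (h : H), p ((ξ ⊗ₜ[ℂ] h : K ⊗[ℂ] H) : Completion (K ⊗[ℂ] H)))
    (η : Completion (K ⊗[ℂ] H)) : p η := by
  refine Completion.induction_on η hp fun t => ?_
  induction t using TensorProduct.induction_on with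
  | zero => simpa using htmul 0 0
  | tmul ξ h => exact htmul ξ h
  | add t u ht hu =>
    rw [Completion.coe_add]
    exact hadd _ _ ht hu

theorem completedTensor_ext {A B : Completion (K ⊗[ℂ] H) →L[ℂ] M}
    (h : ∀ (ξ : K) (h : H), A ((ξ ⊗ₜ[ℂ] h : K ⊗[ℂ] H) : Completion (K ⊗[ℂ] H))
      = B ((ξ ⊗ₜ[ℂ] h : K ⊗[ℂ] H) : Completion (K ⊗[ℂ] H))) : A = B := by
  ext η
  refine completedTensor_induction (isClosed_eq A.continuous B.continuous) (fun η ζ hη hζ => ?_) h η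
  rw [map_add, map_add, hη, hζ]

variable (H) in
/-- The operator `T ⊗ 1` between Hilbert space tensor products. -/
def tensorMap (T : K →L[ℂ] M) : Completion (K ⊗[ℂ] H) →L[ℂ] Completion (M ⊗[ℂ] H) :=
  (T.rTensor H).completion

theorem tensorMap_coe (T : K →L[ℂ] M) (t : K ⊗[ℂ] H) :
    tensorMap H T (t : Completion (K ⊗[ℂ] H)) = (T.rTensor H t : Completion (M ⊗[ℂ] H)) :=
  ContinuousLinearMap.completion_apply_coe _ _

theorem tensorMap_tmul (T : K →L[ℂ] M) (ξ : K) (h : H) :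
    tensorMap H T ((ξ ⊗ₜ[ℂ] h : K ⊗[ℂ] H) : Completion (K ⊗[ℂ] H))
      = ((T ξ ⊗ₜ[ℂ] h : M ⊗[ℂ] H) : Completion (M ⊗[ℂ] H)) := by
  rw [tensorMap_coe, ContinuousLinearMap.rTensor_tmul]

theorem tensorOne_eq {S : Type*} (V : S → K →L[ℂ] K) (s : S) :
    tensorOne H V s = tensorMap H (V s) := rfl

theorem tensorMap_comp (A : M →L[ℂ] N) (B : K →L[ℂ] M) :
    tensorMap H (A ∘L B) = tensorMap H A ∘L tensorMap H B :=
  completedTensor_ext fun ξ h => by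
    simp only [ContinuousLinearMap.comp_apply, tensorMap_tmul]

theorem tensorMap_mul (A B : K →L[ℂ] K) : tensorMap H (A * B) = tensorMap H A * tensorMap H B :=
  tensorMap_comp A B

theorem tensorMap_one : tensorMap H (1 : K →L[ℂ] K) = 1 :=
  completedTensor_ext fun ξ h => by rw [tensorMap_tmul]; rfl

theorem norm_tensorMap_le {T : K →L[ℂ] M} (hT : ∀ ξ, ‖T ξ‖ ≤ ‖ξ‖) (η : Completion (K ⊗[ℂ] H)) :
    ‖tensorMap H T η‖ ≤ ‖η‖ := by
  refine Completion.induction_on η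
    (isClosed_le (tensorMap H T).continuous.norm continuous_norm) fun t => ?_
  rw [tensorMap_coe, Completion.norm_coe, Completion.norm_coe]
  have h1 : ‖T‖ ≤ 1 := T.opNorm_le_bound zero_le_one fun ξ => by rw [one_mul]; exact hT ξ
  have h2 := (T.rTensor H).le_of_opNorm_le ((T.norm_rTensor_le (G := H)).trans h1) t
  rwa [one_mul] at h2

theorem norm_tensorMap {T : K →L[ℂ] M} (hT : ∀ ξ, ‖T ξ‖ = ‖ξ‖) (η : Completion (K ⊗[ℂ] H)) :
    ‖tensorMap H T η‖ = ‖η‖ := by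
  refine Completion.induction_on η
    (isClosed_eq (tensorMap H T).continuous.norm continuous_norm) fun t => ?_
  rw [tensorMap_coe, Completion.norm_coe, Completion.norm_coe]
  exact ((⟨T.toLinearMap, hT⟩ : K →ₗᵢ[ℂ] M).rTensor H).norm_map t

theorem inner_completedTensor_tmul (ξ ξ' : K) (h h' : H) :
    inner ℂ ((ξ ⊗ₜ[ℂ] h : K ⊗[ℂ] H) : Completion (K ⊗[ℂ] H))
      ((ξ' ⊗ₜ[ℂ] h' : K ⊗[ℂ] H) : Completion (K ⊗[ℂ] H)) = inner ℂ ξ ξ' * inner ℂ h h' := by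
  rw [Completion.inner_coe, TensorProduct.inner_tmul]

theorem completedTensor_ext_inner {η ζ : Completion (K ⊗[ℂ] H)}
    (hh : ∀ (ξ : K) (h : H), inner ℂ ((ξ ⊗ₜ[ℂ] h : K ⊗[ℂ] H) : Completion (K ⊗[ℂ] H)) η
      = inner ℂ ((ξ ⊗ₜ[ℂ] h : K ⊗[ℂ] H) : Completion (K ⊗[ℂ] H)) ζ) : η = ζ := by
  refine ext_inner_left ℂ fun θ => ?_
  refine completedTensor_induction (p := fun θ => inner ℂ θ η = inner ℂ θ ζ)
    (isClosed_eq (by fun_prop) (by fun_prop)) (fun a b ha hb => ?_) hh θ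
  rw [inner_add_left, inner_add_left, ha, hb]

theorem adjoint_tensorMap [CompleteSpace K] (T : K →L[ℂ] K) :
    ContinuousLinearMap.adjoint (tensorMap H T) = tensorMap H (ContinuousLinearMap.adjoint T) := by
  refine completedTensor_ext fun ξ h => completedTensor_ext_inner fun ξ' h' => ?_
  rw [ContinuousLinearMap.adjoint_inner_right, tensorMap_tmul, tensorMap_tmul,
    inner_completedTensor_tmul, inner_completedTensor_tmul,
    ContinuousLinearMap.adjoint_inner_right]

variable (H) in
/-- The unitary `Θ ⊗ 1`. -/
def tensorEquiv (Θ : K ≃ₗᵢ[ℂ] M) : Completion (K ⊗[ℂ] H) ≃ₗᵢ[ℂ] Completion (M ⊗[ℂ] H) where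
  toFun := tensorMap H (Θ : K →L[ℂ] M)
  invFun := tensorMap H (Θ.symm : M →L[ℂ] K)
  map_add' := map_add _
  map_smul' := map_smul _
  left_inv η := by
    rw [← ContinuousLinearMap.comp_apply, ← tensorMap_comp]
    have h : (Θ.symm : M →L[ℂ] K) ∘L (Θ : K →L[ℂ] M) = 1 := by ext ξ; exact Θ.symm_apply_apply ξ
    rw [h, tensorMap_one]; rfl
  right_inv η := by
    rw [← ContinuousLinearMap.comp_apply, ← tensorMap_comp]
    have h : (Θ : K →L[ℂ] M) ∘L (Θ.symm : M →L[ℂ] K) = 1 := by ext ξ; exact Θ.apply_symm_apply ξ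
    rw [h, tensorMap_one]; rfl
  norm_map' η := norm_tensorMap (fun ξ => Θ.norm_map ξ) η

theorem tensorEquiv_apply (Θ : K ≃ₗᵢ[ℂ] M) (η : Completion (K ⊗[ℂ] H)) :
    tensorEquiv H Θ η = tensorMap H (Θ : K →L[ℂ] M) η := rfl

/-- The operator `ξ ↦ ξ ⊗ h`. -/
def tensorVec (h : H) : K →L[ℂ] Completion (K ⊗[ℂ] H) :=
  Completion.toComplL ∘L (TensorProduct.mkL ℂ K H).flip h

theorem tensorVec_apply (h : H) (ξ : K) :
    tensorVec h ξ = ((ξ ⊗ₜ[ℂ] h : K ⊗[ℂ] H) : Completion (K ⊗[ℂ] H)) := rfl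

theorem adjoint_tensorVec_tmul [CompleteSpace K] (h h' : H) (ξ : K) :
    ContinuousLinearMap.adjoint (tensorVec (K := K) h)
      ((ξ ⊗ₜ[ℂ] h' : K ⊗[ℂ] H) : Completion (K ⊗[ℂ] H)) = (inner ℂ h h' : ℂ) • ξ := by
  refine ext_inner_left ℂ fun ζ => ?_
  rw [ContinuousLinearMap.adjoint_inner_right, tensorVec_apply, inner_completedTensor_tmul,
    inner_smul_right, mul_comm]

/-- The slice map `ξ ⊗ h' ↦ ⟪h, h'⟫ ξ` intertwines `T ⊗ 1` with `T`. Slices serve both as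
coordinates in the `ℓ²`-sum and as the means of reducing intertwiners of ampliations to those of the
original representations. -/
theorem adjoint_tensorVec_tensorMap [CompleteSpace K] (h : H) (T : K →L[ℂ] K)
    (η : Completion (K ⊗[ℂ] H)) :
    ContinuousLinearMap.adjoint (tensorVec h) (tensorMap H T η)
      = T (ContinuousLinearMap.adjoint (tensorVec h) η) := by
  refine DFunLike.congr_fun (completedTensor_ext
    (A := ContinuousLinearMap.adjoint (tensorVec h) ∘L tensorMap H T)
    (B := T ∘L ContinuousLinearMap.adjoint (tensorVec h)) fun ξ h' => ?_) η
  rw [ContinuousLinearMap.comp_apply, ContinuousLinearMap.comp_apply, tensorMap_tmul,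
    adjoint_tensorVec_tmul, adjoint_tensorVec_tmul, map_smul]

/-- The isometry `ξ ↦ ξ ⊗ h` for a unit vector `h`. -/
def tensorUnitVec (h : H) (hh : ‖h‖ = 1) : K →ₗᵢ[ℂ] Completion (K ⊗[ℂ] H) where
  toLinearMap := (tensorVec h).toLinearMap
  norm_map' ξ := by
    change ‖((ξ ⊗ₜ[ℂ] h : K ⊗[ℂ] H) : Completion (K ⊗[ℂ] H))‖ = ‖ξ‖
    rw [Completion.norm_coe, TensorProduct.norm_tmul, hh, mul_one]

theorem isHilbertSum_tensorUnitVec [CompleteSpace K] (b : HilbertBasis ℕ ℂ H) :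
    IsHilbertSum ℂ (fun _ : ℕ => K) fun n => tensorUnitVec (K := K) (b n) (b.orthonormal.1 n) := by
  refine IsHilbertSum.mk (fun i j hij ξ ξ' => ?_) fun η _ => ?_
  · change inner ℂ ((ξ ⊗ₜ[ℂ] b i : K ⊗[ℂ] H) : Completion (K ⊗[ℂ] H))
      ((ξ' ⊗ₜ[ℂ] b j : K ⊗[ℂ] H) : Completion (K ⊗[ℂ] H)) = 0
    rw [inner_completedTensor_tmul, b.orthonormal.2 hij, mul_zero]
  · set Z := (⨆ n, LinearMap.range
      (tensorUnitVec (K := K) (b n) (b.orthonormal.1 n)).toLinearMap).topologicalClosure with hZ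
    refine completedTensor_induction (p := fun η => η ∈ Z)
      (Submodule.isClosed_topologicalClosure _) (fun _ _ => Z.add_mem) (fun ξ h => ?_) η
    let A : H →L[ℂ] Completion (K ⊗[ℂ] H) := Completion.toComplL ∘L TensorProduct.mkL ℂ K H ξ
    have h1 : (Submodule.span ℂ (Set.range b)).topologicalClosure ≤ Z.comap A.toLinearMap := by
      refine Submodule.topologicalClosure_minimal _ (Submodule.span_le.2 ?_)
        ((Submodule.isClosed_topologicalClosure _).preimage A.continuous)
      rintro _ ⟨n, rfl⟩
      exact Submodule.le_topologicalClosure _ (Submodule.mem_iSup_of_mem n ⟨ξ, rfl⟩)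
    rw [b.dense_span] at h1
    exact h1 (Submodule.mem_top (x := h))

/-- A Hilbert basis `b` of `H` splits the tensor product into the copies `K ⊗ b n`. The `n`-th
coordinate is the slice along `b n`, so `T ⊗ 1` acts coordinatewise as `T`. -/
theorem exists_equiv_lp_tensorMap [CompleteSpace K] (b : HilbertBasis ℕ ℂ H) :
    ∃ U : Completion (K ⊗[ℂ] H) ≃ₗᵢ[ℂ] lp (fun _ : ℕ => K) 2,
      ∀ (T : K →L[ℂ] K) (η : Completion (K ⊗[ℂ] H)) (n : ℕ),
        (U (tensorMap H T η) : ∀ _ : ℕ, K) n = T ((U η : ∀ _ : ℕ, K) n) := by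
  have hV := isHilbertSum_tensorUnitVec (K := K) b
  have key : ∀ η n, (hV.linearIsometryEquiv η : ∀ _ : ℕ, K) n
      = ContinuousLinearMap.adjoint (tensorVec (b n)) η := by
    intro η n
    refine ext_inner_left ℂ fun ξ => ?_
    refine (lp.inner_single_left (𝕜 := ℂ) n ξ (hV.linearIsometryEquiv η)).symm.trans ?_
    rw [ContinuousLinearMap.adjoint_inner_right,
      ← hV.linearIsometryEquiv.symm.inner_map_map, hV.linearIsometryEquiv_symm_apply_single,
      LinearIsometryEquiv.symm_apply_apply]
    rfl
  refine ⟨hV.linearIsometryEquiv, fun T η n => ?_⟩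
  rw [key, key, adjoint_tensorVec_tensorMap]

theorem separableSpace_completedTensor [TopologicalSpace.SeparableSpace K]
    [TopologicalSpace.SeparableSpace H] :
    TopologicalSpace.SeparableSpace (Completion (K ⊗[ℂ] H)) := by
  have h1 : TopologicalSpace.IsSeparable
      (Set.range fun x : K × H => x.1 ⊗ₜ[ℂ] x.2 : Set (K ⊗[ℂ] H)) :=
    TopologicalSpace.isSeparable_range TensorProduct.continuous_tmul
  have h2 := h1.span (R := ℂ)
  have h3 : Submodule.span ℂ (Set.range fun x : K × H => x.1 ⊗ₜ[ℂ] x.2) = ⊤ := by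
    rw [← TensorProduct.span_tmul_eq_top]
    congr 1
    ext t
    simp [eq_comm]
  rw [h3] at h2
  have : TopologicalSpace.SeparableSpace (K ⊗[ℂ] H) :=
    TopologicalSpace.isSeparable_univ_iff.1 h2
  infer_instance

theorem not_finiteDimensional_completedTensor [Nontrivial K] (hH : ¬ FiniteDimensional ℂ H) :
    ¬ FiniteDimensional ℂ (Completion (K ⊗[ℂ] H)) := by
  intro hfin
  obtain ⟨ξ, hξ⟩ := exists_ne (0 : K)
  let A : H →L[ℂ] Completion (K ⊗[ℂ] H) := Completion.toComplL ∘L TensorProduct.mkL ℂ K H ξ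
  refine hH (Module.Finite.of_injective A.toLinearMap ?_)
  rw [injective_iff_map_eq_zero]
  intro h hh
  have h1 : ‖((ξ ⊗ₜ[ℂ] h : K ⊗[ℂ] H) : Completion (K ⊗[ℂ] H))‖ = 0 := by
    rw [norm_eq_zero]; exact hh
  rw [Completion.norm_coe, TensorProduct.norm_tmul, mul_eq_zero, norm_eq_zero, norm_eq_zero] at h1
  exact h1.resolve_left hξ

/-- Closeness of `X ⊗ 1` and `Y ⊗ 1` on one vector is controlled by closeness of the contractions
`X` and `Y` on finitely many vectors. -/
theorem exists_finset_control (M : Type*) [NormedAddCommGroup M] [InnerProductSpace ℂ M]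
    (η : Completion (K ⊗[ℂ] H)) {δ : ℝ} (hδ : 0 < δ) :
    ∃ (F : Finset K) (ε : ℝ), 0 < ε ∧ ∀ X Y : K →L[ℂ] M, (∀ ξ, ‖X ξ‖ ≤ ‖ξ‖) →
      (∀ ξ, ‖Y ξ‖ ≤ ‖ξ‖) → (∀ ξ ∈ F, ‖X ξ - Y ξ‖ ≤ ε) →
      ‖tensorMap H X η - tensorMap H Y η‖ ≤ δ := by
  classical
  -- On algebraic tensors no norm bound on `X` and `Y` is needed. Contractivity enters only when a
  -- general vector is replaced by a nearby algebraic one.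
  have key : ∀ (t : K ⊗[ℂ] H) (δ : ℝ), 0 < δ → ∃ (F : Finset K) (ε : ℝ), 0 < ε ∧
      ∀ X Y : K →L[ℂ] M, (∀ ξ ∈ F, ‖X ξ - Y ξ‖ ≤ ε) →
      ‖tensorMap H X (t : Completion (K ⊗[ℂ] H)) - tensorMap H Y (t : Completion (K ⊗[ℂ] H))‖
        ≤ δ := by
    intro t
    induction t using TensorProduct.induction_on with
    | zero =>
      intro δ hδ
      refine ⟨∅, 1, one_pos, fun X Y _ => ?_⟩
      rw [Completion.coe_zero, map_zero, map_zero, sub_zero, norm_zero]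
      exact hδ.le
    | tmul ξ h =>
      intro δ hδ
      refine ⟨{ξ}, δ / (‖h‖ + 1), by positivity, fun X Y hXY => ?_⟩
      have h1 := hXY ξ (Finset.mem_singleton_self ξ)
      rw [tensorMap_tmul, tensorMap_tmul, ← Completion.coe_sub, ← TensorProduct.sub_tmul,
        Completion.norm_coe, TensorProduct.norm_tmul]
      calc ‖X ξ - Y ξ‖ * ‖h‖ ≤ δ / (‖h‖ + 1) * (‖h‖ + 1) := by gcongr; linarith
        _ = δ := by field_simp
    | add t u ht hu =>
      intro δ hδ
      obtain ⟨F₁, ε₁, h₁, H₁⟩ := ht (δ / 2) (by positivity)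
      obtain ⟨F₂, ε₂, h₂, H₂⟩ := hu (δ / 2) (by positivity)
      refine ⟨F₁ ∪ F₂, min ε₁ ε₂, lt_min h₁ h₂, fun X Y hXY => ?_⟩
      have e₁ := H₁ X Y fun ξ hξ =>
        (hXY ξ (Finset.mem_union_left _ hξ)).trans (min_le_left _ _)
      have e₂ := H₂ X Y fun ξ hξ =>
        (hXY ξ (Finset.mem_union_right _ hξ)).trans (min_le_right _ _)
      rw [Completion.coe_add, map_add, map_add, add_sub_add_comm]
      linarith [norm_add_le_of_le e₁ e₂]
  obtain ⟨t, ht⟩ : ∃ t : K ⊗[ℂ] H, ‖η - (t : Completion (K ⊗[ℂ] H))‖ < δ / 3 := by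
    obtain ⟨_, h1, t, rfl⟩ := Metric.dense_iff.1
      (Completion.denseRange_coe (α := K ⊗[ℂ] H)) η (δ / 3)
      (by positivity)
    rw [Metric.mem_ball, dist_eq_norm, norm_sub_rev] at h1
    exact ⟨t, h1⟩
  obtain ⟨F, ε, hε, hF⟩ := key t (δ / 3) (by positivity)
  generalize (t : Completion (K ⊗[ℂ] H)) = t at ht hF
  refine ⟨F, ε, hε, fun X Y hX hY hXY => ?_⟩
  have e1 : tensorMap H X η - tensorMap H Y η = tensorMap H X (η - t)
      + (tensorMap H X t - tensorMap H Y t) - tensorMap H Y (η - t) := by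
    rw [map_sub, map_sub]; abel
  rw [e1]
  have e2 := norm_sub_le (tensorMap H X (η - t)
    + (tensorMap H X t - tensorMap H Y t)) (tensorMap H Y (η - t))
  have e3 := norm_add_le (tensorMap H X (η - t))
    (tensorMap H X t - tensorMap H Y t)
  linarith [norm_tensorMap_le hX (η - t), norm_tensorMap_le hY (η - t), hF X Y hXY]

theorem exists_finset_control_finset (M : Type*) [NormedAddCommGroup M] [InnerProductSpace ℂ M]
    (E : Finset (Completion (K ⊗[ℂ] H))) {δ : ℝ} (hδ : 0 < δ) :
    ∃ (F : Finset K) (ε : ℝ), 0 < ε ∧ ∀ X Y : K →L[ℂ] M, (∀ ξ, ‖X ξ‖ ≤ ‖ξ‖) →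
      (∀ ξ, ‖Y ξ‖ ≤ ‖ξ‖) → (∀ ξ ∈ F, ‖X ξ - Y ξ‖ ≤ ε) →
      ∀ η ∈ E, ‖tensorMap H X η - tensorMap H Y η‖ ≤ δ := by
  classical
  induction E using Finset.induction_on with
  | empty => exact ⟨∅, 1, one_pos, by simp⟩
  | insert η E _ ih =>
    obtain ⟨F₁, ε₁, h₁, H₁⟩ := exists_finset_control M η hδ
    obtain ⟨F₂, ε₂, h₂, H₂⟩ := ih
    refine ⟨F₁ ∪ F₂, min ε₁ ε₂, lt_min h₁ h₂, fun X Y hX hY hXY => ?_⟩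
    have e₁ := H₁ X Y hX hY fun ξ hξ =>
      (hXY ξ (Finset.mem_union_left _ hξ)).trans (min_le_left _ _)
    have e₂ := H₂ X Y hX hY fun ξ hξ =>
      (hXY ξ (Finset.mem_union_right _ hξ)).trans (min_le_right _ _)
    intro ζ hζ
    rcases Finset.mem_insert.1 hζ with rfl | hζ
    · exact e₁
    · exact e₂ ζ hζ

end CompletedTensor

/-! ### Ampliations and unitary conjugates of representations -/

section Ampliation

open UniformSpace

variable {S K M N H : Type*} [NormedAddCommGroup K] [InnerProductSpace ℂ K]
  [NormedAddCommGroup M] [InnerProductSpace ℂ M] [NormedAddCommGroup N] [InnerProductSpace ℂ N]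
  [NormedAddCommGroup H] [InnerProductSpace ℂ H]

theorem UnitarilyEquivalent.symm {V : S → K →L[ℂ] K} {W : S → M →L[ℂ] M}
    (h : UnitarilyEquivalent V W) : UnitarilyEquivalent W V := by
  obtain ⟨U, hU⟩ := h
  refine ⟨U.symm, fun s x => ?_⟩
  rw [LinearIsometryEquiv.symm_apply_eq, hU, U.apply_symm_apply]

theorem UnitarilyEquivalent.trans {V : S → K →L[ℂ] K} {W : S → M →L[ℂ] M} {X : S → N →L[ℂ] N}
    (h : UnitarilyEquivalent V W) (h' : UnitarilyEquivalent W X) : UnitarilyEquivalent V X := by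
  obtain ⟨U, hU⟩ := h
  obtain ⟨U', hU'⟩ := h'
  refine ⟨U.trans U', fun s x => ?_⟩
  rw [LinearIsometryEquiv.trans_apply, LinearIsometryEquiv.trans_apply, hU, hU']

/-- The representation on `M` obtained from one on `K` by conjugation with a unitary. -/
def conjRep (U : K ≃ₗᵢ[ℂ] M) (V : S → K →L[ℂ] K) (s : S) : M →L[ℂ] M :=
  (U : K →L[ℂ] M) ∘L V s ∘L (U.symm : M →L[ℂ] K)

theorem conjRep_apply (U : K ≃ₗᵢ[ℂ] M) (V : S → K →L[ℂ] K) (s : S) (x : M) :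
    conjRep U V s x = U (V s (U.symm x)) := rfl

theorem conjRep_map (U : K ≃ₗᵢ[ℂ] M) (V : S → K →L[ℂ] K) (s : S) (x : K) :
    U (V s x) = conjRep U V s (U x) := by
  rw [conjRep_apply, U.symm_apply_apply]

theorem unitarilyEquivalent_conjRep (U : K ≃ₗᵢ[ℂ] M) (V : S → K →L[ℂ] K) :
    UnitarilyEquivalent V (conjRep U V) := ⟨U, conjRep_map U V⟩

theorem UnitarilyEquivalent.isIsometricRep [AddCommMonoid S] [TopologicalSpace S]
    {V : S → K →L[ℂ] K} {W : S → M →L[ℂ] M} (h : UnitarilyEquivalent V W)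
    (hV : IsIsometricRep V) : IsIsometricRep W := by
  obtain ⟨U, hU⟩ := h
  have hW : ∀ s x, W s x = U (V s (U.symm x)) := fun s x => by rw [hU, U.apply_symm_apply]
  refine ⟨?_, fun s t => ?_, fun s x => ?_, fun x => ?_⟩
  · ext x
    rw [hW, hV.map_zero]
    exact U.apply_symm_apply x
  · ext x
    rw [mul_apply_eq_comp, hW, hW s, hW t, hV.map_add, U.symm_apply_apply]
    rfl
  · rw [hW, U.norm_map, hV.norm_map, U.symm.norm_map]
  · simp_rw [hW]
    exact U.continuous.comp (hV.strong_continuous _)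

theorem UnitarilyEquivalent.isRailway [AddCommMonoid S] [TopologicalSpace S]
    {V : S → K →L[ℂ] K} {W : S → M →L[ℂ] M} (h : UnitarilyEquivalent V W)
    (hV : IsRailway V) : IsRailway W := by
  refine ⟨h.isIsometricRep hV.1, ?_⟩
  obtain ⟨K₀, _, _, _, _, V₀, h1, h2, U, hU⟩ := hV.2
  obtain ⟨U', hU'⟩ := h.symm
  refine ⟨K₀, _, _, ‹_›, ‹_›, V₀, h1, h2, U'.trans U, fun s x n => ?_⟩
  rw [LinearIsometryEquiv.trans_apply, LinearIsometryEquiv.trans_apply, hU', hU]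

theorem UnitarilyEquivalent.isDoublyCommuting [CompleteSpace K] [CompleteSpace M]
    {V : RPlusInfty → K →L[ℂ] K} {W : RPlusInfty → M →L[ℂ] M} (h : UnitarilyEquivalent V W)
    (hV : IsDoublyCommuting V) : IsDoublyCommuting W := by
  obtain ⟨U, hU⟩ := h
  intro i j hij s t
  ext x
  obtain ⟨x, rfl⟩ := U.surjective x
  rw [mul_apply_eq_comp, mul_apply_eq_comp, ← hU,
    ← intertwines_adjoint U (hU _), ← intertwines_adjoint U (hU _), ← hU]
  exact congrArg U (DFunLike.congr_fun (hV i j hij s t) x)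

theorem IsIsometricRep.tensorOne [AddCommMonoid S] [TopologicalSpace S] {V : S → K →L[ℂ] K}
    (hV : IsIsometricRep V) : IsIsometricRep (tensorOne H V) := by
  refine ⟨?_, fun s t => ?_, fun s x => ?_, fun η => ?_⟩
  · rw [tensorOne_eq, hV.map_zero, tensorMap_one]
  · rw [tensorOne_eq, hV.map_add, tensorMap_mul]; rfl
  · exact norm_tensorMap (hV.norm_map s) x
  · rw [continuous_iff_continuousAt]
    intro s
    rw [ContinuousAt, Metric.tendsto_nhds]
    intro ε hε
    obtain ⟨F, δ, hδ, hF⟩ := exists_finset_control K η (δ := ε / 2) (by positivity)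
    have h1 : ∀ᶠ t in 𝓝 s, ∀ ξ ∈ F, ‖V t ξ - V s ξ‖ < δ := by
      rw [Filter.eventually_all_finset]
      intro ξ _
      filter_upwards [Metric.tendsto_nhds.1 ((hV.strong_continuous ξ).tendsto s) δ hδ] with t ht
      rwa [dist_eq_norm] at ht
    filter_upwards [h1] with t ht
    rw [dist_eq_norm]
    exact (hF (V t) (V s) (fun ξ => (hV.norm_map t ξ).le) (fun ξ => (hV.norm_map s ξ).le)
      fun ξ hξ => (ht ξ hξ).le).trans_lt (by linarith)

theorem IsDoublyCommuting.tensorOne [CompleteSpace K] {V : RPlusInfty → K →L[ℂ] K}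
    (hV : IsDoublyCommuting V) : IsDoublyCommuting (tensorOne H V) := by
  intro i j hij s t
  rw [tensorOne_eq, tensorOne_eq, adjoint_tensorMap, ← tensorMap_mul, ← tensorMap_mul,
    hV i j hij s t]

theorem isRailway_tensorOne {K₀ : Type} [NormedAddCommGroup K₀] [InnerProductSpace ℂ K₀]
    [CompleteSpace K₀] [TopologicalSpace.SeparableSpace K₀] [AddCommMonoid S] [TopologicalSpace S]
    [CompleteSpace H] [TopologicalSpace.SeparableSpace H] (hH : ¬ FiniteDimensional ℂ H)
    {V : S → K₀ →L[ℂ] K₀} (hV : IsIsometricRep V) (hV' : IsIrreducibleRep V) :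
    IsRailway (tensorOne H V) := by
  obtain ⟨b⟩ := exists_hilbertBasis_nat H hH
  obtain ⟨U, hU⟩ := exists_equiv_lp_tensorMap (K := K₀) b
  exact ⟨hV.tensorOne, K₀, _, _, ‹_›, ‹_›, V, hV, hV', U, fun s x n => hU (V s) x n⟩

/-- On finitely many vectors and uniformly on compact sets, `V` and its adjoint are approximated by
unitary conjugates of `W`. -/
def ApproximatedByConjugates [TopologicalSpace S] [CompleteSpace K] [CompleteSpace M]
    (V : S → K →L[ℂ] K) (W : S → M →L[ℂ] M) : Prop :=
  ∀ C : Set S, IsCompact C → ∀ (F : Finset K) (ε : ℝ), 0 < ε → ∃ Θ : K ≃ₗᵢ[ℂ] M,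
    ∀ ξ ∈ F, ∀ x ∈ C, ‖Θ (V x ξ) - W x (Θ ξ)‖ ≤ ε ∧
      ‖Θ (ContinuousLinearMap.adjoint (V x) ξ) - ContinuousLinearMap.adjoint (W x) (Θ ξ)‖ ≤ ε

theorem norm_adjoint_apply_le [CompleteSpace K] [CompleteSpace M] {T : K →L[ℂ] M}
    (hT : ∀ ξ, ‖T ξ‖ ≤ ‖ξ‖) (η : M) : ‖ContinuousLinearMap.adjoint T η‖ ≤ ‖η‖ := by
  have h1 : ‖T‖ ≤ 1 := T.opNorm_le_bound zero_le_one fun ξ => by rw [one_mul]; exact hT ξ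
  rw [← LinearIsometryEquiv.norm_map ContinuousLinearMap.adjoint] at h1
  have h2 := (ContinuousLinearMap.adjoint T).le_of_opNorm_le h1 η
  rwa [one_mul] at h2

/-- The control set `F` and tolerance do not depend on the contractions being compared. They may
therefore be applied to `Θ V_x` and `W_x Θ`, and to the adjoint versions, simultaneously for all `x
∈ C`. -/
theorem ApproximatedByConjugates.tensorOne [TopologicalSpace S] [CompleteSpace K] [CompleteSpace M]
    {V : S → K →L[ℂ] K} {W : S → M →L[ℂ] M} (h : ApproximatedByConjugates V W)
    (hV : ∀ s x, ‖V s x‖ ≤ ‖x‖) (hW : ∀ s x, ‖W s x‖ ≤ ‖x‖) :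
    ApproximatedByConjugates (tensorOne H V) (tensorOne H W) := by
  intro C hC E ε hε
  obtain ⟨F, δ, hδ, hF⟩ := exists_finset_control_finset M E hε
  obtain ⟨Θ, hΘ⟩ := h C hC F δ hδ
  refine ⟨tensorEquiv H Θ, fun η hη x hx => ?_⟩
  rw [tensorOne_eq, tensorOne_eq, adjoint_tensorMap, adjoint_tensorMap]
  simp only [tensorEquiv_apply, ← ContinuousLinearMap.comp_apply, ← tensorMap_comp]
  have h1 := norm_adjoint_apply_le (hV x)
  have h2 := norm_adjoint_apply_le (hW x)
  have h3 := Θ.norm_map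
  constructor
  · refine hF _ _ (fun ξ => ?_) (fun ξ => ?_) (fun ξ hξ => (hΘ ξ hξ x hx).1) η hη
    · exact (h3 _).le.trans (hV x ξ)
    · exact (hW x _).trans (h3 ξ).le
  · refine hF _ _ (fun ξ => ?_) (fun ξ => ?_) (fun ξ hξ => (hΘ ξ hξ x hx).2) η hη
    · exact (h3 _).le.trans (h1 ξ)
    · exact (h2 _).trans (h3 ξ).le

theorem ApproximatedByConjugates.conjRep [TopologicalSpace S] [CompleteSpace K] [CompleteSpace M]
    [CompleteSpace N] {K' : Type*} [NormedAddCommGroup K'] [InnerProductSpace ℂ K']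
    [CompleteSpace K'] {V : S → K →L[ℂ] K} {W : S → M →L[ℂ] M} (h : ApproximatedByConjugates V W)
    (U : K ≃ₗᵢ[ℂ] K') (U' : M ≃ₗᵢ[ℂ] N) :
    ApproximatedByConjugates (conjRep U V) (conjRep U' W) := by
  classical
  intro C hC E ε hε
  obtain ⟨Θ, hΘ⟩ := h C hC (E.image U.symm) ε hε
  refine ⟨(U.symm.trans Θ).trans U', fun ξ hξ x hx => ?_⟩
  obtain ⟨ξ, rfl⟩ := U.surjective ξ
  have h1 := hΘ ξ (Finset.mem_image.2 ⟨_, hξ, U.symm_apply_apply ξ⟩) x hx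
  rw [← intertwines_adjoint U (conjRep_map U V x), ← conjRep_map]
  simp only [LinearIsometryEquiv.trans_apply, LinearIsometryEquiv.symm_apply_apply]
  rw [← intertwines_adjoint U' (conjRep_map U' W x), ← conjRep_map, ← map_sub, ← map_sub,
    U'.norm_map, U'.norm_map]
  exact h1

end Ampliation

/-! ### Inseparability in the Fell topology -/

section FellTopology

variable {S L : Type*} [AddCommMonoid S] [TopologicalSpace S] [NormedAddCommGroup L]
  [InnerProductSpace ℂ L] [CompleteSpace L]

/-- The generating sets are centred at arbitrary representations and form only a subbasis. This
extracts from an open set a neighbourhood centred at the given point. -/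
theorem RailwayRep.exists_control_of_isOpen {O : Set (RailwayRep S L)} (hO : IsOpen O)
    {V : RailwayRep S L} (hV : V ∈ O) :
    ∃ (C : Set S) (F : Finset L) (ε : ℝ), IsCompact C ∧ 0 < ε ∧ ∀ W : RailwayRep S L,
      (∀ ξ ∈ F, ∀ x ∈ C, ‖(V.op x - W.op x) ξ‖ ≤ ε ∧
        ‖(ContinuousLinearMap.adjoint (V.op x) - ContinuousLinearMap.adjoint (W.op x)) ξ‖ ≤ ε) →
      W ∈ O := by
  classical
  induction hO with
  | basic s hs =>
    obtain ⟨V₀, C, ε, F, hC, -, -, rfl⟩ := hs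
    obtain ⟨δ, hδε, hδ⟩ := hV
    -- The supremum for `V` is at most `δ < ε`; half of the gap still leaves a bound strictly below
    -- `ε`.
    refine ⟨C, F, (ε - δ) / 2, hC, by linarith, fun W hW => ⟨δ + (ε - δ) / 2, by linarith,
      fun ξ hξ x hx => ⟨?_, ?_⟩⟩⟩
    · rw [← sub_add_sub_cancel _ (V.op x)]
      exact norm_add_le_of_le (hδ ξ hξ x hx).1 (hW ξ hξ x hx).1
    · rw [← sub_add_sub_cancel _ (ContinuousLinearMap.adjoint (V.op x))]
      exact norm_add_le_of_le (hδ ξ hξ x hx).2 (hW ξ hξ x hx).2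
  | univ => exact ⟨∅, ∅, 1, isCompact_empty, one_pos, fun _ _ => Set.mem_univ _⟩
  | inter s t _ _ hs ht =>
    obtain ⟨C₁, F₁, ε₁, hC₁, h₁, H₁⟩ := hs hV.1
    obtain ⟨C₂, F₂, ε₂, hC₂, h₂, H₂⟩ := ht hV.2
    refine ⟨C₁ ∪ C₂, F₁ ∪ F₂, min ε₁ ε₂, hC₁.union hC₂, lt_min h₁ h₂, fun W hW => ⟨?_, ?_⟩⟩
    · refine H₁ W fun ξ hξ x hx => ?_
      have h := hW ξ (Finset.mem_union_left _ hξ) x (Or.inl hx)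
      exact ⟨h.1.trans (min_le_left _ _), h.2.trans (min_le_left _ _)⟩
    · refine H₂ W fun ξ hξ x hx => ?_
      have h := hW ξ (Finset.mem_union_right _ hξ) x (Or.inr hx)
      exact ⟨h.1.trans (min_le_right _ _), h.2.trans (min_le_right _ _)⟩
  | sUnion T _ hT =>
    obtain ⟨s, hs, hVs⟩ := hV
    obtain ⟨C, F, ε, hC, hε, H⟩ := hT s hs hVs
    exact ⟨C, F, ε, hC, hε, fun W hW => ⟨s, hs, H W hW⟩⟩

theorem FellSpace.mk_eq_mk {S L : Type*} [AddCommMonoid S] [TopologicalSpace S]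
    [NormedAddCommGroup L] [InnerProductSpace ℂ L] {V W : RailwayRep S L} :
    FellSpace.mk V = FellSpace.mk W ↔ UnitarilyEquivalent V.op W.op :=
  Quotient.eq (r := RailwayRep.setoid S L)

/-- The preimage of an open set of classes is open and saturated. Once it contains `V` it contains
some unitary conjugate of `W`, hence the class of `W` lies in the open set. -/
theorem FellSpace.specializes {V W : RailwayRep S L} (h : ApproximatedByConjugates V.op W.op) :
    FellSpace.mk W ⤳ FellSpace.mk V := by
  rw [specializes_iff_forall_open]
  intro O hO hV
  have hO' : IsOpen ((FellSpace.mk : RailwayRep S L → FellSpace S L) ⁻¹' O) :=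
    hO.preimage continuous_quotient_mk'
  obtain ⟨C, F, ε, hC, hε, H⟩ := RailwayRep.exists_control_of_isOpen hO' hV
  obtain ⟨Θ, hΘ⟩ := h C hC F ε hε
  have hequiv := unitarilyEquivalent_conjRep Θ.symm W.op
  have h1 : (⟨conjRep Θ.symm W.op, hequiv.isRailway W.isRailway⟩ : RailwayRep S L) ∈
      (FellSpace.mk : RailwayRep S L → FellSpace S L) ⁻¹' O := by
    refine H _ fun ξ hξ x hx => ?_
    have e1 : ContinuousLinearMap.adjoint (conjRep Θ.symm W.op x) ξ
        = Θ.symm (ContinuousLinearMap.adjoint (W.op x) (Θ ξ)) := by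
      rw [intertwines_adjoint Θ.symm (conjRep_map Θ.symm W.op x), Θ.symm_apply_apply]
    have e2 : conjRep Θ.symm W.op x ξ = Θ.symm (W.op x (Θ ξ)) := rfl
    have h2 := hΘ ξ hξ x hx
    simp only [sub_apply, e1, e2]
    rw [← Θ.norm_map, map_sub, Θ.apply_symm_apply, ← Θ.norm_map (_ - Θ.symm _), map_sub,
      Θ.apply_symm_apply]
    exact h2
  have h3 : FellSpace.mk (⟨conjRep Θ.symm W.op, hequiv.isRailway W.isRailway⟩ : RailwayRep S L)
      = FellSpace.mk W := FellSpace.mk_eq_mk.2 hequiv.symm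
  rw [Set.mem_preimage, h3] at h1
  exact h1

end FellTopology

/-! ### Inequivalence of ampliations -/

section Inequivalence

open UniformSpace

variable {S K M : Type*} [NormedAddCommGroup K] [InnerProductSpace ℂ K] [CompleteSpace K]
  [NormedAddCommGroup M] [InnerProductSpace ℂ M] [CompleteSpace M] {V : S → K →L[ℂ] K}
  {W : S → M →L[ℂ] M}

/-- The only operator intertwining the two families and their adjoints is zero. -/
def AreDisjoint (V : S → K →L[ℂ] K) (W : S → M →L[ℂ] M) : Prop :=
  ∀ T : K →L[ℂ] M, (∀ s f, T (V s f) = W s (T f)) →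
    (∀ s f, T (ContinuousLinearMap.adjoint (V s) f) = ContinuousLinearMap.adjoint (W s) (T f)) →
    ∀ f, T f = 0

theorem AreDisjoint.not_unitarilyEquivalent [Nontrivial K] (h : AreDisjoint V W) :
    ¬ UnitarilyEquivalent V W := by
  rintro ⟨U, hU⟩
  obtain ⟨f, hf⟩ := exists_ne (0 : K)
  have h := h (U : K →L[ℂ] M) hU (fun x f => intertwines_adjoint U (hU x) f) f
  exact hf (U.injective (h.trans (map_zero U).symm))

/-- Compressing a unitary equivalence `U` between `· ⊗ h` and the slice along `h'` gives an
intertwiner of `V` and `W`, which vanishes. Since the vectors `ξ ⊗ h'` are total, `U (f ⊗ h) = 0`,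
which is impossible for nonzero `f` and `h`. -/
theorem AreDisjoint.not_unitarilyEquivalent_tensorOne [Nontrivial K] (hVW : AreDisjoint V W)
    {H : Type*} [NormedAddCommGroup H] [InnerProductSpace ℂ H] [Nontrivial H] :
    ¬ UnitarilyEquivalent (tensorOne H V) (tensorOne H W) := by
  rintro ⟨U, hU⟩
  have hU' : ∀ x η, U (tensorMap H (ContinuousLinearMap.adjoint (V x)) η)
      = tensorMap H (ContinuousLinearMap.adjoint (W x)) (U η) := by
    intro x η
    rw [← adjoint_tensorMap, ← adjoint_tensorMap]
    exact intertwines_adjoint U (hU x) η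
  obtain ⟨f, hf⟩ := exists_ne (0 : K)
  obtain ⟨h, hh⟩ := exists_ne (0 : H)
  have h1 : ∀ h' : H, ContinuousLinearMap.adjoint (tensorVec h') (U (tensorVec h f)) = 0 := by
    intro h'
    refine hVW (ContinuousLinearMap.adjoint (tensorVec h')
      ∘L (U : Completion (K ⊗[ℂ] H) →L[ℂ] Completion (M ⊗[ℂ] H))
      ∘L tensorVec h) (fun x g => ?_) (fun x g => ?_) f
    · change ContinuousLinearMap.adjoint (tensorVec h') (U (tensorVec h (V x g)))
        = W x (ContinuousLinearMap.adjoint (tensorVec h') (U (tensorVec h g)))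
      rw [← adjoint_tensorVec_tensorMap, tensorVec_apply h (V x g), ← tensorMap_tmul]
      exact congrArg _ (hU x _)
    · change ContinuousLinearMap.adjoint (tensorVec h')
          (U (tensorVec h (ContinuousLinearMap.adjoint (V x) g)))
        = ContinuousLinearMap.adjoint (W x)
          (ContinuousLinearMap.adjoint (tensorVec h') (U (tensorVec h g)))
      rw [← adjoint_tensorVec_tensorMap, tensorVec_apply h (ContinuousLinearMap.adjoint _ g),
        ← tensorMap_tmul]
      exact congrArg _ (hU' x _)
  have h2 : U (tensorVec h f) = 0 := by
    refine completedTensor_ext_inner fun ξ h' => ?_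
    rw [inner_zero_right, ← tensorVec_apply, ← ContinuousLinearMap.adjoint_inner_right, h1,
      inner_zero_right]
  have h3 : ‖tensorVec h f‖ = 0 := by rw [← U.norm_map, h2, norm_zero]
  rw [tensorVec_apply, Completion.norm_coe, TensorProduct.norm_tmul, mul_eq_zero, norm_eq_zero,
    norm_eq_zero] at h3
  exact h3.elim hf hh

end Inequivalence

/-! ### Points of the Fell space -/

section FellPoints

variable {K M L : Type*} [NormedAddCommGroup K] [InnerProductSpace ℂ K] [CompleteSpace K]
  [NormedAddCommGroup M] [InnerProductSpace ℂ M] [CompleteSpace M]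
  [NormedAddCommGroup L] [InnerProductSpace ℂ L] [CompleteSpace L]

/-- The class of the representation on `L` obtained from `W` by conjugation with a unitary. -/
def FellSpaceDC.ofEquiv (U : K ≃ₗᵢ[ℂ] L) {W : RPlusInfty → K →L[ℂ] K} (hW : IsRailway W)
    (hW' : IsDoublyCommuting W) : FellSpaceDC L :=
  ⟨FellSpace.mk ⟨conjRep U W, (unitarilyEquivalent_conjRep U W).isRailway hW⟩, _, rfl,
    (unitarilyEquivalent_conjRep U W).isDoublyCommuting hW'⟩

theorem FellSpaceDC.isClassOf_ofEquiv (U : K ≃ₗᵢ[ℂ] L) {W : RPlusInfty → K →L[ℂ] K}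
    (hW : IsRailway W) (hW' : IsDoublyCommuting W) : (ofEquiv U hW hW').IsClassOf W := by
  intro V
  refine FellSpace.mk_eq_mk.trans ⟨fun h => ?_, fun h => ?_⟩
  · exact h.trans (unitarilyEquivalent_conjRep U W).symm
  · exact h.trans (unitarilyEquivalent_conjRep U W)

theorem FellSpaceDC.ofEquiv_ne (U : K ≃ₗᵢ[ℂ] L) (U' : M ≃ₗᵢ[ℂ] L) {V : RPlusInfty → K →L[ℂ] K}
    {W : RPlusInfty → M →L[ℂ] M} (hV : IsRailway V) (hV' : IsDoublyCommuting V) (hW : IsRailway W)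
    (hW' : IsDoublyCommuting W) (h : ¬ UnitarilyEquivalent V W) :
    ofEquiv U hV hV' ≠ ofEquiv U' hW hW' := by
  intro heq
  exact h (((unitarilyEquivalent_conjRep U V).trans
    (FellSpace.mk_eq_mk.1 (congrArg Subtype.val heq))).trans
    (unitarilyEquivalent_conjRep U' W).symm)

theorem FellSpaceDC.inseparable_ofEquiv (U : K ≃ₗᵢ[ℂ] L) (U' : M ≃ₗᵢ[ℂ] L)
    {V : RPlusInfty → K →L[ℂ] K} {W : RPlusInfty → M →L[ℂ] M} (hV : IsRailway V)
    (hV' : IsDoublyCommuting V) (hW : IsRailway W) (hW' : IsDoublyCommuting W)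
    (hVW : ApproximatedByConjugates V W) (hWV : ApproximatedByConjugates W V) :
    Inseparable (ofEquiv U hV hV') (ofEquiv U' hW hW') := by
  exact Topology.IsInducing.subtypeVal.inseparable_iff.1 ((FellSpace.specializes (hWV.conjRep U' U)).antisymm
    (FellSpace.specializes (hVW.conjRep U U')))

end FellPoints

/-! ### A pair of thresholds at infinite distance -/

section ThresholdExample

open ProbabilityTheory

theorem gaussianReal_Iio_le {t c : ℝ} (hc : 0 < c) (ht : t ≤ -c) :
    (gaussianReal 0 1).real (Set.Iio t) ≤ 1 / c ^ 2 := by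
  have h1 := meas_ge_le_variance_div_sq (μ := gaussianReal 0 1) (X := id)
    (memLp_id_gaussianReal' 2 (by norm_num)) hc
  rw [variance_id_gaussianReal] at h1
  have h2 : (gaussianReal 0 1) (Set.Iio t) ≤ ENNReal.ofReal (1 / c ^ 2) := by
    refine (measure_mono fun x hx => ?_).trans h1
    have hx' : x < t := hx
    have h3 : ∫ y, id y ∂gaussianReal 0 1 = 0 := integral_id_gaussianReal
    rw [Set.mem_ofPred_eq, h3, id, sub_zero]
    linarith [neg_le_abs x]
  exact ENNReal.toReal_le_of_le_ofReal (by positivity) h2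

/-- Chebyshev bounds the missing mass by `1 / (n + 2) ^ 2`. This is summable and, thanks to the
offset `2`, at most `1/4`, so every factor is visibly positive and the product converges through its
logarithms. -/
theorem mem_thresholds_of_le {a : ℕ → ℝ} (ha : ∀ n, a n ≤ -((n : ℝ) + 2)) : a ∈ thresholds := by
  set q : ℕ → ℝ := fun n => (gaussianReal 0 1).real (Set.Iio (a n)) with hq
  have h1 : ∀ n, (gaussianReal 0 1).real (Set.Ici (a n)) = 1 + -q n := fun n => by
    rw [hq, ← Set.compl_Iio, probReal_compl_eq_one_sub measurableSet_Iio, sub_eq_add_neg]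
  have h2 : ∀ n, q n ≤ 1 / ((n : ℝ) + 2) ^ 2 := fun n => gaussianReal_Iio_le (by positivity) (ha n)
  have h3 : Summable q := by
    refine Summable.of_nonneg_of_le (fun n => measureReal_nonneg) h2 ?_
    have h4 := (summable_nat_add_iff 2).2 (Real.summable_one_div_nat_pow.2 one_lt_two)
    simpa using h4
  have hpos : ∀ n, 0 < 1 + -q n := by
    intro n
    have h4 : 1 / ((n : ℝ) + 2) ^ 2 ≤ 1 / 4 :=
      one_div_le_one_div_of_le (by norm_num) (by nlinarith [(Nat.cast_nonneg n : (0 : ℝ) ≤ n)])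
    linarith [h2 n]
  refine ⟨fun n => (ha n).trans (by linarith [(Nat.cast_nonneg n : (0 : ℝ) ≤ n)]), _,
    Real.exp_pos (∑' n, Real.log (1 + -q n)), ?_⟩
  simp_rw [h1]
  exact (Real.hasProd_of_hasSum_log hpos
    (Real.summable_log_one_add_of_summable h3.neg).hasSum).tendsto_prod_nat

/-- The two sequences differ by the constant `1`, which is not square summable. -/
theorem exists_thresholds_not_memℓp :
    ∃ a ∈ thresholds, ∃ b ∈ thresholds, ¬ Memℓp (fun n => a n - b n) 2 := by
  refine ⟨fun n => -((n : ℝ) + 2), mem_thresholds_of_le fun n => le_rfl,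
    fun n => -((n : ℝ) + 2) - 1, mem_thresholds_of_le fun n => by linarith, fun h => ?_⟩
  rw [memℓp_gen_iff (by norm_num)] at h
  simp [summable_const_iff] at h

end ThresholdExample

/-! ### The main theorem -/

section Ampliations

variable {H : Type*} [NormedAddCommGroup H] [InnerProductSpace ℂ H]

theorem areDisjoint_orthantRep {a b : ℕ → ℝ} (hab : ¬ Memℓp (fun n => a n - b n) 2) :
    AreDisjoint (orthantRep a) (orthantRep b) :=
  fun T hT hT' f => intertwiner_apply_eq_zero hab T hT hT' f

theorem approximatedByConjugates_tensorOne_orthantRep {a b : ℕ → ℝ} (ha : a ∈ thresholds)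
    (hb : b ∈ thresholds) :
    ApproximatedByConjugates (tensorOne H (orthantRep a)) (tensorOne H (orthantRep b)) :=
  ApproximatedByConjugates.tensorOne (fun _ hC F _ hε => exists_unitary_approx hb ha hC F hε)
    (fun s x => ((isIsometricRep_orthantRep a).norm_map s x).le)
    fun s x => ((isIsometricRep_orthantRep b).norm_map s x).le

theorem isDoublyCommuting_tensorOne_orthantRep (a : ℕ → ℝ) :
    IsDoublyCommuting (tensorOne H (orthantRep a)) :=
  (isDoublyCommuting_orthantRep a).tensorOne

theorem nonempty_completedTensor_equiv {K L : Type*} [NormedAddCommGroup K] [InnerProductSpace ℂ K]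
    [TopologicalSpace.SeparableSpace K] [Nontrivial K] [TopologicalSpace.SeparableSpace H]
    (hH : ¬ FiniteDimensional ℂ H)
    [NormedAddCommGroup L] [InnerProductSpace ℂ L] [CompleteSpace L]
    [TopologicalSpace.SeparableSpace L] (hL : ¬ FiniteDimensional ℂ L) :
    Nonempty (UniformSpace.Completion (K ⊗[ℂ] H) ≃ₗᵢ[ℂ] L) := by
  have := separableSpace_completedTensor (K := K) (H := H)
  exact nonempty_linearIsometryEquiv _ _ (not_finiteDimensional_completedTensor hH) hL

variable [CompleteSpace H] [TopologicalSpace.SeparableSpace H]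

theorem isRailway_tensorOne_orthantRep (hH : ¬ FiniteDimensional ℂ H) {a : ℕ → ℝ}
    (ha : a ∈ thresholds) : IsRailway (tensorOne H (orthantRep a)) :=
  isRailway_tensorOne hH (isIsometricRep_orthantRep a)
    (isIrreducibleRep_orthantRep (gaussianProduct_orthant_ne_zero ha))

/-- Disjointness separates the two classes as points, while mutual approximation by conjugates makes
each specialize to the other. -/
theorem exists_inseparable_classes {L : Type*} [NormedAddCommGroup L] [InnerProductSpace ℂ L]
    [CompleteSpace L] [TopologicalSpace.SeparableSpace L] (hL : ¬ FiniteDimensional ℂ L)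
    (hH : ¬ FiniteDimensional ℂ H) {a b : ℕ → ℝ} (ha : a ∈ thresholds) (hb : b ∈ thresholds)
    (hab : ¬ Memℓp (fun n => a n - b n) 2) :
    ∃ P Q : FellSpaceDC L, P.IsClassOf (tensorOne H (orthantRep a)) ∧
      Q.IsClassOf (tensorOne H (orthantRep b)) ∧ P ≠ Q ∧ Inseparable P Q := by
  have : Nontrivial (orthantL2 a) :=
    (isIrreducibleRep_orthantRep (gaussianProduct_orthant_ne_zero ha)).1
  have : Nontrivial (orthantL2 b) :=
    (isIrreducibleRep_orthantRep (gaussianProduct_orthant_ne_zero hb)).1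
  have : Nontrivial H := by
    by_contra h
    rw [not_nontrivial_iff_subsingleton] at h
    exact hH inferInstance
  obtain ⟨U⟩ := nonempty_completedTensor_equiv (K := orthantL2 a) hH hL
  obtain ⟨U'⟩ := nonempty_completedTensor_equiv (K := orthantL2 b) hH hL
  exact ⟨FellSpaceDC.ofEquiv U (isRailway_tensorOne_orthantRep hH ha)
      (isDoublyCommuting_tensorOne_orthantRep a),
    FellSpaceDC.ofEquiv U' (isRailway_tensorOne_orthantRep hH hb)
      (isDoublyCommuting_tensorOne_orthantRep b),
    FellSpaceDC.isClassOf_ofEquiv _ _ _, FellSpaceDC.isClassOf_ofEquiv _ _ _,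
    FellSpaceDC.ofEquiv_ne _ _ _ _ _ _
      (areDisjoint_orthantRep hab).not_unitarilyEquivalent_tensorOne,
    FellSpaceDC.inseparable_ofEquiv _ _ _ _ _ _
      (approximatedByConjugates_tensorOne_orthantRep ha hb)
      (approximatedByConjugates_tensorOne_orthantRep hb ha)⟩

end Ampliations



theorem mainTheorem5
    (L : Type*) [NormedAddCommGroup L] [InnerProductSpace ℂ L] [CompleteSpace L]
    [TopologicalSpace.SeparableSpace L] (hL : ¬ FiniteDimensional ℂ L)
    (H : Type*) [NormedAddCommGroup H] [InnerProductSpace ℂ H] [CompleteSpace H]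
    [TopologicalSpace.SeparableSpace H] (hH : ¬ FiniteDimensional ℂ H) :
    (∀ a ∈ thresholds, ∀ b ∈ thresholds, ¬ Memℓp (fun n => a n - b n) 2 →
      (IsIsometricRep (orthantRep a) ∧ IsDoublyCommuting (orthantRep a) ∧
        IsIrreducibleRep (orthantRep a)) ∧
      (IsIsometricRep (orthantRep b) ∧ IsDoublyCommuting (orthantRep b) ∧
        IsIrreducibleRep (orthantRep b)) ∧
      ¬ UnitarilyEquivalent (orthantRep a) (orthantRep b) ∧
      (IsRailway (tensorOne H (orthantRep a)) ∧ IsDoublyCommuting (tensorOne H (orthantRep a))) ∧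
      (IsRailway (tensorOne H (orthantRep b)) ∧ IsDoublyCommuting (tensorOne H (orthantRep b))) ∧
      ∃ P Q : FellSpaceDC L,
        P.IsClassOf (tensorOne H (orthantRep a)) ∧ Q.IsClassOf (tensorOne H (orthantRep b)) ∧
        P ≠ Q ∧ closure {P} = closure {Q}) ∧
    ¬ T0Space (FellSpaceDC L) := by
  constructor
  · intro a ha b hb hab
    have hia := isIrreducibleRep_orthantRep (gaussianProduct_orthant_ne_zero ha)
    have hib := isIrreducibleRep_orthantRep (gaussianProduct_orthant_ne_zero hb)
    have := hia.1
    obtain ⟨P, Q, hP, hQ, hne, hPQ⟩ := exists_inseparable_classes hL hH ha hb hab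
    exact ⟨⟨isIsometricRep_orthantRep a, isDoublyCommuting_orthantRep a, hia⟩,
      ⟨isIsometricRep_orthantRep b, isDoublyCommuting_orthantRep b, hib⟩,
      (areDisjoint_orthantRep hab).not_unitarilyEquivalent,
      ⟨isRailway_tensorOne_orthantRep hH ha, isDoublyCommuting_tensorOne_orthantRep a⟩,
      ⟨isRailway_tensorOne_orthantRep hH hb, isDoublyCommuting_tensorOne_orthantRep b⟩,
      P, Q, hP, hQ, hne, inseparable_iff_closure_eq.1 hPQ⟩
  · intro hT
    obtain ⟨a, ha, b, hb, hab⟩ := exists_thresholds_not_memℓp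
    obtain ⟨P, Q, -, -, hne, hPQ⟩ := exists_inseparable_classes hL hH ha hb hab
    exact hne hPQ.eq

end
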